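/- Let $0<b<\infty$, let $q\in L^1((0,b))$ be real-valued, $\|q\|_1=\int_0^b|q(x)|\,dx$, and let $h\in\mathbb{R}\cup\{\infty\}$. For $z\in\mathbb{C}$ let $u(\cdot,z)$ be a nonzero solution of $-u''+qu=zu$ on $(0,b)$ ($u,u'$ absolutely continuous on $[0,b]$) with $u'(b_-)+hu(b_-)=0$, where $h=\infty$ means $u(b_-)=0$; it is unique up to a constant factor. The Weyl–Titchmarsh function is $m(z)=u'(0_+,z)/u(0_+,z)$, defined where $u(0_+,z)\neq0$. There are a universal constant $D_1>0$ and functions $C_\infty(\cdot,\cdot)$, $C_0(\cdot,\cdot)$, $D_2(\cdot,\cdot,\cdot)$ such that for all such $b,q,h$ there exist real numbers $A_j,B_j$ ($j=1,2,\dots$) and a function $A:(0,\infty)\to\mathbb{R}$ that is integrable on $(0,a)$ for every $a>0$, with the following properties. Say that $(*)$ holds at $\kappa\in\mathbb{C}$ if $m$ is defined at $-\kappa^2$, the series and the integral below converge absolutely, and $$(*)\quad m(-\kappa^2)=-\kappa-\sum_{j=1}^\infty A_j\kappa e^{-2\kappa bj}-\sum_{j=1}^\infty B_je^{-2\kappa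 bj}-\int_0^\infty A(\alpha)e^{-2\alpha\kappa}\,d\alpha .$$ **(General.)** There are constants $C,K_0$ (depending on $b,q,h$) with $|A_j|\le C$ and $|B_j|\le Cj$ for all $j\ge1$, $\int_0^a|A(\alpha)|\,d\alpha\le C e^{K_0a}$ for all $a>0$, and $(*)$ holds whenever $\operatorname{Re}\kappa>\frac12K_0$. **($h=\infty$.)** $(*)$ holds whenever $\operatorname{Re}\kappa>\frac12\|q\|_1$, with $A_j=2$, $B_j=-2j\int_0^bq(x)\,dx$. For all $\alpha>0$, $$|A(\alpha)-A_{1,\infty}(\alpha)|\le\frac{(2\alpha+b)(2\alpha+2b)}{2b^2}\|q\|_1^2\,e^{\alpha\|q\|_1},$$ where $A_{1,\infty}(\alpha)=(n+1)q(\alpha-nb)+n\,q((n+1)b-\alpha)$ for $nb\le\alpha<(n+1)b$, $n=0,1,2,\dots$ (so $A_{1,\infty}=q$ on $(0,b)$). For all $a>0$, $\int_0^a|A(\alpha)|\,d\alpha\le C_\infty(b,\|q\|_1)(1+a^2)e^{a\|q\|_1}$. **($h=0$.)** $(*)$ holds whenever $\operatorname{Re}\kappa>\|q\|_1$, with $A_j=2(-1)^j$,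 $B_j=2(-1)^{j+1}j\int_0^bq(x)\,dx$. For all $\alpha>0$, $$|A(\alpha)-A_{1,0}(\alpha)|\le\frac{(2\alpha+b)(2\alpha+2b)}{b^2}\|q\|_1^2\,e^{2\alpha\|q\|_1},$$ where $A_{1,0}(\alpha)=(-1)^n[(n+1)q(\alpha-nb)-n\,q((n+1)b-\alpha)]$ for $nb\le\alpha<(n+1)b$, $n=0,1,2,\dots$. For all $a>0$, $\int_0^a|A(\alpha)|\,d\alpha\le C_0(b,\|q\|_1)(1+a^2)e^{2a\|q\|_1}$. **(General $h\in\mathbb{R}$.)** $(*)$ holds whenever $\operatorname{Re}\kappa>\frac12D_1(\|q\|_1+|h|+b^{-1}+1)$, with $A_j=2(-1)^j$, $B_j=2(-1)^{j+1}j\left[2h+\int_0^bq(x)\,dx\right]$. For $0<\alpha<b$, $|A(\alpha)-q(\alpha)|\le\|q\|_1^2e^{\alpha\|q\|_1}$. For all $a>0$, $\int_0^a|A(\alpha)|\,d\alpha\le D_2(b,\|q\|_1,h)\,e^{D_1a(\|q\|_1+|h|+b^{-1}+1)}$. Here $q$ is a fixed representative defined at every point (its values at $0$ and $b$ being arbitrary).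 -/

import Mathlib

open MeasureTheory Set
open scoped OnePoint

noncomputable section

/-- The norm `‖q‖₁` of `q` in `L¹((0,b))`. -/
def potentialNorm (b : ℝ) (q : ℝ → ℝ) : ℝ := ∫ x in (0 : ℝ)..b, |q x|

/-- `u` solves `-u'' + q u = z u` on `(0,b)` with `q ∈ L¹((0,b))`, and `du` is its derivative: `u` and
`du = u'` are absolutely continuous on `[0,b]` with `u' = du` and `du' = (q - z) u` almost
everywhere, which is written in integrated form. In particular `u(0₊), u'(0₊), u(b₋), u'(b₋)` are
`u 0`, `du 0`, `u b`, `du b`. -/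
structure IsSchrodingerSolution (b : ℝ) (q : ℝ → ℝ) (z : ℂ) (u du : ℝ → ℂ) : Prop where
  continuousOn : ContinuousOn u (Icc 0 b)
  continuousOn_deriv : ContinuousOn du (Icc 0 b)
  eq_integral : ∀ x ∈ Icc 0 b, u x = u 0 + ∫ t in (0 : ℝ)..x, du t
  deriv_eq_integral : ∀ x ∈ Icc 0 b, du x = du 0 + ∫ t in (0 : ℝ)..x, ((q t : ℂ) - z) * u t

/-- The boundary condition `u'(b₋) + h u(b₋) = 0` for `h ∈ ℝ ∪ {∞}`, where `h = ∞` stands for the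
Dirichlet condition `u(b₋) = 0`. -/
def BoundaryConditionAt (b : ℝ) (h : OnePoint ℝ) (u du : ℝ → ℂ) : Prop :=
  (h = ∞ → u b = 0) ∧ ∀ r : ℝ, h = (r : OnePoint ℝ) → du b + (r : ℂ) * u b = 0

/-- `u` (with derivative `du`) is a nonzero solution of `-u'' + q u = z u` on `(0,b)` satisfying the
boundary condition `h` at `b`. -/
def IsWeylSolution (b : ℝ) (q : ℝ → ℝ) (h : OnePoint ℝ) (z : ℂ) (u du : ℝ → ℂ) : Prop :=
  IsSchrodingerSolution b q z u du ∧ BoundaryConditionAt b h u du ∧ ∃ x ∈ Icc 0 b, u x ≠ 0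

/-- The Weyl-Titchmarsh `m`-function of `(b, q, h)` is defined at `z` (that is, `z` is not a pole) and
has the value `m(z) = w`: nonzero solutions satisfying the boundary condition at `b` exist, and each
of them has `u(0₊) ≠ 0` and `u'(0₊) / u(0₊) = w`. -/
def HasWeylMValue (b : ℝ) (q : ℝ → ℝ) (h : OnePoint ℝ) (z w : ℂ) : Prop :=
  (∃ u du : ℝ → ℂ, IsWeylSolution b q h z u du) ∧
    ∀ u du : ℝ → ℂ, IsWeylSolution b q h z u du → u 0 ≠ 0 ∧ du 0 / u 0 = w

/-- At the point `κ`, both series and the integral converge absolutely, `m(-κ²)` is defined, and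
`m(-κ²) = -κ - ∑_{j≥1} A_j κ e^{-2κbj} - ∑_{j≥1} B_j e^{-2κbj} - ∫₀^∞ A(α) e^{-2ακ} dα`.
The entries `cA 0` and `cB 0` of the coefficient sequences are not used. -/
def HasMExpansion (b : ℝ) (q : ℝ → ℝ) (h : OnePoint ℝ) (cA cB : ℕ → ℝ) (A : ℝ → ℝ) (κ : ℂ) :
    Prop :=
  Summable (fun j : ℕ => (cA (j + 1) : ℂ) * κ * Complex.exp (-2 * κ * b * (j + 1))) ∧
  Summable (fun j : ℕ => (cB (j + 1) : ℂ) * Complex.exp (-2 * κ * b * (j + 1))) ∧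
  IntegrableOn (fun α : ℝ => (A α : ℂ) * Complex.exp (-2 * α * κ)) (Ioi 0) ∧
  HasWeylMValue b q h (-κ ^ 2)
    (-κ - (∑' j : ℕ, (cA (j + 1) : ℂ) * κ * Complex.exp (-2 * κ * b * (j + 1)))
      - (∑' j : ℕ, (cB (j + 1) : ℂ) * Complex.exp (-2 * κ * b * (j + 1)))
      - ∫ α in Ioi (0 : ℝ), (A α : ℂ) * Complex.exp (-2 * α * κ))

/-- The function equal to `(n+1) q(α - nb) + n q((n+1)b - α)` for `nb ≤ α < (n+1)b`,
`n = 0, 1, 2, …` (so equal to `q(α)` for `0 ≤ α < b`). -/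
def firstOrderDirichlet (b : ℝ) (q : ℝ → ℝ) (α : ℝ) : ℝ :=
  (⌊α / b⌋₊ + 1) * q (α - ⌊α / b⌋₊ * b) + ⌊α / b⌋₊ * q ((⌊α / b⌋₊ + 1) * b - α)

/-- The function equal to `(-1)^n [(n+1) q(α - nb) - n q((n+1)b - α)]` for `nb ≤ α < (n+1)b`,
`n = 0, 1, 2, …` (so equal to `q(α)` for `0 ≤ α < b`). -/
def firstOrderNeumann (b : ℝ) (q : ℝ → ℝ) (α : ℝ) : ℝ :=
  (-1) ^ ⌊α / b⌋₊ *
    ((⌊α / b⌋₊ + 1) * q (α - ⌊α / b⌋₊ * b) - ⌊α / b⌋₊ * q ((⌊α / b⌋₊ + 1) * b - α))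

end

/-!
The Weyl solution satisfies a Lippmann–Schwinger equation whose free Green function at energy `-κ²`
is the Laplace transform in `t` of an explicit kernel: the method-of-images solution of the wave
equation on `[0,b]`, which vanishes for `t < |x - y|` and is bounded by a constant `greenBound σ`.
Iterating this equation in the time domain gives a Born series whose terms are bounded by
`tⁿ / n!` times powers of the total variation of the potential. Hence the series converges for
every `t`, grows at an exponential rate proportional to the total variation, and transforms into the
Weyl solution to the right of that rate. A finite boundary constant `r` enters as a point mass
`r δ_b` added to the potential of the Neumann problem.

In the `m`-function, the terms of order zero in the potential give the sum of the `A_j`; those of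
order one are an integral against the square of the free Weyl solution, which gives the `B_j` and
the explicit first-order amplitude; the remaining ones are the Laplace transform of a function that
obeys the Born series bounds.
-/

/-! ### The wave kernel on an interval -/

/-- The position of the `k`-th image of `y` under the reflections at `0` and `b`: the points
`y`, `2b - y`, `2b + y`, `4b - y`, … reached by a wave that starts at `y` and is observed at `0`. -/
noncomputable def imagePosition (b y : ℝ) (k : ℕ) : ℝ :=
  k * b + if Even k then y else b - y

/-- The weight of the `k`-th image when the wave is reflected with coefficient `-1` at `0` and
`-σ` at `b`: `σ = 1` is the Dirichlet and `σ = -1` the Neumann condition at `b`. -/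
noncomputable def imageSign (σ : ℝ) (k : ℕ) : ℝ :=
  (-1) ^ k * σ ^ ((k + 1) / 2)

/-- The method of images: the weighted sum of the translates of `f` by the images of `y`. -/
noncomputable def imageSum (σ b y : ℝ) (f : ℝ → ℝ) (t : ℝ) : ℝ :=
  ∑' k, imageSign σ k * f (t - imagePosition b y k)

/-- Half the indicator function of `(-r, r)`. The fundamental solution of the wave equation on the
half-line, with the Dirichlet condition at `0`, is `halfBump (min x y) (t - max x y)`. -/
noncomputable def halfBump (r t : ℝ) : ℝ := if |t| < r then 1 / 2 else 0

open Classical in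
/-- The wave at position `x` and time `t` caused by a unit impulse at `y` at time `0`, for the free
wave equation on `[0,b]` with the Dirichlet condition at `0`; extended by `0` outside `[0,b]`. -/
noncomputable def greenTime (σ b x y t : ℝ) : ℝ :=
  if x ∈ Icc 0 b ∧ y ∈ Icc 0 b then imageSum σ b (max x y) (halfBump (min x y)) t else 0

/-- A bound for the wave kernel, affine in `σ`: `1 / 2` for `σ = 1` and `1` for `σ = -1`. -/
noncomputable def greenBound (σ : ℝ) : ℝ := (3 - σ) / 4

/-- The bilateral Laplace transform. -/
noncomputable def laplace (κ : ℂ) (f : ℝ → ℝ) : ℂ := ∫ t, (f t : ℂ) * Complex.exp (-κ * t)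

/-- The solution of `u'' = κ² u` satisfying the condition `σ` at `b`, normalized by `u(0) = 1`. -/
noncomputable def freeWeyl (σ b : ℝ) (κ : ℂ) (x : ℝ) : ℂ :=
  (Complex.exp (-κ * x) - σ * Complex.exp (-κ * (2 * b - x))) /
    (1 - σ * Complex.exp (-2 * κ * b))

section Images

variable {σ b y t T : ℝ} {f : ℝ → ℝ}

lemma abs_imageSign_le (hσ : |σ| ≤ 1) (k : ℕ) : |imageSign σ k| ≤ 1 := by
  simpa [imageSign] using pow_le_one₀ (abs_nonneg σ) hσ

lemma imageSign_zero (σ : ℝ) : imageSign σ 0 = 1 := by simp [imageSign]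

lemma imageSign_two_mul (σ : ℝ) (i : ℕ) : imageSign σ (2 * i) = σ ^ i := by
  rw [imageSign, show (2 * i + 1) / 2 = i by omega, pow_mul, neg_one_sq, one_pow, one_mul]

lemma imageSign_two_mul_add_one (σ : ℝ) (i : ℕ) : imageSign σ (2 * i + 1) = -σ ^ (i + 1) := by
  rw [imageSign, show (2 * i + 1 + 1) / 2 = i + 1 by omega, pow_succ, pow_mul]
  simp

lemma imagePosition_zero (b y : ℝ) : imagePosition b y 0 = y := by simp [imagePosition]

lemma imagePosition_two_mul (b y : ℝ) (i : ℕ) : imagePosition b y (2 * i) = 2 * i * b + y := by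
  simp [imagePosition]

lemma imagePosition_two_mul_add_one (b y : ℝ) (i : ℕ) :
    imagePosition b y (2 * i + 1) = 2 * (i + 1) * b - y := by
  simp only [imagePosition, Nat.not_even_two_mul_add_one, if_false]
  push_cast
  ring

lemma mul_sub_abs_le_imagePosition (hb : 0 ≤ b) (y : ℝ) (k : ℕ) :
    k * b - |y| ≤ imagePosition b y k := by
  unfold imagePosition
  split_ifs
  · linarith [neg_abs_le y]
  · linarith [le_abs_self y]

lemma mul_le_imagePosition (hy : y ∈ Icc 0 b) (k : ℕ) : k * b ≤ imagePosition b y k := by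
  unfold imagePosition
  split_ifs
  · linarith [hy.1]
  · linarith [hy.2]

lemma imagePosition_mem_Icc (hy : y ≤ b) (k : ℕ) :
    imagePosition b y k ∈
      Icc (2 * (k / 2 : ℕ) * b + y) (2 * ((k / 2 : ℕ) + 1) * b - y) := by
  obtain ⟨i, rfl | rfl⟩ := Nat.even_or_odd' k
  · rw [imagePosition_two_mul, show 2 * i / 2 = i by omega]
    constructor <;> linarith
  · rw [imagePosition_two_mul_add_one, show (2 * i + 1) / 2 = i by omega]
    constructor <;> linarith

lemma le_imagePosition (hy : y ∈ Icc 0 b) (k : ℕ) : y ≤ imagePosition b y k := by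
  have hb : 0 ≤ b := hy.1.trans hy.2
  have hk : (0 : ℝ) ≤ 2 * (k / 2 : ℕ) * b := by positivity
  linarith [(imagePosition_mem_Icc hy.2 k).1]

lemma two_mul_sub_le_imagePosition (hy : y ∈ Icc 0 b) {k : ℕ} (hk : k ≠ 0) :
    2 * b - y ≤ imagePosition b y k := by
  have hb : 0 ≤ b := hy.1.trans hy.2
  obtain rfl | hk : k = 1 ∨ 2 ≤ k := by omega
  · simp only [imagePosition, Nat.not_even_one, if_false, Nat.cast_one]
    linarith
  · have hk : (2 : ℝ) ≤ k := by exact_mod_cast hk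
    linarith [mul_le_imagePosition hy k, mul_le_mul_of_nonneg_right hk hb, hy.1]

lemma lt_mul_of_floor_div_lt (hb : 0 < b) {k : ℕ} (hk : ⌊t / b⌋₊ < k) : t < k * b :=
  (div_lt_iff₀ hb).1 (Nat.lt_of_floor_lt hk)

lemma summable_imageSum (hb : 0 < b) (y : ℝ) (hf : ∀ t < T, f t = 0) (t : ℝ) :
    Summable fun k => imageSign σ k * f (t - imagePosition b y k) := by
  refine summable_of_ne_finset_zero (s := Finset.range (⌊(t + |y| - T) / b⌋₊ + 1)) fun k hk => ?_
  have hk : t + |y| - T < k * b := lt_mul_of_floor_div_lt hb (by simpa using hk)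
  rw [hf _ (by linarith [mul_sub_abs_le_imagePosition hb.le y k]), mul_zero]

lemma abs_imageSum_le (hσ : |σ| ≤ 1) (hb : 0 < b) (hy : y ∈ Icc 0 b) (hf : ∀ t < 0, f t = 0)
    (t : ℝ) :
    |imageSum σ b y f t| ≤ ∑ k ∈ Finset.range (⌊t / b⌋₊ + 1), |f (t - imagePosition b y k)| := by
  rw [imageSum, tsum_eq_sum (s := Finset.range (⌊t / b⌋₊ + 1)) fun k hk => ?_]
  · refine (Finset.abs_sum_le_sum_abs _ _).trans (Finset.sum_le_sum fun k _ => ?_)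
    rw [abs_mul]
    exact mul_le_of_le_one_left (abs_nonneg _) (abs_imageSign_le hσ k)
  · have hk : t < k * b := lt_mul_of_floor_div_lt hb (by simpa using hk)
    rw [hf _ (by linarith [mul_le_imagePosition hy k]), mul_zero]

lemma imageSum_eq_of_le (hy : y ∈ Icc 0 b) (hf : ∀ t ≤ T, f t = 0) (ht : t - (2 * b - y) ≤ T) :
    imageSum σ b y f t = f (t - y) := by
  rw [imageSum, tsum_eq_single 0 fun k hk => ?_]
  · rw [imageSign_zero, imagePosition_zero, one_mul]
  · rw [hf _ (by linarith [two_mul_sub_le_imagePosition hy hk]), mul_zero]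

lemma imageSum_eq_zero (hy : y ∈ Icc 0 b) (hf : ∀ t ≤ T, f t = 0) (ht : t - y ≤ T) :
    imageSum σ b y f t = 0 := by
  rw [imageSum_eq_of_le hy hf (by linarith [hy.2]), hf _ ht]

lemma imageSum_zero (σ b y t : ℝ) : imageSum σ b y (fun _ => 0) t = 0 := by simp [imageSum]

end Images

section GreenTime

variable {σ b r t x y : ℝ}

lemma halfBump_eq_zero (h : r ≤ |t|) : halfBump r t = 0 := if_neg h.not_gt

lemma halfBump_eq_zero_of_le_neg (h : t ≤ -r) : halfBump r t = 0 :=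
  halfBump_eq_zero (by linarith [neg_le_abs t])

lemma halfBump_mem_Icc (r t : ℝ) : halfBump r t ∈ Icc 0 (1 / 2) := by
  unfold halfBump
  split_ifs <;> norm_num

lemma greenBound_one : greenBound 1 = 1 / 2 := by norm_num [greenBound]

lemma greenBound_neg_one : greenBound (-1) = 1 := by norm_num [greenBound]

lemma half_le_greenBound (hσ : |σ| ≤ 1) : 1 / 2 ≤ greenBound σ := by
  unfold greenBound
  linarith [(abs_le.1 hσ).2]

lemma greenBound_nonneg (hσ : |σ| ≤ 1) : 0 ≤ greenBound σ :=
  one_half_pos.le.trans (half_le_greenBound hσ)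

lemma greenBound_le_one (hσ : |σ| ≤ 1) : greenBound σ ≤ 1 := by
  unfold greenBound
  linarith [(abs_le.1 hσ).1]

lemma halfBump_sub_imagePosition_eq_zero (hb : 0 < b) (hry : r ≤ y) (hy : y ≤ b) {k : ℕ}
    (hk : k / 2 ≠ ⌊t / (2 * b)⌋₊) : halfBump r (t - imagePosition b y k) = 0 := by
  obtain ⟨hlow, hupp⟩ := imagePosition_mem_Icc hy k
  apply halfBump_eq_zero
  rcases hk.lt_or_gt with hk | hk
  · have ht : ((k / 2 + 1 : ℕ) : ℝ) ≤ t / (2 * b) := (Nat.le_floor_iff' (Nat.succ_ne_zero _)).1 hk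
    rw [le_div_iff₀ (by positivity)] at ht
    push_cast at ht
    linarith [le_abs_self (t - imagePosition b y k)]
  · have ht := lt_mul_of_floor_div_lt (by positivity) hk
    linarith [neg_le_abs (t - imagePosition b y k)]

lemma imageSum_halfBump (hb : 0 < b) (hry : r ≤ y) (hy : y ≤ b) (t : ℝ) :
    ∃ j : ℕ, ∃ v ∈ Icc (0 : ℝ) (1 / 2), ∃ w ∈ Icc (0 : ℝ) (1 / 2),
      imageSum σ b y (halfBump r) t = σ ^ j * (v - σ * w) := by
  set j := ⌊t / (2 * b)⌋₊
  refine ⟨j, _, halfBump_mem_Icc r (t - imagePosition b y (2 * j)), _,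
    halfBump_mem_Icc r (t - imagePosition b y (2 * j + 1)), ?_⟩
  rw [imageSum, tsum_eq_sum (s := {2 * j, 2 * j + 1}) fun k hk => ?_]
  · rw [Finset.sum_pair (by omega), imageSign_two_mul, imageSign_two_mul_add_one]
    ring
  · rw [Finset.mem_insert, Finset.mem_singleton] at hk
    rw [halfBump_sub_imagePosition_eq_zero hb hry hy (by omega), mul_zero]

lemma abs_imageSum_halfBump_le (hσ : |σ| ≤ 1) (hb : 0 < b) (hry : r ≤ y) (hy : y ≤ b) (t : ℝ) :
    |imageSum σ b y (halfBump r) t| ≤ greenBound σ := by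
  obtain ⟨j, v, hv, w, hw, h⟩ := imageSum_halfBump (σ := σ) hb hry hy t
  rw [h, abs_mul, abs_pow]
  refine (mul_le_of_le_one_left (abs_nonneg _) (pow_le_one₀ (abs_nonneg σ) hσ)).trans ?_
  obtain ⟨h1, h2⟩ := abs_le.1 hσ
  rw [greenBound, abs_le]
  constructor <;> nlinarith [hv.1, hv.2, hw.1, hw.2]

lemma max_mem_Icc (hx : x ∈ Icc 0 b) (hy : y ∈ Icc 0 b) : max x y ∈ Icc 0 b :=
  ⟨hx.1.trans (le_max_left _ _), max_le hx.2 hy.2⟩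

lemma greenTime_of_left_notMem (hx : x ∉ Icc 0 b) (y t : ℝ) : greenTime σ b x y t = 0 :=
  if_neg fun h => hx h.1

lemma greenTime_of_right_notMem (hy : y ∉ Icc 0 b) (x t : ℝ) : greenTime σ b x y t = 0 :=
  if_neg fun h => hy h.2

lemma abs_greenTime_le (hσ : |σ| ≤ 1) (hb : 0 < b) (x y t : ℝ) :
    |greenTime σ b x y t| ≤ greenBound σ := by
  unfold greenTime
  split_ifs with h
  · exact abs_imageSum_halfBump_le hσ hb min_le_max (max_le h.1.2 h.2.2) t
  · rw [abs_zero]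
    exact greenBound_nonneg hσ

lemma greenTime_eq_zero (ht : t ≤ |x - y|) : greenTime σ b x y t = 0 := by
  unfold greenTime
  split_ifs with h
  · refine imageSum_eq_zero (max_mem_Icc h.1 h.2) (T := -min x y)
      (fun s => halfBump_eq_zero_of_le_neg) ?_
    linarith [max_sub_min_eq_abs' x y]
  · rfl

lemma greenTime_of_nonpos (ht : t ≤ 0) : greenTime σ b x y t = 0 :=
  greenTime_eq_zero (ht.trans (abs_nonneg _))

lemma abs_greenTime_le_half (ht : t ≤ 2 * b - x - y) : |greenTime σ b x y t| ≤ 1 / 2 := by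
  unfold greenTime
  split_ifs with h
  · rw [imageSum_eq_of_le (max_mem_Icc h.1 h.2) (T := -min x y)
      (fun s => halfBump_eq_zero_of_le_neg) (by linarith [max_add_min x y]),
      abs_of_nonneg (halfBump_mem_Icc _ _).1]
    exact (halfBump_mem_Icc _ _).2
  · simp

lemma measurable_tsum_of_summable {α : Type*} [MeasurableSpace α] {f : ℕ → α → ℝ}
    (hf : ∀ k, Measurable (f k)) (hs : ∀ x, Summable fun k => f k x) :
    Measurable fun x => ∑' k, f k x :=
  measurable_of_tendsto_metrizable (f := fun n x => ∑ k ∈ Finset.range n, f k x)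
    (fun _ => Finset.measurable_fun_sum _ fun k _ => hf k)
    (tendsto_pi_nhds.2 fun x => (hs x).hasSum.tendsto_sum_nat)

lemma measurable_halfBump : Measurable fun p : ℝ × ℝ => halfBump p.1 p.2 :=
  Measurable.ite (measurableSet_lt (by fun_prop) (by fun_prop)) measurable_const measurable_const

lemma measurable_imagePosition (b : ℝ) (k : ℕ) : Measurable fun y => imagePosition b y k := by
  unfold imagePosition
  split_ifs <;> fun_prop

lemma measurable_greenTime (σ : ℝ) (hb : 0 < b) :
    Measurable fun p : ℝ × ℝ × ℝ => greenTime σ b p.1 p.2.1 p.2.2 := by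
  refine Measurable.ite ?_ (measurable_tsum_of_summable (fun k => ?_) fun p => ?_) measurable_const
  · exact (measurable_fst measurableSet_Icc).inter (measurable_snd.fst measurableSet_Icc)
  · exact measurable_const.mul (measurable_halfBump.comp (Measurable.prodMk (by fun_prop)
      (measurable_snd.snd.sub ((measurable_imagePosition b k).comp (by fun_prop)))))
  · exact summable_imageSum hb _ (T := -min p.1 p.2.1)
      (fun s hs => halfBump_eq_zero_of_le_neg hs.le) _

end GreenTime

section LaplaceGreenTime

variable {σ b : ℝ} {κ : ℂ}

lemma norm_exp_neg_lt_one (hb : 0 < b) (hκ : 0 < κ.re) : ‖Complex.exp (-2 * κ * b)‖ < 1 := by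
  have hre : (-2 * κ * b).re = -2 * (κ.re * b) := by simp [mul_assoc]
  rw [Complex.norm_exp, Real.exp_lt_one_iff, hre]
  linarith [mul_pos hκ hb]

lemma norm_mul_exp_neg_lt_one (hσ : |σ| ≤ 1) (hb : 0 < b) (hκ : 0 < κ.re) :
    ‖(σ : ℂ) * Complex.exp (-2 * κ * b)‖ < 1 := by
  rw [norm_mul, Complex.norm_real]
  exact (mul_le_of_le_one_left (norm_nonneg _) hσ).trans_lt (norm_exp_neg_lt_one hb hκ)

lemma hasSum_freeWeyl (hσ : |σ| ≤ 1) (hb : 0 < b) (hκ : 0 < κ.re) (y : ℝ) :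
    HasSum (fun k => (imageSign σ k : ℂ) * Complex.exp (-κ * imagePosition b y k))
      (freeWeyl σ b κ y) := by
  have hgeom := hasSum_geometric_of_norm_lt_one (norm_mul_exp_neg_lt_one hσ hb hκ)
  have hpow : ∀ i : ℕ, ((σ : ℂ) * Complex.exp (-2 * κ * b)) ^ i =
      σ ^ i * Complex.exp (i * (-2 * κ * b)) := fun i => by rw [mul_pow, Complex.exp_nat_mul]
  have heven : ∀ i : ℕ, Complex.exp (-κ * y) * (σ * Complex.exp (-2 * κ * b)) ^ i =
      imageSign σ (2 * i) * Complex.exp (-κ * imagePosition b y (2 * i)) := fun i => by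
    rw [imageSign_two_mul, imagePosition_two_mul, hpow, mul_left_comm, ← Complex.exp_add]
    push_cast
    ring_nf
  have hodd : ∀ i : ℕ,
      -(σ * Complex.exp (-κ * (2 * b - y))) * (σ * Complex.exp (-2 * κ * b)) ^ i =
        imageSign σ (2 * i + 1) * Complex.exp (-κ * imagePosition b y (2 * i + 1)) := fun i => by
    rw [imageSign_two_mul_add_one, imagePosition_two_mul_add_one, hpow, neg_mul,
      mul_mul_mul_comm, ← Complex.exp_add]
    push_cast
    ring_nf
  rw [freeWeyl, sub_div, sub_eq_add_neg, div_eq_mul_inv, div_eq_mul_inv, ← neg_mul]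
  exact HasSum.even_add_odd (by simpa only [heven] using hgeom.mul_left (Complex.exp (-κ * y)))
    (by simpa only [hodd] using hgeom.mul_left (-(σ * Complex.exp (-κ * (2 * b - y)))))

lemma mul_exp_eq_shift (c : ℂ) (d t v : ℝ) :
    c * v * Complex.exp (-κ * t) =
      c * Complex.exp (-κ * d) * (v * Complex.exp (-κ * (t - d : ℝ))) := by
  rw [mul_mul_mul_comm, ← Complex.exp_add]
  push_cast
  ring_nf

lemma laplace_imageSum (hσ : |σ| ≤ 1) (hb : 0 < b) (hκ : 0 < κ.re) (y : ℝ) {f : ℝ → ℝ}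
    (hf : Integrable fun t : ℝ => (f t : ℂ) * Complex.exp (-κ * t)) :
    laplace κ (imageSum σ b y f) = freeWeyl σ b κ y * laplace κ f := by
  set c : ℕ → ℂ := fun k => imageSign σ k * Complex.exp (-κ * imagePosition b y k)
  set F : ℕ → ℝ → ℂ := fun k t => c k * ((f (t - imagePosition b y k) : ℂ) *
    Complex.exp (-κ * (t - imagePosition b y k : ℝ)))
  have hc : HasSum c (freeWeyl σ b κ y) := hasSum_freeWeyl hσ hb hκ y
  have hF_int : ∀ k, ∫ t, F k t = c k * laplace κ f := fun k => by
    rw [integral_const_mul,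
      integral_sub_right_eq_self (fun t : ℝ => (f t : ℂ) * Complex.exp (-κ * t)), laplace]
  have hF_norm : ∀ k, ∫ t, ‖F k t‖ = ‖c k‖ * ∫ t : ℝ, ‖(f t : ℂ) * Complex.exp (-κ * t)‖ := by
    intro k
    simp only [F, norm_mul (c k)]
    rw [integral_const_mul,
      integral_sub_right_eq_self (fun t : ℝ => ‖(f t : ℂ) * Complex.exp (-κ * t)‖)]
  have hF_tsum : HasSum (fun k => ∫ t, F k t) (∫ t, ∑' k, F k t) :=
    hasSum_integral_of_summable_integral_norm (fun k => (hf.comp_sub_right _).const_mul _)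
      (by simp only [hF_norm]; exact (summable_norm_iff.2 hc.summable).mul_right _)
  simp only [hF_int] at hF_tsum
  rw [(hc.mul_right _).unique hF_tsum]
  refine integral_congr_ae (.of_forall fun t => ?_)
  dsimp only [imageSum]
  rw [Complex.ofReal_tsum, ← tsum_mul_right]
  congr 1 with k
  rw [Complex.ofReal_mul, mul_exp_eq_shift]

lemma halfBump_mul_exp_eq (r : ℝ) (κ : ℂ) :
    (fun t : ℝ => (halfBump r t : ℂ) * Complex.exp (-κ * t)) =
      indicator (Ioo (-r) r) fun t : ℝ => 1 / 2 * Complex.exp (-κ * t) := by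
  ext t
  simp only [halfBump, indicator, mem_Ioo, ← abs_lt]
  split_ifs <;> simp

lemma integrable_halfBump_mul_exp (r : ℝ) (κ : ℂ) :
    Integrable fun t : ℝ => (halfBump r t : ℂ) * Complex.exp (-κ * t) := by
  rw [halfBump_mul_exp_eq, integrable_indicator_iff measurableSet_Ioo]
  have hcont : Continuous fun t : ℝ => 1 / 2 * Complex.exp (-κ * t) := by fun_prop
  exact hcont.integrableOn_Icc.mono_set Ioo_subset_Icc_self

lemma laplace_halfBump {r : ℝ} (hr : 0 ≤ r) (hκ : κ ≠ 0) :
    laplace κ (halfBump r) = Complex.sinh (κ * r) / κ := by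
  rw [laplace, halfBump_mul_exp_eq, integral_indicator measurableSet_Ioo,
    ← integral_Ioc_eq_integral_Ioo, ← intervalIntegral.integral_of_le (by linarith),
    intervalIntegral.integral_const_mul, integral_exp_mul_complex (neg_ne_zero.2 hκ), Complex.sinh]
  push_cast
  field_simp
  ring_nf

lemma ne_zero_of_re_pos (hκ : 0 < κ.re) : κ ≠ 0 := fun h => by simp [h] at hκ

lemma laplace_greenTime {x y : ℝ} (hσ : |σ| ≤ 1) (hb : 0 < b) (hκ : 0 < κ.re)
    (hx : x ∈ Icc 0 b) (hy : y ∈ Icc 0 b) :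
    laplace κ (greenTime σ b x y) =
      Complex.sinh (κ * (min x y : ℝ)) / κ * freeWeyl σ b κ (max x y) := by
  have himages : greenTime σ b x y = imageSum σ b (max x y) (halfBump (min x y)) :=
    funext fun t => if_pos ⟨hx, hy⟩
  rw [himages, laplace_imageSum hσ hb hκ _ (integrable_halfBump_mul_exp _ _),
    laplace_halfBump (le_min hx.1 hy.1) (ne_zero_of_re_pos hκ), mul_comm]

end LaplaceGreenTime

/-! ### The Born series in the time domain -/

/-- The terms of the Born series, in the time domain, for the wave equation with the potential
`s • ν`: the coefficient of order `n + 1` of the wave at `x`, without the incident wave. -/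
noncomputable def bornTerm (σ b : ℝ) (ν : Measure ℝ) (s : ℝ → ℝ) : ℕ → ℝ → ℝ → ℝ
  | 0, x, t => -∫ y, imageSum σ b y (greenTime σ b x y) t * s y ∂ν
  | n + 1, x, t => -∫ y, (∫ u, bornTerm σ b ν s n y u * greenTime σ b x y (t - u)) * s y ∂ν

/-- The scattered wave: the sum of the Born series. -/
noncomputable def bornSum (σ b : ℝ) (ν : Measure ℝ) (s : ℝ → ℝ) (x t : ℝ) : ℝ :=
  ∑' n, bornTerm σ b ν s n x t

/-- The time-domain contribution to the `m`-function of all terms of order at least two in the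
potential. -/
noncomputable def bornRemainder (σ b : ℝ) (ν : Measure ℝ) (s : ℝ → ℝ) (t : ℝ) : ℝ :=
  ∫ y, imageSum σ b y (bornSum σ b ν s y) t * s y ∂ν

/-- The exponential growth rate of the Born series. -/
noncomputable def bornRate (σ : ℝ) (ν : Measure ℝ) : ℝ := greenBound σ * ν.real univ

section IntegralBounds

variable {t B : ℝ}

lemma abs_integral_mul_le {α : Type*} [MeasurableSpace α] {ν : Measure α} [IsFiniteMeasure ν]
    {f s : α → ℝ} {S : Set α} (hs : ∀ y, |s y| ≤ 1) (hS : MeasurableSet S) (hB : 0 ≤ B)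
    (hf : ∀ y, f y ≠ 0 → y ∈ S ∧ |f y| ≤ B) : |∫ y, f y * s y ∂ν| ≤ B * ν.real S := by
  have hint : ‖∫ y, f y * s y ∂ν‖ ≤ ∫ y, S.indicator (fun _ => B) y ∂ν := by
    refine norm_integral_le_of_norm_le ((integrable_const B).indicator hS) (.of_forall fun y => ?_)
    by_cases hy : f y = 0
    · simpa [hy] using indicator_nonneg (fun _ _ => hB) y
    · rw [indicator_of_mem (hf y hy).1, norm_mul]
      exact (mul_le_of_le_one_right (norm_nonneg _) (hs y)).trans (hf y hy).2
  rwa [integral_indicator hS, setIntegral_const, smul_eq_mul, mul_comm] at hint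

lemma abs_integral_le_pow_div_factorial {f : ℝ → ℝ} {n : ℕ} (ht : 0 ≤ t) (hB : 0 ≤ B)
    (hf : ∀ u, f u ≠ 0 → u ∈ Icc 0 t ∧ |f u| ≤ B * (u ^ n / n.factorial)) :
    |∫ u, f u| ≤ B * (t ^ (n + 1) / (n + 1).factorial) := by
  have hint : ‖∫ u, f u‖ ≤ ∫ u, (Icc 0 t).indicator (fun u => B * (u ^ n / n.factorial)) u := by
    refine norm_integral_le_of_norm_le ?_ (.of_forall fun u => ?_)
    · rw [integrable_indicator_iff measurableSet_Icc]
      exact (by fun_prop : Continuous fun u : ℝ => B * (u ^ n / n.factorial)).integrableOn_Icc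
    by_cases hu : f u = 0
    · rw [hu, norm_zero]
      exact indicator_nonneg
        (fun u hu => mul_nonneg hB (div_nonneg (pow_nonneg hu.1 n) (Nat.cast_nonneg _))) u
    · rw [indicator_of_mem (hf u hu).1]
      exact (hf u hu).2
  rw [integral_indicator measurableSet_Icc, integral_Icc_eq_integral_Ioc,
    ← intervalIntegral.integral_of_le ht, intervalIntegral.integral_const_mul,
    intervalIntegral.integral_div, integral_pow] at hint
  refine hint.trans_eq ?_
  rw [Nat.factorial_succ]
  push_cast
  field_simp
  simp

lemma hasSum_pow_succ_mul_pow_div_factorial (a d t : ℝ) :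
    HasSum (fun n : ℕ => a ^ (n + 1) * d * (t ^ n / n.factorial)) (a * d * Real.exp (a * t)) := by
  have hexp := (NormedSpace.expSeries_div_hasSum_exp (𝔸 := ℝ) (a * t)).mul_left (a * d)
  have hterm : ∀ n : ℕ, a * d * ((a * t) ^ n / n.factorial) =
      a ^ (n + 1) * d * (t ^ n / n.factorial) := fun n => by rw [mul_pow, pow_succ]; ring
  simpa only [hterm, ← Real.exp_eq_exp_ℝ] using hexp

lemma sum_range_const_sub (a : ℝ) (n : ℕ) :
    ∑ k ∈ Finset.range n, (a - k) = n * a - n * (n - 1) / 2 := by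
  induction n with
  | zero => simp
  | succ n ih =>
    rw [Finset.sum_range_succ, ih]
    push_cast
    ring

end IntegralBounds

section FirstBornKernel

variable {σ b t x y : ℝ}

lemma imageSum_greenTime_of_notMem (hy : y ∉ Icc 0 b) (x t : ℝ) :
    imageSum σ b y (greenTime σ b x y) t = 0 := by
  rw [funext (greenTime_of_right_notMem hy x), imageSum_zero]

lemma mem_of_imageSum_greenTime_ne_zero (h : imageSum σ b y (greenTime σ b x y) t ≠ 0) :
    y ∈ Icc 0 b ∧ y < t - |x - y| := by
  have hy : y ∈ Icc 0 b := by
    by_contra hy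
    exact h (imageSum_greenTime_of_notMem hy x t)
  refine ⟨hy, ?_⟩
  by_contra! ht
  exact h (imageSum_eq_zero hy (fun _ => greenTime_eq_zero) (by linarith))

lemma abs_imageSum_greenTime_le (hσ : |σ| ≤ 1) (hb : 0 < b) (hy : y ∈ Icc 0 b) (x t : ℝ) :
    |imageSum σ b y (greenTime σ b x y) t| ≤ greenBound σ * (⌊t / b⌋₊ + 1) := by
  refine (abs_imageSum_le hσ hb hy (fun u hu => greenTime_of_nonpos hu.le) t).trans ?_
  refine (Finset.sum_le_sum fun k _ => abs_greenTime_le hσ hb _ _ _).trans_eq ?_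
  simp [mul_comm]

lemma abs_imageSum_greenTime_le_half (hy : y ∈ Icc 0 b) (ht : t ≤ 2 * b - x) :
    |imageSum σ b y (greenTime σ b x y) t| ≤ 1 / 2 := by
  rw [imageSum_eq_of_le hy (T := |x - y|) (fun _ => greenTime_eq_zero)
    (by linarith [neg_le_abs (x - y)])]
  exact abs_greenTime_le_half (by linarith)

end FirstBornKernel

section BornMeasurability

variable {α : Type*} [MeasurableSpace α] {σ b : ℝ} {ν : Measure ℝ} [IsFiniteMeasure ν] {s : ℝ → ℝ}

lemma measurable_greenTime_comp (hb : 0 < b) {x y t : α → ℝ} (hx : Measurable x)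
    (hy : Measurable y) (ht : Measurable t) :
    Measurable fun a => greenTime σ b (x a) (y a) (t a) :=
  (measurable_greenTime σ hb).comp (hx.prodMk (hy.prodMk ht))

lemma measurable_imageSum (hb : 0 < b) {y t : α → ℝ} {f : α → ℝ → ℝ} (hy : Measurable y)
    (ht : Measurable t) (hf : Measurable fun p : α × ℝ => f p.1 p.2)
    (hf0 : ∀ a, ∀ t < 0, f a t = 0) : Measurable fun a => imageSum σ b (y a) (f a) (t a) :=
  measurable_tsum_of_summable (fun k => measurable_const.mul (hf.comp (measurable_id.prodMk
    (ht.sub ((measurable_imagePosition b k).comp hy))))) fun a => summable_imageSum hb _ (hf0 a) _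

lemma measurable_integral_mul (hs : Measurable s) {f : ℝ × ℝ × ℝ → ℝ} (hf : Measurable f) :
    Measurable fun p : ℝ × ℝ => ∫ y, f (p.1, y, p.2) * s y ∂ν := by
  have hfs : Measurable fun p : (ℝ × ℝ) × ℝ => f (p.1.1, p.2, p.1.2) * s p.2 :=
    (hf.comp (by fun_prop)).mul (hs.comp measurable_snd)
  exact hfs.stronglyMeasurable.integral_prod_right'.measurable

lemma measurable_imageSum_greenTime (hb : 0 < b) : Measurable fun p : ℝ × ℝ × ℝ =>
    imageSum σ b p.2.1 (greenTime σ b p.1 p.2.1) p.2.2 :=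
  measurable_imageSum hb (f := fun p : ℝ × ℝ × ℝ => greenTime σ b p.1 p.2.1) (by fun_prop)
    (by fun_prop) (measurable_greenTime_comp hb (by fun_prop) (by fun_prop) (by fun_prop))
    fun _ _ ht => greenTime_of_nonpos ht.le

lemma measurable_convolution_greenTime (hb : 0 < b) {f : ℝ → ℝ → ℝ}
    (hf : Measurable fun p : ℝ × ℝ => f p.1 p.2) :
    Measurable fun p : ℝ × ℝ × ℝ => ∫ u, f p.2.1 u * greenTime σ b p.1 p.2.1 (p.2.2 - u) := by
  have hfG : Measurable fun p : (ℝ × ℝ × ℝ) × ℝ =>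
      f p.1.2.1 p.2 * greenTime σ b p.1.1 p.1.2.1 (p.1.2.2 - p.2) :=
    (hf.comp (by fun_prop : Measurable fun p : (ℝ × ℝ × ℝ) × ℝ => (p.1.2.1, p.2))).mul
      (measurable_greenTime_comp hb (by fun_prop) (by fun_prop) (by fun_prop))
  exact hfG.stronglyMeasurable.integral_prod_right'.measurable

lemma measurable_bornTerm (hb : 0 < b) (hs : Measurable s) (n : ℕ) :
    Measurable fun p : ℝ × ℝ => bornTerm σ b ν s n p.1 p.2 := by
  induction n with
  | zero => exact (measurable_integral_mul hs (measurable_imageSum_greenTime hb)).neg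
  | succ n ih => exact (measurable_integral_mul hs (measurable_convolution_greenTime hb ih)).neg

end BornMeasurability

section BornSupport

variable {σ b t x y u : ℝ} {ν : Measure ℝ} {s : ℝ → ℝ}

lemma bornTerm_of_notMem (hx : x ∉ Icc 0 b) (n : ℕ) (t : ℝ) : bornTerm σ b ν s n x t = 0 := by
  have hG : ∀ y, greenTime σ b x y = fun _ => 0 := fun y => funext (greenTime_of_left_notMem hx y)
  cases n <;> simp [bornTerm, hG, imageSum_zero]

/-- A wave scattered at `y` travels from `0` to `y` and then from `y` to `x`. -/
lemma bornTerm_eq_zero (ht : t ≤ x) (n : ℕ) : bornTerm σ b ν s n x t = 0 := by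
  induction n generalizing x t with
  | zero =>
    rw [bornTerm, neg_eq_zero]
    refine integral_eq_zero_of_ae (.of_forall fun y => ?_)
    have hK : imageSum σ b y (greenTime σ b x y) t = 0 := by
      by_contra h
      linarith [(mem_of_imageSum_greenTime_ne_zero h).2, le_abs_self (x - y)]
    simp only [hK, zero_mul, Pi.zero_apply]
  | succ n ih =>
    have hconv : ∀ y u, bornTerm σ b ν s n y u * greenTime σ b x y (t - u) = 0 := fun y u => by
      rcases le_total u y with hu | hu
      · rw [ih hu, zero_mul]
      · rw [greenTime_eq_zero (by linarith [le_abs_self (x - y)]), mul_zero]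
    simp [bornTerm, hconv]

lemma bornTerm_of_nonpos (ht : t ≤ 0) (n : ℕ) : bornTerm σ b ν s n x t = 0 := by
  by_cases hx : x ∈ Icc 0 b
  · exact bornTerm_eq_zero (ht.trans hx.1) n
  · exact bornTerm_of_notMem hx n t

lemma mem_of_bornTerm_mul_greenTime_ne_zero {n : ℕ}
    (h : bornTerm σ b ν s n y u * greenTime σ b x y (t - u) ≠ 0) :
    y ∈ Icc 0 b ∧ y < u ∧ u < t - |x - y| := by
  refine ⟨?_, ?_, ?_⟩ <;> contrapose! h
  · rw [bornTerm_of_notMem h, zero_mul]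
  · rw [bornTerm_eq_zero h, zero_mul]
  · rw [greenTime_eq_zero (by linarith), mul_zero]

lemma mem_Icc_of_bornTerm_mul_greenTime_ne_zero {n : ℕ}
    (h : bornTerm σ b ν s n y u * greenTime σ b x y (t - u) ≠ 0) : u ∈ Icc 0 t := by
  obtain ⟨hy, hyu, hut⟩ := mem_of_bornTerm_mul_greenTime_ne_zero h
  exact ⟨hy.1.trans hyu.le, by linarith [abs_nonneg (x - y)]⟩

lemma bornSum_of_notMem (hx : x ∉ Icc 0 b) (t : ℝ) : bornSum σ b ν s x t = 0 := by
  simp [bornSum, bornTerm_of_notMem hx]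

lemma bornSum_eq_zero (ht : t ≤ x) : bornSum σ b ν s x t = 0 := by
  simp [bornSum, bornTerm_eq_zero ht]

lemma bornSum_of_nonpos (ht : t ≤ 0) : bornSum σ b ν s x t = 0 := by
  simp [bornSum, bornTerm_of_nonpos ht]

lemma mem_of_imageSum_bornSum_ne_zero (h : imageSum σ b y (bornSum σ b ν s y) t ≠ 0) :
    y ∈ Icc 0 b ∧ 2 * y < t := by
  have hy : y ∈ Icc 0 b := by
    by_contra hy
    rw [funext (bornSum_of_notMem hy), imageSum_zero] at h
    exact h rfl
  refine ⟨hy, ?_⟩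
  by_contra! ht
  exact h (imageSum_eq_zero hy (fun _ => bornSum_eq_zero) (by linarith))

lemma imageSum_bornSum_of_nonpos (ht : t ≤ 0) : imageSum σ b y (bornSum σ b ν s y) t = 0 := by
  by_contra h
  obtain ⟨hy, hyt⟩ := mem_of_imageSum_bornSum_ne_zero h
  linarith [hy.1]

lemma bornRemainder_of_nonpos (ht : t ≤ 0) : bornRemainder σ b ν s t = 0 := by
  simp [bornRemainder, imageSum_bornSum_of_nonpos ht]

lemma bornRate_nonneg (hσ : |σ| ≤ 1) : 0 ≤ bornRate σ ν :=
  mul_nonneg (greenBound_nonneg hσ) measureReal_nonneg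

end BornSupport

section BornBounds

variable {σ b t x y : ℝ} {ν : Measure ℝ} [IsFiniteMeasure ν] {s : ℝ → ℝ}

lemma abs_bornTerm_le (hσ : |σ| ≤ 1) (hb : 0 < b) (hs : ∀ y, |s y| ≤ 1) (n : ℕ) (ht : 0 ≤ t) :
    |bornTerm σ b ν s n x t| ≤
      bornRate σ ν ^ (n + 1) * (⌊t / b⌋₊ + 1) * (t ^ n / n.factorial) := by
  have hG := greenBound_nonneg hσ
  have hR : 0 ≤ bornRate σ ν := bornRate_nonneg hσ
  induction n generalizing x t with
  | zero =>
    rw [bornTerm, abs_neg]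
    refine (abs_integral_mul_le hs MeasurableSet.univ (B := greenBound σ * (⌊t / b⌋₊ + 1))
      (by positivity) fun y hy => ⟨mem_univ y, abs_imageSum_greenTime_le hσ hb
        (mem_of_imageSum_greenTime_ne_zero hy).1 x t⟩).trans_eq ?_
    simp only [bornRate, zero_add, pow_one, pow_zero, Nat.factorial_zero, Nat.cast_one]
    ring
  | succ n ih =>
    set B := greenBound σ * bornRate σ ν ^ (n + 1) * (⌊t / b⌋₊ + 1)
    have hB : 0 ≤ B := by positivity
    have hconv : ∀ y, |∫ u, bornTerm σ b ν s n y u * greenTime σ b x y (t - u)| ≤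
        B * (t ^ (n + 1) / (n + 1).factorial) := fun y => by
      refine abs_integral_le_pow_div_factorial ht hB fun u hu => ?_
      obtain ⟨hu0, hut⟩ := mem_Icc_of_bornTerm_mul_greenTime_ne_zero hu
      refine ⟨⟨hu0, hut⟩, ?_⟩
      rw [abs_mul, mul_comm]
      calc |greenTime σ b x y (t - u)| * |bornTerm σ b ν s n y u|
          ≤ greenBound σ *
              (bornRate σ ν ^ (n + 1) * (⌊u / b⌋₊ + 1) * (u ^ n / n.factorial)) := by
            gcongr
            · exact abs_greenTime_le hσ hb x y _
            · exact ih hu0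
        _ ≤ greenBound σ *
              (bornRate σ ν ^ (n + 1) * (⌊t / b⌋₊ + 1) * (u ^ n / n.factorial)) := by gcongr
        _ = B * (u ^ n / n.factorial) := by ring
    rw [bornTerm, abs_neg]
    refine (abs_integral_mul_le hs MeasurableSet.univ (by positivity)
      fun y _ => ⟨mem_univ y, hconv y⟩).trans_eq ?_
    simp only [B, bornRate]
    ring

/-- Before the reflection at `b` arrives, the Born series obeys the bounds of the half-line problem,
and a point mass of the potential at `b` is not noticed. -/
lemma abs_bornTerm_le_of_le (hs : ∀ y, |s y| ≤ 1) (n : ℕ) (ht : 0 ≤ t) (hx : t ≤ 2 * b - x) :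
    |bornTerm σ b ν s n x t| ≤ (1 / 2 * ν.real (Iio b)) ^ (n + 1) * (t ^ n / n.factorial) := by
  induction n generalizing x t with
  | zero =>
    rw [bornTerm, abs_neg]
    refine (abs_integral_mul_le hs (measurableSet_Iio (a := b)) one_half_pos.le
      fun y hy => ?_).trans_eq (by simp)
    obtain ⟨hyb, hyt⟩ := mem_of_imageSum_greenTime_ne_zero hy
    refine ⟨?_, abs_imageSum_greenTime_le_half hyb hx⟩
    rw [mem_Iio]
    linarith [neg_le_abs (x - y)]
  | succ n ih =>
    set B := 1 / 2 * (1 / 2 * ν.real (Iio b)) ^ (n + 1)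
    have hB : 0 ≤ B := by positivity
    rw [bornTerm, abs_neg]
    refine (abs_integral_mul_le hs (measurableSet_Iio (a := b))
      (B := B * (t ^ (n + 1) / (n + 1).factorial)) (by positivity) fun y hy => ⟨?_, ?_⟩).trans_eq
      (by simp only [B]; ring)
    · obtain ⟨u, hu⟩ : ∃ u, bornTerm σ b ν s n y u * greenTime σ b x y (t - u) ≠ 0 := by
        by_contra! h
        exact hy (by simp [h])
      obtain ⟨-, hyu, hut⟩ := mem_of_bornTerm_mul_greenTime_ne_zero hu
      rw [mem_Iio]
      linarith [neg_le_abs (x - y)]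
    · refine abs_integral_le_pow_div_factorial ht hB fun u hu => ?_
      have huI := mem_Icc_of_bornTerm_mul_greenTime_ne_zero hu
      obtain ⟨-, hyu, hut⟩ := mem_of_bornTerm_mul_greenTime_ne_zero hu
      refine ⟨huI, ?_⟩
      rw [abs_mul, mul_comm, mul_assoc]
      exact mul_le_mul (abs_greenTime_le_half (by linarith))
        (ih huI.1 (by linarith [neg_le_abs (x - y)])) (abs_nonneg _) one_half_pos.le

lemma summable_bornTerm (hσ : |σ| ≤ 1) (hb : 0 < b) (hs : ∀ y, |s y| ≤ 1) (x t : ℝ) :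
    Summable fun n => bornTerm σ b ν s n x t := by
  rcases le_total t 0 with ht | ht
  · simp only [bornTerm_of_nonpos ht]
    exact summable_zero
  · exact .of_norm_bounded (hasSum_pow_succ_mul_pow_div_factorial _ _ t).summable
      fun n => abs_bornTerm_le hσ hb hs n ht

lemma abs_bornSum_le (hσ : |σ| ≤ 1) (hb : 0 < b) (hs : ∀ y, |s y| ≤ 1) (ht : 0 ≤ t) :
    |bornSum σ b ν s x t| ≤
      bornRate σ ν * (⌊t / b⌋₊ + 1) * Real.exp (bornRate σ ν * t) :=
  tsum_of_norm_bounded (f := fun n => bornTerm σ b ν s n x t)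
    (hasSum_pow_succ_mul_pow_div_factorial _ _ t) fun n => abs_bornTerm_le hσ hb hs n ht

lemma abs_bornSum_le_of_le (hs : ∀ y, |s y| ≤ 1) (ht : 0 ≤ t) (hx : t ≤ 2 * b - x) :
    |bornSum σ b ν s x t| ≤ 1 / 2 * ν.real (Iio b) * Real.exp (1 / 2 * ν.real (Iio b) * t) := by
  have hsum := hasSum_pow_succ_mul_pow_div_factorial (1 / 2 * ν.real (Iio b)) 1 t
  simp only [mul_one] at hsum
  exact tsum_of_norm_bounded (f := fun n => bornTerm σ b ν s n x t) hsum
    fun n => abs_bornTerm_le_of_le hs n ht hx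

lemma measurable_bornSum (hσ : |σ| ≤ 1) (hb : 0 < b) (hs : Measurable s)
    (hs1 : ∀ y, |s y| ≤ 1) : Measurable fun p : ℝ × ℝ => bornSum σ b ν s p.1 p.2 :=
  measurable_tsum_of_summable (measurable_bornTerm hb hs) fun p =>
    summable_bornTerm hσ hb hs1 p.1 p.2

lemma measurable_imageSum_bornSum (hσ : |σ| ≤ 1) (hb : 0 < b) (hs : Measurable s)
    (hs1 : ∀ y, |s y| ≤ 1) :
    Measurable fun p : ℝ × ℝ => imageSum σ b p.1 (bornSum σ b ν s p.1) p.2 :=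
  measurable_imageSum hb (f := fun p : ℝ × ℝ => bornSum σ b ν s p.1) measurable_fst measurable_snd
    ((measurable_bornSum hσ hb hs hs1).comp
      (by fun_prop : Measurable fun p : (ℝ × ℝ) × ℝ => (p.1.1, p.2)))
    fun _ _ ht => bornSum_of_nonpos ht.le

lemma measurable_bornRemainder (hσ : |σ| ≤ 1) (hb : 0 < b) (hs : Measurable s)
    (hs1 : ∀ y, |s y| ≤ 1) : Measurable (bornRemainder σ b ν s) := by
  have hint : Measurable fun p : ℝ × ℝ => imageSum σ b p.2 (bornSum σ b ν s p.2) p.1 * s p.2 :=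
    ((measurable_imageSum_bornSum hσ hb hs hs1).comp measurable_swap).mul (hs.comp measurable_snd)
  exact hint.stronglyMeasurable.integral_prod_right'.measurable

lemma floor_sub_imagePosition_le (hb : 0 < b) (hy : y ∈ Icc 0 b) {k : ℕ}
    (ht : 0 ≤ t - imagePosition b y k) :
    (⌊(t - imagePosition b y k) / b⌋₊ : ℝ) ≤ ⌊t / b⌋₊ - k := by
  have hfloor : ⌊(t - imagePosition b y k) / b⌋₊ + k ≤ ⌊t / b⌋₊ := by
    apply Nat.le_floor
    have hle := Nat.floor_le (a := (t - imagePosition b y k) / b) (by positivity)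
    rw [le_div_iff₀ hb] at hle ⊢
    push_cast
    linarith [mul_le_imagePosition hy k]
  rw [le_sub_iff_add_le]
  exact_mod_cast hfloor

lemma abs_bornSum_sub_imagePosition_le (hσ : |σ| ≤ 1) (hb : 0 < b) (hs : ∀ y, |s y| ≤ 1)
    (hy : y ∈ Icc 0 b) {k : ℕ} (hk : k ≤ ⌊t / b⌋₊) :
    |bornSum σ b ν s x (t - imagePosition b y k)| ≤
      bornRate σ ν * Real.exp (bornRate σ ν * t) * ((⌊t / b⌋₊ + 1 : ℝ) - k) := by
  have hR : 0 ≤ bornRate σ ν := bornRate_nonneg hσ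
  have hk : (k : ℝ) ≤ ⌊t / b⌋₊ := by exact_mod_cast hk
  have hpos : 0 ≤ imagePosition b y k := by linarith [le_imagePosition hy k, hy.1]
  rcases le_total (t - imagePosition b y k) 0 with ht | ht
  · rw [bornSum_of_nonpos ht, abs_zero]
    exact mul_nonneg (by positivity) (by linarith)
  · have hfloor : (⌊(t - imagePosition b y k) / b⌋₊ : ℝ) + 1 ≤ ⌊t / b⌋₊ + 1 - k := by
      linarith [floor_sub_imagePosition_le hb hy ht]
    refine (abs_bornSum_le hσ hb hs ht).trans ?_
    rw [mul_right_comm]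
    gcongr
    linarith

lemma abs_imageSum_bornSum_le (hσ : |σ| ≤ 1) (hb : 0 < b) (hs : ∀ y, |s y| ≤ 1)
    (hy : y ∈ Icc 0 b) (ht : 0 ≤ t) :
    |imageSum σ b y (bornSum σ b ν s y) t| ≤
      bornRate σ ν * ((t / b + 1) * (t / b + 2) / 2) * Real.exp (bornRate σ ν * t) := by
  have hR : 0 ≤ bornRate σ ν := bornRate_nonneg hσ
  have hfloor : (⌊t / b⌋₊ : ℝ) ≤ t / b := Nat.floor_le (by positivity)
  calc |imageSum σ b y (bornSum σ b ν s y) t|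
      ≤ ∑ k ∈ Finset.range (⌊t / b⌋₊ + 1), |bornSum σ b ν s y (t - imagePosition b y k)| :=
        abs_imageSum_le hσ hb hy (fun u hu => bornSum_of_nonpos hu.le) t
    _ ≤ ∑ k ∈ Finset.range (⌊t / b⌋₊ + 1),
          bornRate σ ν * Real.exp (bornRate σ ν * t) * ((⌊t / b⌋₊ + 1 : ℝ) - k) :=
        Finset.sum_le_sum fun k hk => abs_bornSum_sub_imagePosition_le hσ hb hs hy
          (Nat.lt_succ_iff.1 (Finset.mem_range.1 hk))
    _ = bornRate σ ν * ((⌊t / b⌋₊ + 1 : ℝ) * (⌊t / b⌋₊ + 2) / 2) *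
          Real.exp (bornRate σ ν * t) := by
        rw [← Finset.mul_sum, sum_range_const_sub]
        push_cast
        ring
    _ ≤ bornRate σ ν * ((t / b + 1) * (t / b + 2) / 2) * Real.exp (bornRate σ ν * t) := by gcongr

lemma abs_bornRemainder_le (hσ : |σ| ≤ 1) (hb : 0 < b) (hs : ∀ y, |s y| ≤ 1) (ht : 0 ≤ t) :
    |bornRemainder σ b ν s t| ≤ bornRate σ ν * ν.real univ *
      ((t / b + 1) * (t / b + 2) / 2) * Real.exp (bornRate σ ν * t) := by
  have hR : 0 ≤ bornRate σ ν := bornRate_nonneg hσ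
  refine (abs_integral_mul_le hs MeasurableSet.univ (by positivity) fun y hy => ⟨mem_univ y,
    abs_imageSum_bornSum_le hσ hb hs (mem_of_imageSum_bornSum_ne_zero hy).1 ht⟩).trans_eq ?_
  ring

lemma abs_bornRemainder_le_of_lt (hs : ∀ y, |s y| ≤ 1) (ht : t < 2 * b) :
    |bornRemainder σ b ν s t| ≤
      1 / 2 * ν.real (Iio b) ^ 2 * Real.exp (1 / 2 * ν.real (Iio b) * t) := by
  set B := 1 / 2 * ν.real (Iio b) * Real.exp (1 / 2 * ν.real (Iio b) * t)
  have hB : 0 ≤ B := by positivity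
  refine (abs_integral_mul_le hs measurableSet_Iio hB fun y hy => ?_).trans_eq
    (by simp only [B]; ring)
  obtain ⟨hyb, hyt⟩ := mem_of_imageSum_bornSum_ne_zero hy
  refine ⟨by rw [mem_Iio]; linarith, ?_⟩
  rw [imageSum_eq_of_le hyb (T := t - (2 * b - y))
    (fun u hu => bornSum_eq_zero (by linarith)) le_rfl]
  refine (abs_bornSum_le_of_le hs (by linarith [hyb.1]) (by linarith)).trans ?_
  simp only [B]
  gcongr
  linarith [hyb.1]

end BornBounds

/-! ### Laplace transform of the Born series -/

/-- `f` vanishes on the negative half-line and is bounded by `B e^{βt}` on the positive one. -/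
def ExpBounded (β B : ℝ) (f : ℝ → ℝ) : Prop :=
  (∀ t < 0, f t = 0) ∧ ∀ t, 0 ≤ t → |f t| ≤ B * Real.exp (β * t)

/-- The integrable majorant that `ExpBounded β B f` gives for `f t * e^{-κt}`, with `a = re κ`. -/
noncomputable def expMajorant (β B a t : ℝ) : ℝ :=
  (Ici 0).indicator (fun t => B * Real.exp ((β - a) * t)) t

/-- The integral kernel of the free resolvent at energy `-κ²`. -/
noncomputable def greenFunction (σ b : ℝ) (κ : ℂ) (x y : ℝ) : ℂ := laplace κ (greenTime σ b x y)

section ExpBounded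

variable {α : Type*} [MeasurableSpace α] {a β B : ℝ} {κ : ℂ} {f g : ℝ → ℝ}

lemma integrable_expMajorant (B : ℝ) (h : β < a) : Integrable (expMajorant β B a) := by
  unfold expMajorant
  rw [integrable_indicator_iff measurableSet_Ici, integrableOn_Ici_iff_integrableOn_Ioi]
  exact (integrableOn_exp_mul_Ioi (by linarith) 0).const_mul B

lemma integral_expMajorant (B : ℝ) (h : β < a) : ∫ t, expMajorant β B a t = B / (a - β) := by
  unfold expMajorant
  rw [integral_indicator measurableSet_Ici, integral_Ici_eq_integral_Ioi, integral_const_mul,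
    integral_exp_mul_Ioi (by linarith), mul_zero, Real.exp_zero, neg_div, ← div_neg, neg_sub,
    mul_one_div]

lemma norm_exp_neg_mul (κ : ℂ) (t : ℝ) : ‖Complex.exp (-κ * t)‖ = Real.exp (-κ.re * t) := by
  simp [Complex.norm_exp]

lemma ExpBounded.norm_le (hf : ExpBounded β B f) (κ : ℂ) (t : ℝ) :
    ‖(f t : ℂ) * Complex.exp (-κ * t)‖ ≤ expMajorant β B κ.re t := by
  unfold expMajorant
  rcases lt_or_ge t 0 with ht | ht
  · rw [hf.1 t ht, indicator_of_notMem (notMem_Ici.2 ht), Complex.ofReal_zero, zero_mul, norm_zero]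
  · rw [indicator_of_mem (mem_Ici.2 ht), norm_mul, norm_exp_neg_mul, Complex.norm_real,
      Real.norm_eq_abs, sub_eq_add_neg, add_mul, Real.exp_add, ← mul_assoc]
    gcongr
    exact hf.2 t ht

lemma measurable_mul_exp {f : α × ℝ → ℝ} (hf : Measurable f) (κ : ℂ) :
    Measurable fun p : α × ℝ => (f p : ℂ) * Complex.exp (-κ * p.2) :=
  (Complex.measurable_ofReal.comp hf).mul
    ((by fun_prop : Measurable fun t : ℝ => Complex.exp (-κ * t)).comp measurable_snd)

lemma measurable_laplace {f : α → ℝ → ℝ} (hf : Measurable fun p : α × ℝ => f p.1 p.2) (κ : ℂ) :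
    Measurable fun a => laplace κ (f a) :=
  (measurable_mul_exp hf κ).stronglyMeasurable.integral_prod_right'.measurable

lemma ExpBounded.integrable (hf : ExpBounded β B f) (hm : Measurable f) (hκ : β < κ.re) :
    Integrable fun t : ℝ => (f t : ℂ) * Complex.exp (-κ * t) :=
  (integrable_expMajorant B hκ).mono'
    ((Complex.measurable_ofReal.comp hm).mul (by fun_prop)).aestronglyMeasurable
    (.of_forall (hf.norm_le κ))

lemma ExpBounded.integral_norm_le (hf : ExpBounded β B f) (hκ : β < κ.re) :
    ∫ t : ℝ, ‖(f t : ℂ) * Complex.exp (-κ * t)‖ ≤ B / (κ.re - β) := by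
  rw [← integral_expMajorant B hκ]
  exact integral_mono_of_nonneg (.of_forall fun _ => norm_nonneg _) (integrable_expMajorant B hκ)
    (.of_forall (hf.norm_le κ))

lemma ExpBounded.norm_laplace_le (hf : ExpBounded β B f) (hκ : β < κ.re) :
    ‖laplace κ f‖ ≤ B / (κ.re - β) :=
  (norm_integral_le_integral_norm _).trans (hf.integral_norm_le hκ)

lemma laplace_neg (κ : ℂ) (f : ℝ → ℝ) : laplace κ (fun t => -f t) = -laplace κ f := by
  simp [laplace, integral_neg]

lemma laplace_integral {ν : Measure ℝ} [IsFiniteMeasure ν] {s : ℝ → ℝ} (hs : Measurable s)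
    (hs1 : ∀ y, |s y| ≤ 1) {f : ℝ → ℝ → ℝ} (hm : Measurable fun p : ℝ × ℝ => f p.1 p.2)
    (hf : ∀ y, ExpBounded β B (f y)) (hκ : β < κ.re) :
    laplace κ (fun t => ∫ y, f y t * s y ∂ν) = ∫ y, laplace κ (f y) * s y ∂ν := by
  have hpull : ∀ t : ℝ, ((∫ y, f y t * s y ∂ν : ℝ) : ℂ) * Complex.exp (-κ * t) =
      ∫ y, (f y t : ℂ) * Complex.exp (-κ * t) * s y ∂ν := fun t => by
    rw [← integral_complex_ofReal, ← integral_mul_const]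
    congr 1 with y
    push_cast
    ring
  simp only [laplace, hpull, ← integral_mul_const]
  refine (integral_integral_swap (((integrable_expMajorant B hκ).comp_snd ν).mono' ?_
    (.of_forall fun p => ?_))).symm
  · exact ((measurable_mul_exp hm κ).mul
      (Complex.measurable_ofReal.comp (hs.comp measurable_fst))).aestronglyMeasurable
  · rw [Function.uncurry_def, norm_mul, Complex.norm_real]
    exact (mul_le_of_le_one_right (norm_nonneg _) (hs1 p.1)).trans ((hf p.1).norm_le κ p.2)

lemma hasSum_laplace {f : ℕ → ℝ → ℝ} {B : ℕ → ℝ} (hm : ∀ n, Measurable (f n))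
    (hf : ∀ n, ExpBounded β (B n) (f n)) (hB : Summable B) (hκ : β < κ.re) :
    HasSum (fun n => laplace κ (f n)) (laplace κ fun t => ∑' n, f n t) := by
  simp only [laplace, Complex.ofReal_tsum, ← tsum_mul_right]
  exact hasSum_integral_of_summable_integral_norm (fun n => (hf n).integrable (hm n) hκ)
    (.of_nonneg_of_le (fun n => integral_nonneg fun _ => norm_nonneg _)
      (fun n => (hf n).integral_norm_le hκ) (hB.div_const _))

lemma laplace_convolution (hf : Integrable fun t : ℝ => (f t : ℂ) * Complex.exp (-κ * t))
    (hg : Integrable fun t : ℝ => (g t : ℂ) * Complex.exp (-κ * t)) :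
    laplace κ (fun t => ∫ u, f u * g (t - u)) = laplace κ f * laplace κ g := by
  have hconv := integral_convolution (μ := volume) (ν := volume) (ContinuousLinearMap.mul ℂ ℂ) hf hg
  rw [ContinuousLinearMap.mul_apply'] at hconv
  rw [laplace, laplace, laplace, ← hconv]
  congr 1 with t
  rw [convolution_def, ← integral_complex_ofReal, ← integral_mul_const]
  congr 1 with u
  rw [ContinuousLinearMap.mul_apply', mul_mul_mul_comm, ← Complex.exp_add]
  push_cast
  ring_nf

/-- The factor `t` lost in the convolution with a bounded function is absorbed by `e^{δt} / δ`. -/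
lemma ExpBounded.convolution {c δ : ℝ} (hf : ExpBounded β B f) (hβ : 0 ≤ β) (hB : 0 ≤ B)
    (hg0 : ∀ t ≤ 0, g t = 0) (hg : ∀ t, |g t| ≤ c) (hδ : 0 < δ) :
    ExpBounded (β + δ) (B * c / δ) fun t => ∫ u, f u * g (t - u) := by
  have hc : 0 ≤ c := (abs_nonneg _).trans (hg 0)
  have hsupp : ∀ t u, f u * g (t - u) ≠ 0 → u ∈ Icc 0 t := fun t u h => by
    constructor <;> contrapose! h
    · rw [hf.1 u h, zero_mul]
    · rw [hg0 _ (by linarith), mul_zero]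
  refine ⟨fun t ht => integral_eq_zero_of_ae (.of_forall fun u => ?_), fun t ht => ?_⟩
  · by_contra h
    exact ht.not_ge (nonempty_Icc.1 ⟨u, hsupp t u h⟩)
  · have hlin : t ≤ Real.exp (δ * t) / δ := by
      rw [le_div_iff₀ hδ]
      linarith [Real.add_one_le_exp (δ * t)]
    calc |∫ u, f u * g (t - u)|
        ≤ B * Real.exp (β * t) * c * (t ^ (0 + 1) / (0 + 1).factorial) := by
          refine abs_integral_le_pow_div_factorial ht (by positivity) fun u hu => ?_
          obtain ⟨hu0, hut⟩ := hsupp t u hu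
          refine ⟨⟨hu0, hut⟩, ?_⟩
          rw [abs_mul, pow_zero, Nat.factorial_zero, Nat.cast_one, div_one, mul_one]
          refine mul_le_mul ((hf.2 u hu0).trans ?_) (hg _) (abs_nonneg _) (by positivity)
          gcongr
      _ = B * Real.exp (β * t) * c * t := by simp
      _ ≤ B * Real.exp (β * t) * c * (Real.exp (δ * t) / δ) := by gcongr
      _ = B * c / δ * Real.exp ((β + δ) * t) := by rw [add_mul, Real.exp_add]; ring

lemma exists_quadratic_le_exp {b δ : ℝ} (hb : 0 < b) (hδ : 0 < δ) :
    ∃ B, 0 ≤ B ∧ ∀ t, 0 ≤ t → (t / b + 1) * (t / b + 2) / 2 ≤ B * Real.exp (δ * t) := by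
  refine ⟨(2 / (b * δ) + 1) ^ 2, by positivity, fun t ht => ?_⟩
  have htb : 0 ≤ t / b := by positivity
  have hlin : t / b + 1 ≤ (2 / (b * δ) + 1) * Real.exp (δ / 2 * t) := by
    have hdiv : t / b = 2 / (b * δ) * (δ / 2 * t) := by field_simp
    have hle : t / b ≤ 2 / (b * δ) * Real.exp (δ / 2 * t) := by
      rw [hdiv]
      gcongr
      linarith [Real.add_one_le_exp (δ / 2 * t)]
    linarith [Real.one_le_exp (x := δ / 2 * t) (by positivity)]
  calc (t / b + 1) * (t / b + 2) / 2 ≤ (t / b + 1) ^ 2 := by nlinarith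
    _ ≤ ((2 / (b * δ) + 1) * Real.exp (δ / 2 * t)) ^ 2 := by gcongr
    _ = (2 / (b * δ) + 1) ^ 2 * Real.exp (δ * t) := by
      rw [mul_pow, ← Real.exp_nat_mul]
      ring_nf

lemma exists_expBounded {b c : ℝ} (hb : 0 < b) (hc : c < β) :
    ∃ B, 0 ≤ B ∧ ∀ (a : ℝ) (f : ℝ → ℝ), 0 ≤ a → (∀ t < 0, f t = 0) →
      (∀ t, 0 ≤ t → |f t| ≤ a * ((t / b + 1) * (t / b + 2) / 2) * Real.exp (c * t)) →
      ExpBounded β (a * B) f := by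
  obtain ⟨B, hB, hquad⟩ := exists_quadratic_le_exp hb (sub_pos.2 hc)
  refine ⟨B, hB, fun a f ha hf0 hf => ⟨hf0, fun t ht => ?_⟩⟩
  calc |f t| ≤ a * ((t / b + 1) * (t / b + 2) / 2) * Real.exp (c * t) := hf t ht
    _ ≤ a * (B * Real.exp ((β - c) * t)) * Real.exp (c * t) := by gcongr; exact hquad t ht
    _ = a * B * Real.exp (β * t) := by
      rw [← mul_assoc, mul_assoc, ← Real.exp_add]
      ring_nf

end ExpBounded

section BornExpBounded

variable {σ b β t : ℝ} {ν : Measure ℝ} [IsFiniteMeasure ν] {s : ℝ → ℝ}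

lemma floor_add_one_le (ht : 0 ≤ t) : (⌊t⌋₊ : ℝ) + 1 ≤ (t + 1) * (t + 2) / 2 := by
  nlinarith [Nat.floor_le ht]

lemma exists_expBounded_imageSum_greenTime (hσ : |σ| ≤ 1) (hb : 0 < b) (hβ : 0 < β) :
    ∃ B, ∀ x y, ExpBounded β B (imageSum σ b y (greenTime σ b x y)) := by
  obtain ⟨B, -, hB⟩ := exists_expBounded hb hβ
  refine ⟨greenBound σ * B, fun x y => hB _ _ (greenBound_nonneg hσ) (fun t ht => ?_)
    fun t ht => ?_⟩
  · by_contra h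
    obtain ⟨hy, hyt⟩ := mem_of_imageSum_greenTime_ne_zero h
    linarith [hy.1, abs_nonneg (x - y)]
  · rw [zero_mul, Real.exp_zero, mul_one]
    by_cases h : imageSum σ b y (greenTime σ b x y) t = 0
    · rw [h, abs_zero]
      exact mul_nonneg (greenBound_nonneg hσ) (by positivity)
    · exact (abs_imageSum_greenTime_le hσ hb (mem_of_imageSum_greenTime_ne_zero h).1 x t).trans
        (mul_le_mul_of_nonneg_left (floor_add_one_le (by positivity)) (greenBound_nonneg hσ))

/-- Splitting `bornRate` as `ρ * γ` with `bornRate < γ < β` leaves a geometric factor in front of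
`(γt)ⁿ / n! ≤ e^{γt}`. -/
lemma exists_expBounded_bornTerm (hσ : |σ| ≤ 1) (hb : 0 < b) (hs : ∀ y, |s y| ≤ 1)
    (hβ : bornRate σ ν < β) :
    ∃ B ρ, 0 ≤ B ∧ 0 ≤ ρ ∧ ρ < 1 ∧ ∀ n x, ExpBounded β (B * ρ ^ n) (bornTerm σ b ν s n x) := by
  obtain ⟨γ, hγ, hγβ⟩ := exists_between hβ
  obtain ⟨B, hB, hexp⟩ := exists_expBounded hb hγβ
  have hR : 0 ≤ bornRate σ ν := bornRate_nonneg hσ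
  have hγ0 : 0 < γ := hR.trans_lt hγ
  refine ⟨bornRate σ ν * B, bornRate σ ν / γ, by positivity, by positivity,
    (div_lt_one hγ0).2 hγ, fun n x => ?_⟩
  rw [mul_right_comm]
  refine hexp _ _ (by positivity) (fun t ht => bornTerm_of_nonpos ht.le n) fun t ht => ?_
  calc |bornTerm σ b ν s n x t|
      ≤ bornRate σ ν ^ (n + 1) * (⌊t / b⌋₊ + 1) * (t ^ n / n.factorial) :=
        abs_bornTerm_le hσ hb hs n ht
    _ = bornRate σ ν * (bornRate σ ν / γ) ^ n * (⌊t / b⌋₊ + 1) * ((γ * t) ^ n / n.factorial) := by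
        rw [div_pow, mul_pow]
        field_simp
        ring
    _ ≤ bornRate σ ν * (bornRate σ ν / γ) ^ n * ((t / b + 1) * (t / b + 2) / 2) *
          Real.exp (γ * t) := by
        gcongr
        · exact floor_add_one_le (by positivity)
        · exact Real.pow_div_factorial_le_exp _ (by positivity) n

lemma exists_expBounded_bornSum (hσ : |σ| ≤ 1) (hb : 0 < b) (hs : ∀ y, |s y| ≤ 1)
    (hβ : bornRate σ ν < β) : ∃ B, ∀ x, ExpBounded β B (bornSum σ b ν s x) := by
  obtain ⟨B, -, hexp⟩ := exists_expBounded hb hβ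
  have hR : 0 ≤ bornRate σ ν := bornRate_nonneg hσ
  refine ⟨bornRate σ ν * B, fun x => hexp _ _ hR (fun t ht => bornSum_of_nonpos ht.le)
    fun t ht => (abs_bornSum_le hσ hb hs ht).trans ?_⟩
  gcongr
  exact floor_add_one_le (by positivity)

lemma exists_expBounded_imageSum_bornSum (hσ : |σ| ≤ 1) (hb : 0 < b) (hs : ∀ y, |s y| ≤ 1)
    (hβ : bornRate σ ν < β) :
    ∃ B, ∀ y, ExpBounded β B (imageSum σ b y (bornSum σ b ν s y)) := by
  obtain ⟨B, -, hexp⟩ := exists_expBounded hb hβ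
  have hR : 0 ≤ bornRate σ ν := bornRate_nonneg hσ
  refine ⟨bornRate σ ν * B, fun y => hexp _ _ hR (fun t ht => imageSum_bornSum_of_nonpos ht.le)
    fun t ht => ?_⟩
  by_cases h : imageSum σ b y (bornSum σ b ν s y) t = 0
  · rw [h, abs_zero]
    positivity
  · exact abs_imageSum_bornSum_le hσ hb hs (mem_of_imageSum_bornSum_ne_zero h).1 ht

lemma exists_expBounded_bornRemainder (hσ : |σ| ≤ 1) (hb : 0 < b) (hs : ∀ y, |s y| ≤ 1)
    (hβ : bornRate σ ν < β) : ∃ B, ExpBounded β B (bornRemainder σ b ν s) := by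
  obtain ⟨B, -, hexp⟩ := exists_expBounded hb hβ
  exact ⟨_, hexp _ _ (mul_nonneg (bornRate_nonneg hσ) measureReal_nonneg)
    (fun t ht => bornRemainder_of_nonpos ht.le) fun t ht => abs_bornRemainder_le hσ hb hs ht⟩

end BornExpBounded

section LaplaceBorn

variable {σ b : ℝ} {ν : Measure ℝ} [IsFiniteMeasure ν] {s : ℝ → ℝ} {κ : ℂ}

lemma expBounded_greenTime (hσ : |σ| ≤ 1) (hb : 0 < b) (x y : ℝ) :
    ExpBounded 0 (greenBound σ) (greenTime σ b x y) :=
  ⟨fun _ ht => greenTime_of_nonpos ht.le, fun t _ => by simpa using abs_greenTime_le hσ hb x y t⟩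

lemma integrable_greenTime_mul_exp (hσ : |σ| ≤ 1) (hb : 0 < b) (hκ : 0 < κ.re) (x y : ℝ) :
    Integrable fun t : ℝ => (greenTime σ b x y t : ℂ) * Complex.exp (-κ * t) :=
  (expBounded_greenTime hσ hb x y).integrable
    (measurable_greenTime_comp hb measurable_const measurable_const measurable_id) hκ

lemma norm_greenFunction_le (hσ : |σ| ≤ 1) (hb : 0 < b) (hκ : 0 < κ.re) (x y : ℝ) :
    ‖greenFunction σ b κ x y‖ ≤ greenBound σ / κ.re := by
  simpa [greenFunction] using (expBounded_greenTime hσ hb x y).norm_laplace_le hκ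

lemma measurable_greenFunction (hb : 0 < b) (x : ℝ) : Measurable (greenFunction σ b κ x) :=
  measurable_laplace
    (measurable_greenTime_comp hb measurable_const measurable_fst measurable_snd) κ

lemma laplace_bornTerm_zero (hσ : |σ| ≤ 1) (hb : 0 < b) (hs : Measurable s)
    (hs1 : ∀ y, |s y| ≤ 1) (hκ : 0 < κ.re) (x : ℝ) :
    laplace κ (bornTerm σ b ν s 0 x) =
      -∫ y, freeWeyl σ b κ y * greenFunction σ b κ x y * s y ∂ν := by
  obtain ⟨β, hβ, hβκ⟩ := exists_between hκ
  obtain ⟨B, hB⟩ := exists_expBounded_imageSum_greenTime hσ hb hβ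
  have hdef : bornTerm σ b ν s 0 x =
      fun t => -∫ y, imageSum σ b y (greenTime σ b x y) t * s y ∂ν := rfl
  rw [hdef, laplace_neg, laplace_integral hs hs1
    ((measurable_imageSum_greenTime hb).comp measurable_prodMk_left) (hB x) hβκ]
  simp only [laplace_imageSum hσ hb hκ _ (integrable_greenTime_mul_exp hσ hb hκ x _),
    greenFunction]

lemma laplace_bornTerm_succ (hσ : |σ| ≤ 1) (hb : 0 < b) (hs : Measurable s)
    (hs1 : ∀ y, |s y| ≤ 1) (hκ : bornRate σ ν < κ.re) (n : ℕ) (x : ℝ) :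
    laplace κ (bornTerm σ b ν s (n + 1) x) =
      -∫ y, laplace κ (bornTerm σ b ν s n y) * greenFunction σ b κ x y * s y ∂ν := by
  obtain ⟨β, hRβ, hβκ⟩ := exists_between hκ
  obtain ⟨γ, hβγ, hγκ⟩ := exists_between hβκ
  have hβ : 0 ≤ β := (bornRate_nonneg hσ).trans hRβ.le
  obtain ⟨B, ρ, hB, hρ, -, hexp⟩ := exists_expBounded_bornTerm hσ hb hs1 hRβ
  have hconv : ∀ y, ExpBounded γ (B * ρ ^ n * greenBound σ / (γ - β))
      fun t => ∫ u, bornTerm σ b ν s n y u * greenTime σ b x y (t - u) := fun y => by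
    simpa only [add_sub_cancel] using (hexp n y).convolution hβ (by positivity)
      (fun t ht => greenTime_of_nonpos ht) (abs_greenTime_le hσ hb x y) (sub_pos.2 hβγ)
  have hdef : bornTerm σ b ν s (n + 1) x = fun t =>
    -∫ y, (∫ u, bornTerm σ b ν s n y u * greenTime σ b x y (t - u)) * s y ∂ν := rfl
  rw [hdef, laplace_neg, laplace_integral hs hs1
    ((measurable_convolution_greenTime hb (measurable_bornTerm hb hs n)).comp
      measurable_prodMk_left) hconv hγκ]
  congr 2 with y
  rw [greenFunction, laplace_convolution ((hexp n y).integrable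
    ((measurable_bornTerm hb hs n).comp measurable_prodMk_left) hβκ)
    (integrable_greenTime_mul_exp hσ hb (hβ.trans_lt hβκ) x y)]

lemma exists_summable_bound_hasSum_laplace_bornTerm (hσ : |σ| ≤ 1) (hb : 0 < b)
    (hs : Measurable s) (hs1 : ∀ y, |s y| ≤ 1) (hκ : bornRate σ ν < κ.re) :
    ∃ d : ℕ → ℝ, Summable d ∧ ∀ x, (∀ n, ‖laplace κ (bornTerm σ b ν s n x)‖ ≤ d n) ∧
      HasSum (fun n => laplace κ (bornTerm σ b ν s n x)) (laplace κ (bornSum σ b ν s x)) := by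
  obtain ⟨β, hRβ, hβκ⟩ := exists_between hκ
  obtain ⟨B, ρ, -, hρ0, hρ1, hexp⟩ := exists_expBounded_bornTerm hσ hb hs1 hRβ
  have hgeom : Summable fun n => B * ρ ^ n := (summable_geometric_of_lt_one hρ0 hρ1).mul_left B
  exact ⟨_, hgeom.div_const (κ.re - β), fun x => ⟨fun n => (hexp n x).norm_laplace_le hβκ,
    hasSum_laplace (fun n => (measurable_bornTerm hb hs n).comp measurable_prodMk_left)
      (fun n => hexp n x) hgeom hβκ⟩⟩

lemma laplace_bornSum_eq (hσ : |σ| ≤ 1) (hb : 0 < b) (hs : Measurable s)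
    (hs1 : ∀ y, |s y| ≤ 1) (hκ : bornRate σ ν < κ.re) (x : ℝ) :
    laplace κ (bornSum σ b ν s x) =
      -(∫ y, freeWeyl σ b κ y * greenFunction σ b κ x y * s y ∂ν) -
        ∫ y, laplace κ (bornSum σ b ν s y) * greenFunction σ b κ x y * s y ∂ν := by
  have hκ0 : 0 < κ.re := (bornRate_nonneg hσ).trans_lt hκ
  obtain ⟨d, hd, hborn⟩ := exists_summable_bound_hasSum_laplace_bornTerm hσ hb hs hs1 hκ
  have hint : HasSum
      (fun n => ∫ y, laplace κ (bornTerm σ b ν s n y) * greenFunction σ b κ x y * s y ∂ν)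
      (∫ y, laplace κ (bornSum σ b ν s y) * greenFunction σ b κ x y * s y ∂ν) := by
    refine hasSum_integral_of_dominated_convergence (fun n _ => d n * (greenBound σ / κ.re))
      (fun n => ?_) (fun n => .of_forall fun y => ?_) (.of_forall fun _ => hd.mul_right _)
      (integrable_const _) (.of_forall fun y => ((hborn y).2.mul_right _).mul_right _)
    · exact (((measurable_laplace (measurable_bornTerm hb hs n) κ).mul
        (measurable_greenFunction hb x)).mul
        (Complex.measurable_ofReal.comp hs)).aestronglyMeasurable
    · rw [norm_mul, norm_mul, Complex.norm_real]
      have hdn : 0 ≤ d n := (norm_nonneg _).trans ((hborn y).1 n)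
      exact (mul_le_of_le_one_right (by positivity) (hs1 y)).trans (mul_le_mul ((hborn y).1 n)
        (norm_greenFunction_le hσ hb hκ0 x y) (norm_nonneg _) hdn)
  have htail := (hasSum_nat_add_iff' 1).2 (hborn x).2
  simp only [laplace_bornTerm_succ hσ hb hs hs1 hκ, Finset.sum_range_one,
    laplace_bornTerm_zero hσ hb hs hs1 hκ0] at htail
  linear_combination htail.unique hint.neg

lemma laplace_bornRemainder (hσ : |σ| ≤ 1) (hb : 0 < b) (hs : Measurable s)
    (hs1 : ∀ y, |s y| ≤ 1) (hκ : bornRate σ ν < κ.re) :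
    laplace κ (bornRemainder σ b ν s) =
      ∫ y, freeWeyl σ b κ y * laplace κ (bornSum σ b ν s y) * s y ∂ν := by
  obtain ⟨β, hRβ, hβκ⟩ := exists_between hκ
  obtain ⟨B, hB⟩ := exists_expBounded_bornSum hσ hb hs1 hRβ
  obtain ⟨C, hC⟩ := exists_expBounded_imageSum_bornSum hσ hb hs1 hRβ
  have hdef : bornRemainder σ b ν s =
      fun t => ∫ y, imageSum σ b y (bornSum σ b ν s y) t * s y ∂ν := rfl
  rw [hdef, laplace_integral hs hs1 (measurable_imageSum_bornSum hσ hb hs hs1) hC hβκ]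
  congr 1 with y
  rw [laplace_imageSum hσ hb ((bornRate_nonneg hσ).trans_lt hκ) _ ((hB y).integrable
    ((measurable_bornSum hσ hb hs hs1).comp measurable_prodMk_left) hβκ)]

end LaplaceBorn

/-! ### The free equation and variation of constants -/

lemma uIcc_zero_subset_of_mem {b x : ℝ} (hx : x ∈ Icc 0 b) : uIcc 0 x ⊆ Icc 0 b := by
  rw [uIcc_of_le hx.1]
  exact Icc_subset_Icc_right hx.2

lemma intervalIntegrable_zero_of_mem {E : Type*} [NormedAddCommGroup E] {g : ℝ → E} {b x : ℝ}
    (hg : IntervalIntegrable g volume 0 b) (hx : x ∈ Icc 0 b) : IntervalIntegrable g volume 0 x :=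
  hg.mono_set (uIcc_subset_uIcc_left (by rwa [uIcc_of_le (hx.1.trans hx.2)]))

lemma integral_mul_integral_swap {f g : ℝ → ℂ} {a b : ℝ} (hab : a ≤ b)
    (hf : IntervalIntegrable f volume a b) (hg : IntervalIntegrable g volume a b) :
    ∫ t in a..b, f t * ∫ u in a..t, g u = ∫ u in a..b, (∫ t in u..b, f t) * g u := by
  have hfI := (intervalIntegrable_iff_integrableOn_Ioc_of_le hab).1 hf
  have hgI := (intervalIntegrable_iff_integrableOn_Ioc_of_le hab).1 hg
  have fubini := integral_integral_swap (μ := volume.restrict (Ioc a b))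
    (ν := volume.restrict (Ioc a b))
    (f := fun t u => {p : ℝ × ℝ | p.2 ≤ p.1}.indicator (fun p => f p.1 * g p.2) (t, u))
    ((hfI.mul_prod hgI).indicator (measurableSet_le measurable_snd measurable_fst))
  rw [intervalIntegral.integral_of_le hab, intervalIntegral.integral_of_le hab]
  refine Eq.trans (setIntegral_congr_fun measurableSet_Ioc fun t ht => ?_)
    (fubini.trans (setIntegral_congr_fun measurableSet_Ioc fun u hu => ?_))
  · have hslice : (fun u => {p : ℝ × ℝ | p.2 ≤ p.1}.indicator (fun p => f p.1 * g p.2) (t, u)) =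
        (Iic t).indicator fun u => f t * g u := by
      ext u
      by_cases h : u ≤ t <;> simp [indicator, h]
    simp only [hslice]
    rw [integral_indicator measurableSet_Iic, Measure.restrict_restrict measurableSet_Iic,
      inter_comm, Ioc_inter_Iic, min_eq_right ht.2, integral_const_mul,
      intervalIntegral.integral_of_le ht.1.le]
  · have hslice : (fun t => {p : ℝ × ℝ | p.2 ≤ p.1}.indicator (fun p => f p.1 * g p.2) (t, u)) =
        (Ici u).indicator fun t => f t * g u := by
      ext t
      by_cases h : u ≤ t <;> simp [indicator, h]
    have hinter : Ici u ∩ Ioc a b = Icc u b := by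
      ext t
      simp only [mem_inter_iff, mem_Ici, mem_Ioc, mem_Icc]
      exact ⟨fun h => ⟨h.1, h.2.2⟩, fun h => ⟨h.1, hu.1.trans_le h.1, h.2⟩⟩
    simp only [hslice]
    rw [integral_indicator measurableSet_Ici, Measure.restrict_restrict measurableSet_Ici, hinter,
      integral_mul_const, integral_Icc_eq_integral_Ioc, ← intervalIntegral.integral_of_le hu.2]

/-- `F` is absolutely continuous on `[0,b]` with derivative `f ∈ L¹`, in integrated form; this is
the sense in which `IsSchrodingerSolution` asks for the differential equation to hold. -/
structure IsPrimitiveOn (b : ℝ) (F f : ℝ → ℂ) : Prop where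
  intervalIntegrable : IntervalIntegrable f volume 0 b
  eq_add_integral : ∀ x ∈ Icc 0 b, F x = F 0 + ∫ t in (0 : ℝ)..x, f t

namespace IsPrimitiveOn

variable {b : ℝ} {F G f g : ℝ → ℂ}

lemma of_hasDerivAt (hF : ∀ t, HasDerivAt F (f t) t) (hf : Continuous f) : IsPrimitiveOn b F f :=
  ⟨hf.intervalIntegrable 0 b, fun x _ => by
    rw [intervalIntegral.integral_eq_sub_of_hasDerivAt (fun t _ => hF t)
      (hf.intervalIntegrable 0 x), add_sub_cancel]⟩

lemma integral (hf : IntervalIntegrable f volume 0 b) :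
    IsPrimitiveOn b (fun x => ∫ t in (0 : ℝ)..x, f t) f :=
  ⟨hf, fun x _ => by simp⟩

lemma congr (hb : 0 ≤ b) (hF : IsPrimitiveOn b F f) (hGF : EqOn G F (Icc 0 b))
    (hgf : EqOn g f (Icc 0 b)) : IsPrimitiveOn b G g := by
  refine ⟨hF.intervalIntegrable.congr fun t ht =>
    (hgf (uIcc_zero_subset_of_mem ⟨hb, le_rfl⟩ (uIoc_subset_uIcc ht))).symm, fun x hx => ?_⟩
  rw [hGF hx, hGF ⟨le_rfl, hb⟩, hF.eq_add_integral x hx,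
    intervalIntegral.integral_congr fun t ht => hgf (uIcc_zero_subset_of_mem hx ht)]

lemma const_mul (c : ℂ) (hF : IsPrimitiveOn b F f) :
    IsPrimitiveOn b (fun x => c * F x) fun x => c * f x :=
  ⟨hF.intervalIntegrable.const_mul c, fun x hx => by
    rw [intervalIntegral.integral_const_mul, hF.eq_add_integral x hx, mul_add]⟩

lemma const_sub (c : ℂ) (hF : IsPrimitiveOn b F f) :
    IsPrimitiveOn b (fun x => c - F x) fun x => -f x :=
  ⟨hF.intervalIntegrable.neg, fun x hx => by
    rw [intervalIntegral.integral_neg, hF.eq_add_integral x hx]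
    ring⟩

lemma add (hF : IsPrimitiveOn b F f) (hG : IsPrimitiveOn b G g) :
    IsPrimitiveOn b (fun x => F x + G x) fun x => f x + g x :=
  ⟨hF.intervalIntegrable.add hG.intervalIntegrable, fun x hx => by
    rw [intervalIntegral.integral_add (intervalIntegrable_zero_of_mem hF.intervalIntegrable hx)
      (intervalIntegrable_zero_of_mem hG.intervalIntegrable hx), hF.eq_add_integral x hx,
      hG.eq_add_integral x hx]
    ring⟩

lemma sub (hF : IsPrimitiveOn b F f) (hG : IsPrimitiveOn b G g) :
    IsPrimitiveOn b (fun x => F x - G x) fun x => f x - g x :=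
  ⟨hF.intervalIntegrable.sub hG.intervalIntegrable, fun x hx => by
    rw [intervalIntegral.integral_sub (intervalIntegrable_zero_of_mem hF.intervalIntegrable hx)
      (intervalIntegrable_zero_of_mem hG.intervalIntegrable hx), hF.eq_add_integral x hx,
      hG.eq_add_integral x hx]
    ring⟩

lemma continuousOn (hF : IsPrimitiveOn b F f) : ContinuousOn F (Icc 0 b) := by
  rcases lt_or_ge b 0 with hb | hb
  · simp [Icc_eq_empty_of_lt hb]
  have hprim : ContinuousOn (fun x => ∫ t in (0 : ℝ)..x, f t) (Icc 0 b) := by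
    simpa only [uIcc_of_le hb] using intervalIntegral.continuousOn_primitive_interval'
      hF.intervalIntegrable left_mem_uIcc
  exact (continuousOn_const.add hprim).congr hF.eq_add_integral

lemma mul (hb : 0 ≤ b) (hF : IsPrimitiveOn b F f) (hG : IsPrimitiveOn b G g) :
    IsPrimitiveOn b (fun x => F x * G x) fun x => f x * G x + F x * g x := by
  have hf := hF.intervalIntegrable
  have hg := hG.intervalIntegrable
  have hFc : ContinuousOn F (uIcc 0 b) := by rw [uIcc_of_le hb]; exact hF.continuousOn
  have hGc : ContinuousOn G (uIcc 0 b) := by rw [uIcc_of_le hb]; exact hG.continuousOn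
  have hfG : IntervalIntegrable (fun t => f t * G t) volume 0 b := hf.mul_continuousOn hGc
  have hFg : IntervalIntegrable (fun t => F t * g t) volume 0 b := hg.continuousOn_mul hFc
  refine ⟨hfG.add hFg, fun x hx => ?_⟩
  have hfx := intervalIntegrable_zero_of_mem hf hx
  have hgx := intervalIntegrable_zero_of_mem hg hx
  have hmem := uIcc_zero_subset_of_mem hx
  have hfG_eq : ∫ t in (0 : ℝ)..x, f t * (G t - G 0) =
      ∫ u in (0 : ℝ)..x, (F x - F u) * g u := by
    rw [intervalIntegral.integral_congr fun t ht =>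
        congrArg (f t * ·) (sub_eq_iff_eq_add'.2 (hG.eq_add_integral t (hmem ht))),
      integral_mul_integral_swap hx.1 hfx hgx]
    refine intervalIntegral.integral_congr fun u hu => ?_
    have hfu := intervalIntegrable_zero_of_mem hf (hmem hu)
    simp only [hF.eq_add_integral x hx, hF.eq_add_integral u (hmem hu),
      ← intervalIntegral.integral_add_adjacent_intervals hfu (hfu.symm.trans hfx)]
    ring
  simp only [mul_sub, sub_mul] at hfG_eq
  rw [intervalIntegral.integral_sub (intervalIntegrable_zero_of_mem hfG hx) (hfx.mul_const _),
    intervalIntegral.integral_sub (hgx.const_mul _) (intervalIntegrable_zero_of_mem hFg hx),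
    intervalIntegral.integral_mul_const, intervalIntegral.integral_const_mul] at hfG_eq
  rw [intervalIntegral.integral_add (intervalIntegrable_zero_of_mem hfG hx)
    (intervalIntegrable_zero_of_mem hFg hx)]
  linear_combination F x * hG.eq_add_integral x hx + G 0 * hF.eq_add_integral x hx - hfG_eq

end IsPrimitiveOn

/-- The derivative of `freeWeyl`. -/
noncomputable def freeWeylDeriv (σ b : ℝ) (κ : ℂ) (x : ℝ) : ℂ :=
  -κ * (Complex.exp (-κ * x) + σ * Complex.exp (-κ * (2 * b - x))) /
    (1 - σ * Complex.exp (-2 * κ * b))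

section FreeEquation

variable {σ b : ℝ} {κ : ℂ}

lemma hasDerivAt_exp_mul_ofReal (c : ℂ) (x : ℝ) :
    HasDerivAt (fun t : ℝ => Complex.exp (c * t)) (c * Complex.exp (c * x)) x := by
  have hlin : HasDerivAt (fun t : ℝ => c * (t : ℂ)) c x := by
    simpa using (Complex.ofRealCLM.hasDerivAt (x := x)).const_mul c
  simpa [mul_comm] using hlin.cexp

lemma hasDerivAt_exp_reflect (b : ℝ) (κ : ℂ) (x : ℝ) :
    HasDerivAt (fun t : ℝ => Complex.exp (-κ * (2 * b - t)))
      (κ * Complex.exp (-κ * (2 * b - x))) x := by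
  have hsplit : ∀ t : ℝ, Complex.exp (-κ * (2 * b - t)) =
      Complex.exp (-κ * (2 * b)) * Complex.exp (κ * t) := fun t => by
    rw [← Complex.exp_add]
    congr 1
    ring
  rw [funext hsplit, hsplit]
  exact ((hasDerivAt_exp_mul_ofReal κ x).const_mul _).congr_deriv (by ring)

lemma hasDerivAt_freeWeyl (x : ℝ) :
    HasDerivAt (freeWeyl σ b κ) (freeWeylDeriv σ b κ x) x := by
  refine (((hasDerivAt_exp_mul_ofReal (-κ) x).sub
    ((hasDerivAt_exp_reflect b κ x).const_mul (σ : ℂ))).div_const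
      (1 - σ * Complex.exp (-2 * κ * b))).congr_deriv ?_
  rw [freeWeylDeriv]
  ring

lemma hasDerivAt_freeWeylDeriv (x : ℝ) :
    HasDerivAt (freeWeylDeriv σ b κ) (κ ^ 2 * freeWeyl σ b κ x) x := by
  refine ((((hasDerivAt_exp_mul_ofReal (-κ) x).add
    ((hasDerivAt_exp_reflect b κ x).const_mul (σ : ℂ))).const_mul (-κ)).div_const
      (1 - σ * Complex.exp (-2 * κ * b))).congr_deriv ?_
  rw [freeWeyl]
  ring

lemma hasDerivAt_sinh_div (hκ : κ ≠ 0) (x : ℝ) :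
    HasDerivAt (fun t : ℝ => Complex.sinh (κ * t) / κ) (Complex.cosh (κ * x)) x := by
  refine (((hasDerivAt_id (x : ℂ)).const_mul κ).csinh.div_const κ).comp_ofReal.congr_deriv ?_
  simp only [id_eq]
  field_simp

lemma hasDerivAt_cosh_mul (hκ : κ ≠ 0) (x : ℝ) :
    HasDerivAt (fun t : ℝ => Complex.cosh (κ * t)) (κ ^ 2 * (Complex.sinh (κ * x) / κ)) x := by
  refine ((hasDerivAt_id (x : ℂ)).const_mul κ).ccosh.comp_ofReal.congr_deriv ?_
  simp only [id_eq]
  field_simp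

@[fun_prop]
lemma continuous_freeWeyl : Continuous (freeWeyl σ b κ) :=
  continuous_iff_continuousAt.2 fun x => (hasDerivAt_freeWeyl x).continuousAt

@[fun_prop]
lemma continuous_freeWeylDeriv : Continuous (freeWeylDeriv σ b κ) :=
  continuous_iff_continuousAt.2 fun x => (hasDerivAt_freeWeylDeriv x).continuousAt

lemma isPrimitiveOn_freeWeyl : IsPrimitiveOn b (freeWeyl σ b κ) (freeWeylDeriv σ b κ) :=
  .of_hasDerivAt hasDerivAt_freeWeyl continuous_freeWeylDeriv

lemma isPrimitiveOn_freeWeylDeriv :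
    IsPrimitiveOn b (freeWeylDeriv σ b κ) fun x => κ ^ 2 * freeWeyl σ b κ x :=
  .of_hasDerivAt hasDerivAt_freeWeylDeriv (by fun_prop)

lemma isPrimitiveOn_sinh_div (hκ : κ ≠ 0) :
    IsPrimitiveOn b (fun x => Complex.sinh (κ * x) / κ) fun x => Complex.cosh (κ * x) :=
  .of_hasDerivAt (hasDerivAt_sinh_div hκ) (by fun_prop)

lemma isPrimitiveOn_cosh_mul (hκ : κ ≠ 0) :
    IsPrimitiveOn b (fun x => Complex.cosh (κ * x)) fun x => κ ^ 2 * (Complex.sinh (κ * x) / κ) :=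
  .of_hasDerivAt (hasDerivAt_cosh_mul hκ) (by fun_prop)

lemma one_sub_mul_exp_ne_zero (hσ : |σ| ≤ 1) (hb : 0 < b) (hκ : 0 < κ.re) :
    (1 : ℂ) - σ * Complex.exp (-2 * κ * b) ≠ 0 := fun h => by
  have hlt := norm_mul_exp_neg_lt_one hσ hb hκ
  rw [← sub_eq_zero.1 h, norm_one] at hlt
  exact lt_irrefl _ hlt

lemma free_wronskian (hσ : |σ| ≤ 1) (hb : 0 < b) (hκ : 0 < κ.re) (x : ℝ) :
    Complex.cosh (κ * x) * freeWeyl σ b κ x -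
      Complex.sinh (κ * x) / κ * freeWeylDeriv σ b κ x = 1 := by
  have hκ0 := ne_zero_of_re_pos hκ
  have hden := one_sub_mul_exp_ne_zero hσ hb hκ
  have hreflect : Complex.exp (-κ * (2 * b - x)) =
      Complex.exp (-2 * κ * b) * Complex.exp (κ * x) := by
    rw [← Complex.exp_add]
    congr 1
    ring
  have hinv : Complex.exp (κ * x) * Complex.exp (-(κ * x)) = 1 := by
    rw [← Complex.exp_add, add_neg_cancel, Complex.exp_zero]
  rw [freeWeyl, freeWeylDeriv, Complex.cosh, Complex.sinh, hreflect, neg_mul κ (x : ℂ)]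
  generalize Complex.exp (-2 * κ * b) = E at *
  generalize Complex.exp (κ * x) = e at *
  generalize Complex.exp (-(κ * x)) = e' at *
  field_simp
  linear_combination 2 * (1 - (σ : ℂ) * E) * hinv

lemma freeWeyl_zero (hσ : |σ| ≤ 1) (hb : 0 < b) (hκ : 0 < κ.re) : freeWeyl σ b κ 0 = 1 := by
  simpa using free_wronskian hσ hb hκ 0

lemma freeWeyl_one_right : freeWeyl 1 b κ b = 0 := by
  have hb : (2 * b - b : ℂ) = b := by ring
  simp [freeWeyl, hb]

lemma freeWeylDeriv_neg_one_right : freeWeylDeriv (-1) b κ b = 0 := by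
  have hb : (2 * b - b : ℂ) = b := by ring
  simp [freeWeylDeriv, hb]

/-- Variation of constants: the solution of `-v'' + p = -κ² v` with `v(0) = a` that is a multiple
of the free Weyl solution at `b` up to a jump `c₀`, which carries a point mass of `p` at `b`. -/
noncomputable def resolventSolution (σ b : ℝ) (κ : ℂ) (p : ℝ → ℂ) (a c₀ : ℂ) (x : ℝ) : ℂ :=
  a * freeWeyl σ b κ x -
    (freeWeyl σ b κ x * (∫ t in (0 : ℝ)..x, Complex.sinh (κ * t) / κ * p t) +
      Complex.sinh (κ * x) / κ * (((∫ t in (0 : ℝ)..b, freeWeyl σ b κ t * p t) + c₀) -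
        ∫ t in (0 : ℝ)..x, freeWeyl σ b κ t * p t))

/-- The derivative of `resolventSolution`. -/
noncomputable def resolventSolutionDeriv (σ b : ℝ) (κ : ℂ) (p : ℝ → ℂ) (a c₀ : ℂ) (x : ℝ) : ℂ :=
  a * freeWeylDeriv σ b κ x -
    (freeWeylDeriv σ b κ x * (∫ t in (0 : ℝ)..x, Complex.sinh (κ * t) / κ * p t) +
      Complex.cosh (κ * x) * (((∫ t in (0 : ℝ)..b, freeWeyl σ b κ t * p t) + c₀) -
        ∫ t in (0 : ℝ)..x, freeWeyl σ b κ t * p t))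

variable {p : ℝ → ℂ} {a c₀ : ℂ}

lemma intervalIntegrable_sinh_div_mul (hp : IntervalIntegrable p volume 0 b) :
    IntervalIntegrable (fun t : ℝ => Complex.sinh (κ * t) / κ * p t) volume 0 b :=
  hp.continuousOn_mul (by fun_prop)

lemma intervalIntegrable_freeWeyl_mul (hp : IntervalIntegrable p volume 0 b) :
    IntervalIntegrable (fun t : ℝ => freeWeyl σ b κ t * p t) volume 0 b :=
  hp.continuousOn_mul (by fun_prop)

lemma isPrimitiveOn_resolventSolution (hb : 0 ≤ b) (hκ : κ ≠ 0)
    (hp : IntervalIntegrable p volume 0 b) :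
    IsPrimitiveOn b (resolventSolution σ b κ p a c₀) (resolventSolutionDeriv σ b κ p a c₀) := by
  refine ((isPrimitiveOn_freeWeyl.const_mul a).sub
    ((isPrimitiveOn_freeWeyl.mul hb (.integral (intervalIntegrable_sinh_div_mul hp))).add
      ((isPrimitiveOn_sinh_div hκ).mul hb (.const_sub _
        (.integral (intervalIntegrable_freeWeyl_mul hp)))))).congr hb (fun _ _ => rfl) fun x _ => ?_
  rw [resolventSolutionDeriv]
  ring

lemma isPrimitiveOn_resolventSolutionDeriv (hσ : |σ| ≤ 1) (hb : 0 < b) (hκ : 0 < κ.re)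
    (hp : IntervalIntegrable p volume 0 b) :
    IsPrimitiveOn b (resolventSolutionDeriv σ b κ p a c₀) fun x =>
      κ ^ 2 * resolventSolution σ b κ p a c₀ x + p x := by
  refine ((isPrimitiveOn_freeWeylDeriv.const_mul a).sub
    ((isPrimitiveOn_freeWeylDeriv.mul hb.le (.integral (intervalIntegrable_sinh_div_mul hp))).add
      ((isPrimitiveOn_cosh_mul (ne_zero_of_re_pos hκ)).mul hb.le (.const_sub _
        (.integral (intervalIntegrable_freeWeyl_mul hp)))))).congr hb.le (fun _ _ => rfl)
    fun x _ => ?_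
  simp only [resolventSolution]
  linear_combination -(p x) * free_wronskian hσ hb hκ x

lemma resolventSolution_zero (hσ : |σ| ≤ 1) (hb : 0 < b) (hκ : 0 < κ.re) :
    resolventSolution σ b κ p a c₀ 0 = a := by
  simp [resolventSolution, freeWeyl_zero hσ hb hκ]

lemma resolventSolutionDeriv_zero : resolventSolutionDeriv σ b κ p a c₀ 0 =
    a * freeWeylDeriv σ b κ 0 - ((∫ t in (0 : ℝ)..b, freeWeyl σ b κ t * p t) + c₀) := by
  simp [resolventSolutionDeriv]

lemma resolventSolution_boundary (hσ : |σ| ≤ 1) (hb : 0 < b) (hκ : 0 < κ.re) (c : ℂ) :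
    (resolventSolutionDeriv σ b κ p a (freeWeyl σ b κ b * c) b + c) * freeWeyl σ b κ b =
      resolventSolution σ b κ p a (freeWeyl σ b κ b * c) b * freeWeylDeriv σ b κ b := by
  rw [resolventSolution, resolventSolutionDeriv]
  linear_combination -(c * freeWeyl σ b κ b) * free_wronskian hσ hb hκ b

variable {w dw : ℝ → ℂ}

lemma exp_neg_mul_mul_eq_of_free_equation (hb : 0 ≤ b) (hw : IsPrimitiveOn b w dw)
    (hdw : IsPrimitiveOn b dw fun t => κ ^ 2 * w t) {c : ℂ} (hc : c ^ 2 = κ ^ 2) {x : ℝ}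
    (hx : x ∈ Icc 0 b) : Complex.exp (-c * x) * (dw x + c * w x) = dw 0 + c * w 0 := by
  have hprim : IsPrimitiveOn b (fun t => Complex.exp (-c * t) * (dw t + c * w t)) fun _ => 0 := by
    refine (IsPrimitiveOn.mul hb (.of_hasDerivAt (hasDerivAt_exp_mul_ofReal (-c)) (by fun_prop))
      (hdw.add (hw.const_mul c))).congr hb (fun _ _ => rfl) fun t _ => ?_
    linear_combination Complex.exp (-c * t) * w t * hc
  simpa using hprim.eq_add_integral x hx

lemma eq_sinh_and_cosh_of_free_equation (hb : 0 ≤ b) (hκ : κ ≠ 0) (hw : IsPrimitiveOn b w dw)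
    (hdw : IsPrimitiveOn b dw fun t => κ ^ 2 * w t) (hw0 : w 0 = 0) {x : ℝ} (hx : x ∈ Icc 0 b) :
    w x = dw 0 * (Complex.sinh (κ * x) / κ) ∧ dw x = dw 0 * Complex.cosh (κ * x) := by
  have hdecay := exp_neg_mul_mul_eq_of_free_equation hb hw hdw (c := κ) rfl hx
  have hgrow := exp_neg_mul_mul_eq_of_free_equation hb hw hdw (c := -κ) (neg_sq κ) hx
  have hinv : Complex.exp (κ * x) * Complex.exp (-(κ * x)) = 1 := by
    rw [← Complex.exp_add, add_neg_cancel, Complex.exp_zero]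
  rw [hw0, mul_zero, add_zero, neg_mul] at hdecay
  rw [hw0, mul_zero, add_zero, neg_neg] at hgrow
  rw [Complex.sinh, Complex.cosh, ← mul_div_assoc, eq_div_iff hκ]
  constructor
  · linear_combination (Complex.exp (κ * x) * hdecay - Complex.exp (-(κ * x)) * hgrow) / 2 -
      κ * w x * hinv
  · linear_combination (Complex.exp (κ * x) * hdecay + Complex.exp (-(κ * x)) * hgrow) / 2 -
      dw x * hinv

lemma eq_zero_of_free_equation (hσ : |σ| ≤ 1) (hb : 0 < b) (hκ : 0 < κ.re)
    (hw : IsPrimitiveOn b w dw) (hdw : IsPrimitiveOn b dw fun t => κ ^ 2 * w t) (hw0 : w 0 = 0)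
    (hwb : dw b * freeWeyl σ b κ b = w b * freeWeylDeriv σ b κ b) {x : ℝ} (hx : x ∈ Icc 0 b) :
    w x = 0 ∧ dw x = 0 := by
  have hrep := fun y hy =>
    eq_sinh_and_cosh_of_free_equation hb.le (ne_zero_of_re_pos hκ) hw hdw hw0 (x := y) hy
  have hdw0 : dw 0 = 0 := by
    rw [(hrep b ⟨hb.le, le_rfl⟩).1, (hrep b ⟨hb.le, le_rfl⟩).2] at hwb
    linear_combination hwb - dw 0 * free_wronskian hσ hb hκ b
  simpa [hdw0] using hrep x hx

end FreeEquation

/-! ### The Weyl solution as a Laplace transform -/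

/-- The test functions against which `RepresentsPotential` represents a potential: measurable on
`(0,b)` and bounded on `[0,b]`. -/
structure BoundedMeasurableOn (b : ℝ) (F : ℝ → ℂ) : Prop where
  aestronglyMeasurable : AEStronglyMeasurable F (volume.restrict (Ioo 0 b))
  exists_bound : ∃ K, ∀ y ∈ Icc 0 b, ‖F y‖ ≤ K

namespace BoundedMeasurableOn

variable {b : ℝ} {F G : ℝ → ℂ} {q : ℝ → ℝ}

lemma of_continuousOn (hF : ContinuousOn F (Icc 0 b)) : BoundedMeasurableOn b F :=
  ⟨(hF.mono Ioo_subset_Icc_self).aestronglyMeasurable measurableSet_Ioo,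
    isCompact_Icc.exists_bound_of_continuousOn hF⟩

lemma mul (hF : BoundedMeasurableOn b F) (hG : BoundedMeasurableOn b G) :
    BoundedMeasurableOn b fun y => F y * G y := by
  obtain ⟨hF, K, hK⟩ := hF
  obtain ⟨hG, L, hL⟩ := hG
  refine ⟨hF.mul hG, K * L, fun y hy => ?_⟩
  rw [norm_mul]
  exact mul_le_mul (hK y hy) (hL y hy) (norm_nonneg _) ((norm_nonneg _).trans (hK y hy))

lemma add (hF : BoundedMeasurableOn b F) (hG : BoundedMeasurableOn b G) :
    BoundedMeasurableOn b fun y => F y + G y := by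
  obtain ⟨hF, K, hK⟩ := hF
  obtain ⟨hG, L, hL⟩ := hG
  exact ⟨hF.add hG, K + L, fun y hy => (norm_add_le _ _).trans (add_le_add (hK y hy) (hL y hy))⟩

lemma integrableOn_mul (hF : BoundedMeasurableOn b F) (hq : IntegrableOn q (Ioo 0 b)) :
    IntegrableOn (fun y => F y * q y) (Ioo 0 b) := by
  obtain ⟨hF, K, hK⟩ := hF
  exact Integrable.bdd_mul (c := K) hq.ofReal hF <|
    (ae_restrict_mem measurableSet_Ioo).mono fun y hy => hK y (Ioo_subset_Icc_self hy)

lemma intervalIntegrable_mul (hF : BoundedMeasurableOn b F) (hb : 0 ≤ b)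
    (hq : IntegrableOn q (Ioo 0 b)) : IntervalIntegrable (fun y => F y * q y) volume 0 b :=
  (intervalIntegrable_iff_integrableOn_Ioo_of_le hb).2 (hF.integrableOn_mul hq)

end BoundedMeasurableOn

/-- The measure `s ν` represents the potential `q` on `(0,b)` together with a point mass `r` at
`b`. The point mass turns the boundary condition `u'(b) + r u(b) = 0` into a Neumann condition. -/
structure RepresentsPotential (b : ℝ) (q : ℝ → ℝ) (r : ℝ) (ν : Measure ℝ) (s : ℝ → ℝ) : Prop where
  measurable : Measurable s
  abs_le_one : ∀ y, |s y| ≤ 1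
  measureReal_univ : ν.real univ = potentialNorm b q + |r|
  measureReal_Iio : ν.real (Iio b) = potentialNorm b q
  integral_eq : ∀ F : ℝ → ℂ, BoundedMeasurableOn b F →
    ∫ y, F y * s y ∂ν = (∫ y in (0 : ℝ)..b, F y * q y) + r * F b

lemma exists_abs_le_one_withDensity {α : Type*} [MeasurableSpace α] {μ : Measure α} {Q : α → ℝ}
    (hQ : Integrable Q μ) : ∃ (ν : Measure α) (s : α → ℝ), IsFiniteMeasure ν ∧ Measurable s ∧
      (∀ y, |s y| ≤ 1) ∧ (∀ A, MeasurableSet A → ν.real A = ∫ y in A, |Q y| ∂μ) ∧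
      ∀ F : α → ℂ, ∫ y, F y * s y ∂ν = ∫ y, F y * Q y ∂μ := by
  obtain ⟨P, hP, hPQ⟩ : ∃ P : α → ℝ, Measurable P ∧ Q =ᵐ[μ] P :=
    ⟨_, hQ.1.stronglyMeasurable_mk.measurable, hQ.1.ae_eq_mk⟩
  have hνA : ∀ A, MeasurableSet A →
      (μ.withDensity fun y => (‖P y‖₊ : ENNReal)) A = ∫⁻ y in A, ‖P y‖ₑ ∂μ :=
    fun A hA => withDensity_apply _ hA
  have hPi : Integrable P μ := hQ.congr hPQ
  refine ⟨μ.withDensity fun y => (‖P y‖₊ : ENNReal), fun y => if 0 ≤ P y then 1 else -1,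
    ⟨?_⟩, ?_, fun y => ?_, fun A hA => ?_, fun F => ?_⟩
  · rw [hνA _ .univ, Measure.restrict_univ]
    exact hPi.2
  · exact Measurable.ite (measurableSet_le measurable_const hP) measurable_const measurable_const
  · dsimp only
    split_ifs <;> simp
  · rw [Measure.real, hνA A hA, ← integral_norm_eq_lintegral_enorm hPi.1.restrict]
    exact integral_congr_ae <| (ae_restrict_of_ae hPQ).mono fun y hy => by
      simp only [hy, Real.norm_eq_abs]
  · rw [integral_withDensity_eq_integral_smul hP.nnnorm]
    refine integral_congr_ae <| hPQ.mono fun y hy => ?_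
    have hpolar : |P y| * (if 0 ≤ P y then 1 else -1) = P y := by
      split_ifs with h
      · rw [abs_of_nonneg h, mul_one]
      · rw [abs_of_neg (not_le.1 h), neg_mul_neg, mul_one]
    simp only [NNReal.smul_def, coe_nnnorm, Real.norm_eq_abs, Complex.real_smul, hy]
    rw [mul_left_comm, ← Complex.ofReal_mul, hpolar]

lemma exists_representsPotential {b : ℝ} (hb : 0 < b) {q : ℝ → ℝ}
    (hq : IntegrableOn q (Ioo 0 b)) (r : ℝ) :
    ∃ (ν : Measure ℝ) (s : ℝ → ℝ), IsFiniteMeasure ν ∧ RepresentsPotential b q r ν s := by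
  have hupdate : ∀ y ∈ Ioo 0 b, Function.update q b r y = q y :=
    fun y hy => Function.update_of_ne hy.2.ne _ _
  have hQ : IntegrableOn (Function.update q b r) (Ioo 0 b) :=
    hq.congr_fun (fun y hy => (hupdate y hy).symm) measurableSet_Ioo
  have hnorm : ∫ y in Ioo 0 b, |Function.update q b r y| = potentialNorm b q := by
    rw [potentialNorm, intervalIntegral.integral_of_le hb.le, integral_Ioc_eq_integral_Ioo,
      setIntegral_congr_fun measurableSet_Ioo fun y hy => congrArg abs (hupdate y hy)]
  have hdirac : ∀ g : ℝ → ℝ, Integrable g (Measure.dirac b) :=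
    fun g => integrable_dirac enorm_lt_top
  obtain ⟨ν, s, hfin, hs, hs1, hνA, hint⟩ := exists_abs_le_one_withDensity
    (μ := volume.restrict (Ioo 0 b) + Measure.dirac b) (integrable_add_measure.2 ⟨hQ, hdirac _⟩)
  refine ⟨ν, s, hfin, hs, hs1, ?_, ?_, fun F hF => ?_⟩
  · rw [hνA _ .univ, Measure.restrict_univ, integral_add_measure hQ.abs (hdirac _), hnorm,
      integral_dirac, Function.update_self]
  · have hb : Measure.dirac b (Iio b) = 0 := by simp
    rw [hνA _ measurableSet_Iio, Measure.restrict_add, Measure.restrict_eq_zero.2 hb, add_zero,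
      Measure.restrict_restrict measurableSet_Iio, inter_eq_right.2 fun y hy => hy.2, hnorm]
  · rw [hint, integral_add_measure (hF.integrableOn_mul hQ) (integrable_dirac enorm_lt_top),
      integral_dirac, Function.update_self, mul_comm (F b), intervalIntegral.integral_of_le hb.le,
      integral_Ioc_eq_integral_Ioo, setIntegral_congr_fun measurableSet_Ioo fun y hy =>
        congrArg (fun c : ℝ => F y * c) (hupdate y hy)]

section WeylSolution

variable {σ b r : ℝ} {κ : ℂ} {q s : ℝ → ℝ} {ν : Measure ℝ}

lemma RepresentsPotential.integral_add {F G : ℝ → ℂ} (hν : RepresentsPotential b q r ν s)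
    (hb : 0 ≤ b) (hq : IntegrableOn q (Ioo 0 b)) (hF : BoundedMeasurableOn b F)
    (hG : BoundedMeasurableOn b G) :
    ∫ y, (F y + G y) * s y ∂ν = (∫ y, F y * s y ∂ν) + ∫ y, G y * s y ∂ν := by
  rw [hν.integral_eq _ hF, hν.integral_eq _ hG, hν.integral_eq _ (hF.add hG)]
  simp only [add_mul]
  rw [intervalIntegral.integral_add (hF.intervalIntegrable_mul hb hq)
    (hG.intervalIntegrable_mul hb hq)]
  ring

lemma boundedMeasurableOn_freeWeyl : BoundedMeasurableOn b (freeWeyl σ b κ) :=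
  .of_continuousOn continuous_freeWeyl.continuousOn

section Green

variable {x y : ℝ}

lemma boundedMeasurableOn_greenFunction (hσ : |σ| ≤ 1) (hb : 0 < b) (hκ : 0 < κ.re) (x : ℝ) :
    BoundedMeasurableOn b (greenFunction σ b κ x) :=
  ⟨(measurable_greenFunction hb x).aestronglyMeasurable, _,
    fun y _ => norm_greenFunction_le hσ hb hκ x y⟩

lemma greenFunction_of_le (hσ : |σ| ≤ 1) (hb : 0 < b) (hκ : 0 < κ.re) (hy : 0 ≤ y) (hyx : y ≤ x)
    (hx : x ≤ b) : greenFunction σ b κ x y = freeWeyl σ b κ x * (Complex.sinh (κ * y) / κ) := by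
  rw [greenFunction, laplace_greenTime hσ hb hκ ⟨hy.trans hyx, hx⟩ ⟨hy, hyx.trans hx⟩,
    min_eq_right hyx, max_eq_left hyx, mul_comm]

lemma greenFunction_of_ge (hσ : |σ| ≤ 1) (hb : 0 < b) (hκ : 0 < κ.re) (hx : 0 ≤ x) (hxy : x ≤ y)
    (hy : y ≤ b) : greenFunction σ b κ x y = Complex.sinh (κ * x) / κ * freeWeyl σ b κ y := by
  rw [greenFunction, laplace_greenTime hσ hb hκ ⟨hx, hxy.trans hy⟩ ⟨hx.trans hxy, hy⟩,
    min_eq_left hxy, max_eq_right hxy]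

lemma resolventSolution_eq_greenFunction (hσ : |σ| ≤ 1) (hb : 0 < b) (hκ : 0 < κ.re) {p : ℝ → ℂ}
    (hp : IntervalIntegrable p volume 0 b) (a c : ℂ) (hx : x ∈ Icc 0 b) :
    resolventSolution σ b κ p a (freeWeyl σ b κ b * c) x = a * freeWeyl σ b κ x -
      ((∫ y in (0 : ℝ)..b, greenFunction σ b κ x y * p y) + greenFunction σ b κ x b * c) := by
  have hφp := intervalIntegrable_freeWeyl_mul (σ := σ) (κ := κ) hp
  have hφp_left := intervalIntegrable_zero_of_mem hφp hx
  have hφp_right := hφp_left.symm.trans hφp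
  have hsp_left := intervalIntegrable_zero_of_mem (intervalIntegrable_sinh_div_mul (κ := κ) hp) hx
  have hleft : EqOn (fun y : ℝ => freeWeyl σ b κ x * (Complex.sinh (κ * y) / κ * p y))
      (fun y => greenFunction σ b κ x y * p y) (uIcc 0 x) := fun y hy => by
    rw [uIcc_of_le hx.1] at hy
    simp only [greenFunction_of_le hσ hb hκ hy.1 hy.2 hx.2, mul_assoc]
  have hright : EqOn (fun y : ℝ => Complex.sinh (κ * x) / κ * (freeWeyl σ b κ y * p y))
      (fun y => greenFunction σ b κ x y * p y) (uIcc x b) := fun y hy => by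
    rw [uIcc_of_le hx.2] at hy
    simp only [greenFunction_of_ge hσ hb hκ hx.1 hy.1 hy.2, mul_assoc]
  rw [← intervalIntegral.integral_add_adjacent_intervals
      ((hsp_left.const_mul _).congr (hleft.mono uIoc_subset_uIcc))
      ((hφp_right.const_mul _).congr (hright.mono uIoc_subset_uIcc)),
    ← intervalIntegral.integral_congr hleft, ← intervalIntegral.integral_congr hright,
    intervalIntegral.integral_const_mul, intervalIntegral.integral_const_mul,
    greenFunction_of_ge hσ hb hκ hx.1 hx.2 le_rfl, resolventSolution,
    ← intervalIntegral.integral_add_adjacent_intervals hφp_left hφp_right]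
  ring

lemma norm_integral_greenFunction_mul_add_le (hσ : |σ| ≤ 1) (hb : 0 < b) (hκ : 0 < κ.re)
    (hq : IntegrableOn q (Ioo 0 b)) {η : ℝ → ℂ} {K : ℝ} (hη : ∀ y ∈ Icc 0 b, ‖η y‖ ≤ K) (x : ℝ) :
    ‖(∫ y in (0 : ℝ)..b, greenFunction σ b κ x y * (η y * q y)) +
      greenFunction σ b κ x b * (r * η b)‖ ≤
      greenBound σ * (potentialNorm b q + |r|) / κ.re * K := by
  have hG := norm_greenFunction_le (b := b) hσ hb hκ x
  have hbound := greenBound_nonneg hσ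
  have hregular : ‖∫ y in (0 : ℝ)..b, greenFunction σ b κ x y * (η y * q y)‖ ≤
      greenBound σ / κ.re * K * potentialNorm b q := by
    rw [potentialNorm, ← intervalIntegral.integral_const_mul]
    refine intervalIntegral.norm_integral_le_of_norm_le hb.le (.of_forall fun y hy => ?_)
      (((intervalIntegrable_iff_integrableOn_Ioo_of_le hb.le).2 hq).abs.const_mul _)
    rw [norm_mul, norm_mul, Complex.norm_real, Real.norm_eq_abs, mul_assoc]
    gcongr
    exacts [hG y, hη y (Ioc_subset_Icc_self hy)]
  have hatom : ‖greenFunction σ b κ x b * (r * η b)‖ ≤ greenBound σ / κ.re * K * |r| := by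
    rw [norm_mul, norm_mul, Complex.norm_real, Real.norm_eq_abs, mul_assoc, mul_comm |r|]
    gcongr
    exacts [hG b, hη b ⟨hb.le, le_rfl⟩]
  calc _ ≤ _ := (norm_add_le _ _).trans (add_le_add hregular hatom)
    _ = _ := by ring

lemma eq_zero_of_homogeneous_integral_equation (hσ : |σ| ≤ 1) (hb : 0 < b)
    (hq : IntegrableOn q (Ioo 0 b)) (hκ : greenBound σ * (potentialNorm b q + |r|) < κ.re)
    (hκ0 : 0 < κ.re) {η : ℝ → ℂ} (hηc : ContinuousOn η (Icc 0 b))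
    (hη : ∀ x ∈ Icc 0 b, η x = -((∫ y in (0 : ℝ)..b, greenFunction σ b κ x y * (η y * q y)) +
      greenFunction σ b κ x b * (r * η b))) (hx : x ∈ Icc 0 b) : η x = 0 := by
  obtain ⟨x₀, hx₀, hmax⟩ := isCompact_Icc.exists_isMaxOn ⟨b, hb.le, le_rfl⟩ hηc.norm
  have hcontract :
      ‖η x₀‖ ≤ greenBound σ * (potentialNorm b q + |r|) / κ.re * ‖η x₀‖ := by
    conv_lhs => rw [hη x₀ hx₀, norm_neg]
    exact norm_integral_greenFunction_mul_add_le hσ hb hκ0 hq (fun y hy => hmax hy) x₀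
  have hlt : greenBound σ * (potentialNorm b q + |r|) / κ.re < 1 := (div_lt_one hκ0).2 hκ
  have hx₀_le : ‖η x₀‖ ≤ 0 := by
    by_contra! hpos
    nlinarith
  exact norm_le_zero_iff.1 ((hmax hx).trans hx₀_le)

end Green

lemma IsSchrodingerSolution.isPrimitiveOn {z : ℂ} {u du : ℝ → ℂ} (hb : 0 ≤ b)
    (hu : IsSchrodingerSolution b q z u du) : IsPrimitiveOn b u du :=
  ⟨hu.continuousOn_deriv.intervalIntegrable_of_Icc hb, hu.eq_integral⟩

lemma IsSchrodingerSolution.isPrimitiveOn_deriv {z : ℂ} {u du : ℝ → ℂ} (hb : 0 ≤ b)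
    (hq : IntegrableOn q (Ioo 0 b)) (hu : IsSchrodingerSolution b q z u du) :
    IsPrimitiveOn b du fun t => (q t - z) * u t := by
  refine ⟨?_, hu.deriv_eq_integral⟩
  have huq := (BoundedMeasurableOn.of_continuousOn hu.continuousOn).intervalIntegrable_mul hb hq
  refine (huq.sub ((hu.continuousOn.intervalIntegrable_of_Icc hb).const_mul z)).congr fun t _ => ?_
  ring

/-- The sign `σ` and the coupling `r` encode the boundary condition `h` at `b`: the image sign is
`1` with `r = 0` for the Dirichlet condition, and `-1` with `r = h` for finite `h`. -/
def EncodesBoundary (h : OnePoint ℝ) (σ r : ℝ) : Prop :=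
  (h = ∞ ∧ σ = 1 ∧ r = 0) ∨ (h = (r : OnePoint ℝ) ∧ σ = -1)

namespace EncodesBoundary

variable {h : OnePoint ℝ}

lemma abs_le_one (hh : EncodesBoundary h σ r) : |σ| ≤ 1 := by
  rcases hh with ⟨-, rfl, -⟩ | ⟨-, rfl⟩ <;> simp

lemma boundaryConditionAt_iff (hh : EncodesBoundary h σ r) (hb : 0 < b) (hκ : 0 < κ.re)
    {u du : ℝ → ℂ} : BoundaryConditionAt b h u du ↔
      (du b + r * u b) * freeWeyl σ b κ b = u b * freeWeylDeriv σ b κ b := by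
  have hwronskian := free_wronskian hh.abs_le_one hb hκ b
  rcases hh with ⟨rfl, rfl, rfl⟩ | ⟨rfl, rfl⟩
  · rw [freeWeyl_one_right, mul_zero, zero_sub, neg_eq_iff_eq_neg] at hwronskian
    have hne : freeWeylDeriv 1 b κ b ≠ 0 := fun h => by simp [h] at hwronskian
    simp [BoundaryConditionAt, freeWeyl_one_right, hne]
  · rw [freeWeylDeriv_neg_one_right, mul_zero, sub_zero] at hwronskian
    have hne : freeWeyl (-1) b κ b ≠ 0 := right_ne_zero_of_mul_eq_one hwronskian
    simp [BoundaryConditionAt, freeWeylDeriv_neg_one_right, hne]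

end EncodesBoundary

lemma IsWeylSolution.eq_resolventSolution {h : OnePoint ℝ} (hh : EncodesBoundary h σ r)
    (hb : 0 < b) (hq : IntegrableOn q (Ioo 0 b)) (hκ : 0 < κ.re) {u du : ℝ → ℂ}
    (hu : IsWeylSolution b q h (-κ ^ 2) u du) {x : ℝ} (hx : x ∈ Icc 0 b) :
    u x = resolventSolution σ b κ (fun y => u y * q y) (u 0) (freeWeyl σ b κ b * (r * u b)) x ∧
      du x = resolventSolutionDeriv σ b κ (fun y => u y * q y) (u 0)
        (freeWeyl σ b κ b * (r * u b)) x := by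
  have hσ := hh.abs_le_one
  have hp : IntervalIntegrable (fun y => u y * q y) volume 0 b :=
    (BoundedMeasurableOn.of_continuousOn hu.1.continuousOn).intervalIntegrable_mul hb.le hq
  have hboundary := (hh.boundaryConditionAt_iff hb hκ).1 hu.2.1
  have hresolvent := resolventSolution_boundary (p := fun y => u y * q y) (a := u 0) hσ hb hκ
    (r * u b)
  have hdiff := eq_zero_of_free_equation hσ hb hκ
    ((hu.1.isPrimitiveOn hb.le).sub
      (isPrimitiveOn_resolventSolution hb.le (ne_zero_of_re_pos hκ) hp))
    (((hu.1.isPrimitiveOn_deriv hb.le hq).sub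
      (isPrimitiveOn_resolventSolutionDeriv hσ hb hκ hp)).congr hb.le (fun _ _ => rfl)
        fun t _ => by ring)
    (sub_eq_zero.2 (resolventSolution_zero hσ hb hκ).symm)
    (by linear_combination hboundary - hresolvent) hx
  exact ⟨sub_eq_zero.1 hdiff.1, sub_eq_zero.1 hdiff.2⟩

/-- The Weyl solution `ψ`, normalized by `ψ(0) = 1`, as the Laplace transform of the summed Born
series. -/
noncomputable def weylSolution (σ b : ℝ) (ν : Measure ℝ) (s : ℝ → ℝ) (κ : ℂ) (x : ℝ) : ℂ :=
  freeWeyl σ b κ x + laplace κ (bornSum σ b ν s x)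

/-- The derivative of `weylSolution`, obtained by differentiating its integral equation. -/
noncomputable def weylSolutionDeriv (σ b r : ℝ) (q : ℝ → ℝ) (ν : Measure ℝ) (s : ℝ → ℝ) (κ : ℂ) :
    ℝ → ℂ :=
  resolventSolutionDeriv σ b κ (fun y => weylSolution σ b ν s κ y * q y) 1
    (freeWeyl σ b κ b * (r * weylSolution σ b ν s κ b))

variable [IsFiniteMeasure ν]

lemma boundedMeasurableOn_laplace_bornSum (hσ : |σ| ≤ 1) (hb : 0 < b) (hs : Measurable s)
    (hs1 : ∀ y, |s y| ≤ 1) (hκ : bornRate σ ν < κ.re) :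
    BoundedMeasurableOn b fun y => laplace κ (bornSum σ b ν s y) := by
  obtain ⟨β, hβ, hβκ⟩ := exists_between hκ
  obtain ⟨B, hB⟩ := exists_expBounded_bornSum hσ hb hs1 hβ
  exact ⟨(measurable_laplace (measurable_bornSum hσ hb hs hs1) κ).aestronglyMeasurable, _,
    fun y _ => (hB y).norm_laplace_le hβκ⟩

lemma boundedMeasurableOn_weylSolution (hσ : |σ| ≤ 1) (hb : 0 < b) (hs : Measurable s)
    (hs1 : ∀ y, |s y| ≤ 1) (hκ : bornRate σ ν < κ.re) :
    BoundedMeasurableOn b (weylSolution σ b ν s κ) :=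
  boundedMeasurableOn_freeWeyl.add (boundedMeasurableOn_laplace_bornSum hσ hb hs hs1 hκ)

lemma weylSolution_eq (hν : RepresentsPotential b q r ν s) (hσ : |σ| ≤ 1) (hb : 0 < b)
    (hq : IntegrableOn q (Ioo 0 b)) (hκ : bornRate σ ν < κ.re) (x : ℝ) :
    weylSolution σ b ν s κ x = freeWeyl σ b κ x -
      ((∫ y in (0 : ℝ)..b, greenFunction σ b κ x y * (weylSolution σ b ν s κ y * q y)) +
        greenFunction σ b κ x b * (r * weylSolution σ b ν s κ b)) := by
  have hG := boundedMeasurableOn_greenFunction hσ hb ((bornRate_nonneg hσ).trans_lt hκ) x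
  have hψ := boundedMeasurableOn_weylSolution hσ hb hν.measurable hν.abs_le_one hκ
  have hφ : BoundedMeasurableOn b (freeWeyl σ b κ) := boundedMeasurableOn_freeWeyl
  have hsplit := hν.integral_add hb.le hq (hφ.mul hG)
    ((boundedMeasurableOn_laplace_bornSum hσ hb hν.measurable hν.abs_le_one hκ).mul hG)
  have hint := hν.integral_eq _ (hG.mul hψ)
  calc weylSolution σ b ν s κ x
      = freeWeyl σ b κ x - ∫ y, greenFunction σ b κ x y * weylSolution σ b ν s κ y * s y ∂ν := by
        simp only [weylSolution, mul_comm (greenFunction σ b κ x _), add_mul (freeWeyl σ b κ _)]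
        rw [hsplit, laplace_bornSum_eq hσ hb hν.measurable hν.abs_le_one hκ]
        ring
    _ = _ := by
        rw [hint]
        simp only [mul_assoc, mul_left_comm (r : ℂ)]

lemma weylSolution_eq_resolventSolution (hν : RepresentsPotential b q r ν s) (hσ : |σ| ≤ 1)
    (hb : 0 < b) (hq : IntegrableOn q (Ioo 0 b)) (hκ : bornRate σ ν < κ.re) {x : ℝ}
    (hx : x ∈ Icc 0 b) :
    weylSolution σ b ν s κ x = resolventSolution σ b κ (fun y => weylSolution σ b ν s κ y * q y) 1
      (freeWeyl σ b κ b * (r * weylSolution σ b ν s κ b)) x := by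
  have hψ := boundedMeasurableOn_weylSolution hσ hb hν.measurable hν.abs_le_one hκ
  rw [resolventSolution_eq_greenFunction hσ hb ((bornRate_nonneg hσ).trans_lt hκ)
    (hψ.intervalIntegrable_mul hb.le hq) _ _ hx, one_mul]
  exact weylSolution_eq hν hσ hb hq hκ x

lemma isSchrodingerSolution_weylSolution (hν : RepresentsPotential b q r ν s) (hσ : |σ| ≤ 1)
    (hb : 0 < b) (hq : IntegrableOn q (Ioo 0 b)) (hκ : bornRate σ ν < κ.re) :
    IsSchrodingerSolution b q (-κ ^ 2) (weylSolution σ b ν s κ)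
      (weylSolutionDeriv σ b r q ν s κ) := by
  have hκ0 := (bornRate_nonneg hσ).trans_lt hκ
  have hp := (boundedMeasurableOn_weylSolution hσ hb hν.measurable hν.abs_le_one
    hκ).intervalIntegrable_mul hb.le hq
  have heq : EqOn (weylSolution σ b ν s κ) _ (Icc 0 b) :=
    fun x hx => weylSolution_eq_resolventSolution hν hσ hb hq hκ hx
  have hψ : IsPrimitiveOn b (weylSolution σ b ν s κ) (weylSolutionDeriv σ b r q ν s κ) :=
    (isPrimitiveOn_resolventSolution hb.le (ne_zero_of_re_pos hκ0) hp).congr hb.le heq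
      fun _ _ => rfl
  have hdψ : IsPrimitiveOn b (weylSolutionDeriv σ b r q ν s κ)
      fun t => (q t - -κ ^ 2) * weylSolution σ b ν s κ t :=
    (isPrimitiveOn_resolventSolutionDeriv hσ hb hκ0 hp).congr hb.le (fun _ _ => rfl)
      fun t ht => by rw [← heq ht]; ring
  exact ⟨hψ.continuousOn, hdψ.continuousOn, hψ.eq_add_integral, hdψ.eq_add_integral⟩

lemma isWeylSolution_weylSolution {h : OnePoint ℝ} (hh : EncodesBoundary h σ r)
    (hν : RepresentsPotential b q r ν s) (hb : 0 < b) (hq : IntegrableOn q (Ioo 0 b))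
    (hκ : bornRate σ ν < κ.re) :
    IsWeylSolution b q h (-κ ^ 2) (weylSolution σ b ν s κ)
      (weylSolutionDeriv σ b r q ν s κ) := by
  have hσ := hh.abs_le_one
  have hκ0 := (bornRate_nonneg hσ).trans_lt hκ
  have hboundary := resolventSolution_boundary (a := 1)
    (p := fun y => weylSolution σ b ν s κ y * q y) hσ hb hκ0 (r * weylSolution σ b ν s κ b)
  rw [← weylSolution_eq_resolventSolution hν hσ hb hq hκ ⟨hb.le, le_rfl⟩] at hboundary
  refine ⟨isSchrodingerSolution_weylSolution hν hσ hb hq hκ,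
    (hh.boundaryConditionAt_iff hb hκ0).2 hboundary, 0, ⟨le_rfl, hb.le⟩, ?_⟩
  rw [weylSolution_eq_resolventSolution hν hσ hb hq hκ ⟨le_rfl, hb.le⟩,
    resolventSolution_zero hσ hb hκ0]
  exact one_ne_zero

lemma IsWeylSolution.eq_const_mul_weylSolution {h : OnePoint ℝ} (hh : EncodesBoundary h σ r)
    (hν : RepresentsPotential b q r ν s) (hb : 0 < b) (hq : IntegrableOn q (Ioo 0 b))
    (hκ : bornRate σ ν < κ.re) {u du : ℝ → ℂ} (hu : IsWeylSolution b q h (-κ ^ 2) u du) {x : ℝ}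
    (hx : x ∈ Icc 0 b) : u x = u 0 * weylSolution σ b ν s κ x := by
  have hσ := hh.abs_le_one
  have hκ0 := (bornRate_nonneg hσ).trans_lt hκ
  have hψc := (isSchrodingerSolution_weylSolution hν hσ hb hq hκ).continuousOn
  have huc := hu.1.continuousOn
  refine sub_eq_zero.1 (eq_zero_of_homogeneous_integral_equation (r := r)
    (η := fun x => u x - u 0 * weylSolution σ b ν s κ x) hσ hb hq
    (by rwa [← hν.measureReal_univ]) hκ0 (huc.sub (hψc.const_mul _)) (fun y hy => ?_) hx)
  have hG := boundedMeasurableOn_greenFunction hσ hb hκ0 y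
  have huG := (hG.mul (.of_continuousOn huc)).intervalIntegrable_mul hb.le hq
  have hψG := (hG.mul (.of_continuousOn hψc)).intervalIntegrable_mul hb.le hq
  have hu_eq := (hu.eq_resolventSolution hh hb hq hκ0 hy).1
  rw [resolventSolution_eq_greenFunction hσ hb hκ0
    ((BoundedMeasurableOn.of_continuousOn huc).intervalIntegrable_mul hb.le hq) _ _ hy] at hu_eq
  have hψ_eq := weylSolution_eq hν hσ hb hq hκ y
  have hsub : ∫ t in (0 : ℝ)..b,
      greenFunction σ b κ y t * ((u t - u 0 * weylSolution σ b ν s κ t) * q t) =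
        (∫ t in (0 : ℝ)..b, greenFunction σ b κ y t * (u t * q t)) -
          u 0 * ∫ t in (0 : ℝ)..b, greenFunction σ b κ y t * (weylSolution σ b ν s κ t * q t) := by
    simp only [← mul_assoc]
    rw [← intervalIntegral.integral_const_mul,
      ← intervalIntegral.integral_sub huG (hψG.const_mul _)]
    refine intervalIntegral.integral_congr fun t _ => ?_
    ring
  rw [hsub]
  linear_combination hu_eq - u 0 * hψ_eq

lemma weylSolutionDeriv_zero (hν : RepresentsPotential b q r ν s) (hσ : |σ| ≤ 1) (hb : 0 < b)
    (hq : IntegrableOn q (Ioo 0 b)) (hκ : bornRate σ ν < κ.re) :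
    weylSolutionDeriv σ b r q ν s κ 0 = freeWeylDeriv σ b κ 0 -
      ((∫ t in (0 : ℝ)..b, freeWeyl σ b κ t ^ 2 * q t) + r * freeWeyl σ b κ b ^ 2) -
      laplace κ (bornRemainder σ b ν s) := by
  have hφ : BoundedMeasurableOn b (freeWeyl σ b κ) := boundedMeasurableOn_freeWeyl
  have hψ := boundedMeasurableOn_weylSolution hσ hb hν.measurable hν.abs_le_one hκ
  have hsplit := hν.integral_add hb.le hq (hφ.mul hφ)
    (hφ.mul (boundedMeasurableOn_laplace_bornSum hσ hb hν.measurable hν.abs_le_one hκ))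
  simp only [← mul_add] at hsplit
  rw [← laplace_bornRemainder hσ hb hν.measurable hν.abs_le_one hκ,
    hν.integral_eq _ (hφ.mul hφ)] at hsplit
  have hfirst := hν.integral_eq _ (hφ.mul hψ)
  simp only [weylSolutionDeriv, resolventSolutionDeriv_zero, sq]
  simp only [weylSolution, mul_assoc] at hfirst hsplit ⊢
  linear_combination -hsplit + hfirst

lemma hasWeylMValue_of_representsPotential {h : OnePoint ℝ} (hh : EncodesBoundary h σ r)
    (hν : RepresentsPotential b q r ν s) (hb : 0 < b) (hq : IntegrableOn q (Ioo 0 b))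
    (hκ : bornRate σ ν < κ.re) :
    HasWeylMValue b q h (-κ ^ 2) (freeWeylDeriv σ b κ 0 -
      ((∫ t in (0 : ℝ)..b, freeWeyl σ b κ t ^ 2 * q t) + r * freeWeyl σ b κ b ^ 2) -
      laplace κ (bornRemainder σ b ν s)) := by
  have hκ0 := (bornRate_nonneg hh.abs_le_one).trans_lt hκ
  refine ⟨⟨_, _, isWeylSolution_weylSolution hh hν hb hq hκ⟩, fun u du hu => ?_⟩
  have hmul := fun x hx => hu.eq_const_mul_weylSolution hh hν hb hq hκ (x := x) hx
  have hu0 : u 0 ≠ 0 := fun h0 => by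
    obtain ⟨x, hx, hne⟩ := hu.2.2
    exact hne (by rw [hmul x hx, h0, zero_mul])
  have hintegral : ∫ t in (0 : ℝ)..b, freeWeyl σ b κ t * (u t * q t) =
      u 0 * ∫ t in (0 : ℝ)..b, freeWeyl σ b κ t * (weylSolution σ b ν s κ t * q t) := by
    rw [← intervalIntegral.integral_const_mul]
    refine intervalIntegral.integral_congr fun t ht => ?_
    rw [uIcc_of_le hb.le] at ht
    simp only [hmul t ht]
    ring
  refine ⟨hu0, ?_⟩
  rw [← weylSolutionDeriv_zero hν hh.abs_le_one hb hq hκ, weylSolutionDeriv, div_eq_iff hu0,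
    (hu.eq_resolventSolution hh hb hq hκ0 ⟨le_rfl, hb.le⟩).2, resolventSolutionDeriv_zero,
    resolventSolutionDeriv_zero, hintegral, hmul b ⟨hb.le, le_rfl⟩]
  ring

end WeylSolution

/-! ### The first-order amplitude -/

section Cells

variable {E : Type*} [NormedAddCommGroup E] {b : ℝ} {f : ℝ → E}

lemma intervalIntegrable_comp_add_nat_mul {n : ℕ} :
    IntervalIntegrable (fun y => f (y + n * b)) volume 0 b ↔
      IntervalIntegrable f volume (n * b) ((n + 1 : ℕ) * b) := by
  rw [IntervalIntegrable.comp_add_right_iff, zero_add,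
    show b + n * b = (n + 1 : ℕ) * b by push_cast; ring]

variable [NormedSpace ℝ E]

lemma integral_comp_add_nat_mul (f : ℝ → E) (n : ℕ) :
    ∫ y in (0 : ℝ)..b, f (y + n * b) = ∫ α in n * b..(n + 1 : ℕ) * b, f α := by
  rw [intervalIntegral.integral_comp_add_right, zero_add,
    show b + n * b = (n + 1 : ℕ) * b by push_cast; ring]

lemma integral_comp_add_nat_mul_eq_setIntegral (hb : 0 < b) (f : ℝ → E) (n : ℕ) :
    ∫ y in (0 : ℝ)..b, f (y + n * b) = ∫ α in Ico (n * b) ((n + 1 : ℕ) * b), f α := by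
  rw [integral_comp_add_nat_mul, intervalIntegral.integral_of_le (by gcongr; simp),
    integral_Ico_eq_integral_Ioc]

lemma sum_integral_comp_add_nat_mul
    (hf : ∀ n : ℕ, IntervalIntegrable (fun y => f (y + n * b)) volume 0 b) (N : ℕ) :
    IntervalIntegrable f volume 0 (N * b) ∧
      ∑ n ∈ Finset.range N, ∫ y in (0 : ℝ)..b, f (y + n * b) = ∫ α in (0 : ℝ)..N * b, f α := by
  have hcell (n : ℕ) : IntervalIntegrable f volume (n * b) ((n + 1 : ℕ) * b) :=
    intervalIntegrable_comp_add_nat_mul.1 (hf n)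
  constructor
  · simpa using IntervalIntegrable.trans_iterate (a := fun n : ℕ => (n : ℝ) * b) (n := N)
      fun k _ => hcell k
  · simpa only [integral_comp_add_nat_mul, Nat.cast_zero, zero_mul] using
      intervalIntegral.sum_integral_adjacent_intervals (a := fun n : ℕ => (n : ℝ) * b) (n := N)
        fun k _ => hcell k

lemma hasSum_integral_comp_add_nat_mul (hb : 0 < b)
    (hf : ∀ n : ℕ, IntervalIntegrable (fun y => f (y + n * b)) volume 0 b)
    (hsum : Summable fun n : ℕ => ∫ y in (0 : ℝ)..b, ‖f (y + n * b)‖) :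
    IntegrableOn f (Ioi 0) ∧
      HasSum (fun n : ℕ => ∫ y in (0 : ℝ)..b, f (y + n * b)) (∫ α in Ioi (0 : ℝ), f α) := by
  have hmono : Monotone fun n : ℕ => (n : ℝ) * b := fun m n hmn => by dsimp only; gcongr
  have hunion : ⋃ n : ℕ, Ico ((n : ℝ) * b) ((n + 1 : ℕ) * b) = Ici 0 := by
    simpa using iUnion_Ico_map_succ_eq_Ici (f := fun n : ℕ => (n : ℝ) * b)
      (fun n => hmono bot_le) (not_bddAbove_iff.2 fun x => by
        obtain ⟨n, hn⟩ := exists_nat_gt (x / b)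
        exact ⟨n * b, mem_range_self n, (div_lt_iff₀ hb).1 hn⟩)
  have hint : IntegrableOn f (⋃ n : ℕ, Ico ((n : ℝ) * b) ((n + 1 : ℕ) * b)) :=
    integrableOn_iUnion_of_summable_integral_norm
      (fun n => (intervalIntegrable_iff_integrableOn_Ico_of_le (hmono n.le_succ)).1
        (intervalIntegrable_comp_add_nat_mul.1 (hf n)))
      (hsum.congr fun n => integral_comp_add_nat_mul_eq_setIntegral hb (fun α => ‖f α‖) n)
  have hsum_cells := hasSum_integral_iUnion (fun _ => measurableSet_Ico)
    hmono.pairwise_disjoint_on_Ico_succ hint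
  rw [hunion] at hint
  refine ⟨hint.mono_set Ioi_subset_Ici_self, ?_⟩
  rw [← integral_Ici_eq_integral_Ioi, ← hunion]
  exact hsum_cells.congr_fun fun n => integral_comp_add_nat_mul_eq_setIntegral hb f n

end Cells

/-- The contribution of first order in `q` to the amplitude `A`, interpolating between
`firstOrderDirichlet` at `σ = 1` and `firstOrderNeumann` at `σ = -1`. -/
noncomputable def firstOrder (σ b : ℝ) (q : ℝ → ℝ) (α : ℝ) : ℝ :=
  σ ^ ⌊α / b⌋₊ * ((⌊α / b⌋₊ + 1) * q (α - ⌊α / b⌋₊ * b) +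
    σ * (⌊α / b⌋₊ * q ((⌊α / b⌋₊ + 1) * b - α)))

lemma firstOrder_one (b : ℝ) (q : ℝ → ℝ) : firstOrder 1 b q = firstOrderDirichlet b q := by
  ext α; simp [firstOrder, firstOrderDirichlet]

lemma firstOrder_neg_one (b : ℝ) (q : ℝ → ℝ) : firstOrder (-1) b q = firstOrderNeumann b q := by
  ext α; simp [firstOrder, firstOrderNeumann, sub_eq_add_neg]

/-- The restriction of `firstOrder` to the `n`-th cell `[nb, (n+1)b)`, translated to `[0, b)`. -/
def firstOrderCell (σ b : ℝ) (q : ℝ → ℝ) (n : ℕ) (y : ℝ) : ℝ :=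
  σ ^ n * ((n + 1) * q y + σ * (n * q (b - y)))

/-- The Laplace transform of `q` over `[0, b]`, with the kernel `e^{-2yκ}` of the amplitude. -/
noncomputable def potentialLaplace (b : ℝ) (q : ℝ → ℝ) (κ : ℂ) : ℂ :=
  ∫ y in (0 : ℝ)..b, q y * Complex.exp (-2 * y * κ)

section FirstOrder

variable {σ b : ℝ} {q : ℝ → ℝ} {κ : ℂ}

lemma firstOrder_add_nat_mul (hb : 0 < b) {y : ℝ} (hy : y ∈ Ico 0 b) (n : ℕ) :
    firstOrder σ b q (y + n * b) = firstOrderCell σ b q n y := by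
  have hfloor : ⌊(y + n * b) / b⌋₊ = n := by
    rw [add_div, mul_div_cancel_right₀ _ hb.ne', Nat.floor_add_natCast (div_nonneg hy.1 hb.le),
      Nat.floor_eq_zero.2 ((div_lt_one hb).2 hy.2), zero_add]
  rw [firstOrder, firstOrderCell, hfloor, add_sub_cancel_right,
    show (n + 1 : ℝ) * b - (y + n * b) = b - y by ring]

lemma firstOrder_of_lt (hb : 0 < b) {α : ℝ} (hα : 0 < α) (hαb : α < b) :
    firstOrder σ b q α = q α := by
  simpa [firstOrderCell] using firstOrder_add_nat_mul (σ := σ) (q := q) hb ⟨hα.le, hαb⟩ 0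

lemma intervalIntegrable_reflect (hq : IntervalIntegrable q volume 0 b) :
    IntervalIntegrable (fun y => q (b - y)) volume 0 b := by
  simpa using (hq.comp_sub_left b).symm

lemma intervalIntegrable_firstOrderCell (hq : IntervalIntegrable q volume 0 b) (n : ℕ) :
    IntervalIntegrable (firstOrderCell σ b q n) volume 0 b :=
  ((hq.const_mul _).add (((intervalIntegrable_reflect hq).const_mul _).const_mul _)).const_mul _

lemma intervalIntegrable_firstOrder_add_nat_mul (hb : 0 < b)
    (hq : IntervalIntegrable q volume 0 b) (n : ℕ) :
    IntervalIntegrable (fun y => firstOrder σ b q (y + n * b)) volume 0 b :=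
  (intervalIntegrable_firstOrderCell hq n).congr_uIoo fun y hy => by
    rw [uIoo_of_le hb.le] at hy
    exact (firstOrder_add_nat_mul hb (Ioo_subset_Ico_self hy) n).symm

lemma potentialNorm_nonneg (hb : 0 < b) (q : ℝ → ℝ) : 0 ≤ potentialNorm b q :=
  intervalIntegral.integral_nonneg hb.le fun _ _ => abs_nonneg _

lemma integral_abs_firstOrderCell_le (hσ : |σ| ≤ 1) (hb : 0 < b)
    (hq : IntervalIntegrable q volume 0 b) (n : ℕ) :
    ∫ y in (0 : ℝ)..b, |firstOrderCell σ b q n y| ≤ (2 * n + 1) * potentialNorm b q := by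
  have hq' := intervalIntegrable_reflect hq
  have hreflect : ∫ y in (0 : ℝ)..b, |q (b - y)| = potentialNorm b q := by
    simp [intervalIntegral.integral_comp_sub_left (fun y => |q y|), potentialNorm]
  calc ∫ y in (0 : ℝ)..b, |firstOrderCell σ b q n y|
      ≤ ∫ y in (0 : ℝ)..b, ((n + 1 : ℝ) * |q y| + n * |q (b - y)|) := by
        refine intervalIntegral.integral_mono_on hb.le (intervalIntegrable_firstOrderCell hq n).abs
          ((hq.abs.const_mul _).add (hq'.abs.const_mul _)) fun y _ => ?_
        calc |firstOrderCell σ b q n y|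
            ≤ 1 * (|(n + 1 : ℝ) * q y| + |σ * (n * q (b - y))|) := by
              rw [firstOrderCell, abs_mul, abs_pow]
              gcongr
              · exact pow_le_one₀ (abs_nonneg σ) hσ
              · exact abs_add_le _ _
          _ ≤ (n + 1 : ℝ) * |q y| + 1 * (n * |q (b - y)|) := by
              rw [one_mul, abs_mul, abs_of_nonneg (by positivity : (0 : ℝ) ≤ n + 1), abs_mul σ,
                abs_mul, Nat.abs_cast]
              gcongr
          _ = _ := by rw [one_mul]
    _ = (2 * n + 1) * potentialNorm b q := by
        rw [intervalIntegral.integral_add (hq.abs.const_mul _) (hq'.abs.const_mul _),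
          intervalIntegral.integral_const_mul, intervalIntegral.integral_const_mul, hreflect,
          ← potentialNorm]
        ring

lemma integral_abs_firstOrder_nat_mul_le (hσ : |σ| ≤ 1) (hb : 0 < b)
    (hq : IntervalIntegrable q volume 0 b) (N : ℕ) :
    ∫ α in (0 : ℝ)..N * b, |firstOrder σ b q α| ≤ N ^ 2 * potentialNorm b q := by
  have hodd : ∑ k ∈ Finset.range N, (2 * k + 1 : ℝ) = N ^ 2 := by
    induction N with
    | zero => simp
    | succ N ih => rw [Finset.sum_range_succ, ih]; push_cast; ring
  rw [← (sum_integral_comp_add_nat_mul (f := fun α => |firstOrder σ b q α|)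
    (fun n => (intervalIntegrable_firstOrder_add_nat_mul hb hq n).abs) N).2, ← hodd,
    Finset.sum_mul]
  refine Finset.sum_le_sum fun n _ => ?_
  rw [intervalIntegral.integral_congr_Ioo_of_le hb.le fun y hy =>
    congrArg abs (firstOrder_add_nat_mul hb (Ioo_subset_Ico_self hy) n)]
  exact integral_abs_firstOrderCell_le hσ hb hq n

lemma intervalIntegrable_firstOrder (hb : 0 < b) (hq : IntervalIntegrable q volume 0 b) {a : ℝ}
    (ha : 0 < a) : IntervalIntegrable (firstOrder σ b q) volume 0 a :=
  intervalIntegrable_zero_of_mem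
    (sum_integral_comp_add_nat_mul (intervalIntegrable_firstOrder_add_nat_mul hb hq) ⌈a / b⌉₊).1
    ⟨ha.le, (div_le_iff₀ hb).1 (Nat.le_ceil _)⟩

lemma integral_abs_firstOrder_le (hσ : |σ| ≤ 1) (hb : 0 < b)
    (hq : IntervalIntegrable q volume 0 b) {a : ℝ} (ha : 0 < a) :
    ∫ α in (0 : ℝ)..a, |firstOrder σ b q α| ≤ (a / b + 1) ^ 2 * potentialNorm b q := by
  have hceil : a ≤ ⌈a / b⌉₊ * b := (div_le_iff₀ hb).1 (Nat.le_ceil _)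
  have hnorm := potentialNorm_nonneg hb q
  calc ∫ α in (0 : ℝ)..a, |firstOrder σ b q α|
      ≤ ∫ α in (0 : ℝ)..⌈a / b⌉₊ * b, |firstOrder σ b q α| :=
        intervalIntegral.integral_mono_interval le_rfl ha.le hceil
          (.of_forall fun _ => abs_nonneg _)
          (intervalIntegrable_firstOrder hb hq (ha.trans_le hceil)).abs
    _ ≤ ⌈a / b⌉₊ ^ 2 * potentialNorm b q := integral_abs_firstOrder_nat_mul_le hσ hb hq _
    _ ≤ (a / b + 1) ^ 2 * potentialNorm b q := by
        gcongr
        exact (Nat.ceil_lt_add_one (by positivity)).le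

lemma hasSum_succ_mul_geometric {x : ℂ} (hx : ‖x‖ < 1) :
    HasSum (fun n : ℕ => ((n : ℂ) + 1) * x ^ n) (1 / (1 - x) ^ 2) := by
  simpa using hasSum_choose_mul_geometric_of_norm_lt_one' 1 hx

lemma intervalIntegrable_ofReal (hq : IntervalIntegrable q volume 0 b) :
    IntervalIntegrable (fun y => (q y : ℂ)) volume 0 b :=
  ⟨hq.1.ofReal, hq.2.ofReal⟩

lemma intervalIntegrable_mul_exp (hq : IntervalIntegrable q volume 0 b) (κ : ℂ) :
    IntervalIntegrable (fun y => (q y : ℂ) * Complex.exp (-2 * y * κ)) volume 0 b :=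
  (intervalIntegrable_ofReal hq).mul_continuousOn (by fun_prop)

lemma potentialLaplace_firstOrderCell (hq : IntervalIntegrable q volume 0 b) (κ : ℂ) (n : ℕ) :
    potentialLaplace b (firstOrderCell σ b q n) κ =
      σ ^ n * ((n + 1) * potentialLaplace b q κ +
        σ * (n * potentialLaplace b (fun y => q (b - y)) κ)) := by
  have hq₁ := intervalIntegrable_mul_exp hq κ
  have hq₂ := intervalIntegrable_mul_exp (intervalIntegrable_reflect hq) κ
  simp only [potentialLaplace, ← intervalIntegral.integral_const_mul]
  rw [← intervalIntegral.integral_add (hq₁.const_mul _) ((hq₂.const_mul _).const_mul _),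
    ← intervalIntegral.integral_const_mul]
  congr 1 with y
  push_cast [firstOrderCell]
  ring

lemma firstOrder_mul_exp_add_nat_mul (hb : 0 < b) {y : ℝ} (hy : y ∈ Ico 0 b) (n : ℕ) :
    (firstOrder σ b q (y + n * b) : ℂ) * Complex.exp (-2 * (y + n * b : ℝ) * κ) =
      Complex.exp (-2 * κ * b) ^ n * (firstOrderCell σ b q n y * Complex.exp (-2 * y * κ)) := by
  rw [firstOrder_add_nat_mul hb hy, mul_left_comm, ← Complex.exp_nat_mul, ← Complex.exp_add]
  congr 2
  push_cast
  ring

lemma integral_norm_firstOrderCell_mul_exp_le (hσ : |σ| ≤ 1) (hb : 0 < b)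
    (hq : IntervalIntegrable q volume 0 b) (hκ : 0 < κ.re) (n : ℕ) :
    ∫ y in (0 : ℝ)..b, ‖(firstOrderCell σ b q n y : ℂ) * Complex.exp (-2 * y * κ)‖ ≤
      (2 * n + 1) * potentialNorm b q := by
  have hcell := intervalIntegrable_firstOrderCell (σ := σ) hq n
  refine le_trans (intervalIntegral.integral_mono_on hb.le (intervalIntegrable_mul_exp hcell κ).norm
    hcell.abs fun y hy => ?_) (integral_abs_firstOrderCell_le hσ hb hq n)
  rw [norm_mul, Complex.norm_real, Real.norm_eq_abs]
  refine mul_le_of_le_one_right (abs_nonneg _) ?_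
  rw [Complex.norm_exp, Real.exp_le_one_iff]
  simpa using mul_nonneg (mul_nonneg zero_le_two hy.1) hκ.le

lemma hasSum_integral_firstOrder_mul_exp (hσ : |σ| ≤ 1) (hb : 0 < b)
    (hq : IntervalIntegrable q volume 0 b) (hκ : 0 < κ.re) :
    IntegrableOn (fun α : ℝ => (firstOrder σ b q α : ℂ) * Complex.exp (-2 * α * κ)) (Ioi 0) ∧
      HasSum (fun n : ℕ => Complex.exp (-2 * κ * b) ^ n *
        potentialLaplace b (firstOrderCell σ b q n) κ)
        (∫ α in Ioi (0 : ℝ), (firstOrder σ b q α : ℂ) * Complex.exp (-2 * α * κ)) := by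
  set x := Complex.exp (-2 * κ * b)
  have hcongr (n : ℕ) : EqOn
      (fun y => (firstOrder σ b q (y + n * b) : ℂ) * Complex.exp (-2 * (y + n * b : ℝ) * κ))
      (fun y => x ^ n * (firstOrderCell σ b q n y * Complex.exp (-2 * y * κ))) (Ioo 0 b) :=
    fun y hy => firstOrder_mul_exp_add_nat_mul hb (Ioo_subset_Ico_self hy) n
  have hcell (n : ℕ) :=
    (intervalIntegrable_mul_exp (intervalIntegrable_firstOrderCell (σ := σ) hq n) κ).const_mul
      (x ^ n)
  have hmajorant : Summable fun n : ℕ => ‖x‖ ^ n * ((2 * n + 1) * potentialNorm b q) := by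
    have hx1 : ‖‖x‖‖ < 1 := by rw [norm_norm]; exact norm_exp_neg_lt_one hb hκ
    refine (((hasSum_coe_mul_geometric_of_norm_lt_one hx1).summable.mul_left
      (2 * potentialNorm b q)).add ((hasSum_geometric_of_norm_lt_one hx1).summable.mul_left
        (potentialNorm b q))).congr fun n => ?_
    ring
  have hsum := hasSum_integral_comp_add_nat_mul hb
    (f := fun α : ℝ => (firstOrder σ b q α : ℂ) * Complex.exp (-2 * α * κ))
    (fun n => (hcell n).congr_uIoo (by rw [uIoo_of_le hb.le]; exact (hcongr n).symm))
    (hmajorant.of_nonneg_of_le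
      (fun _ => intervalIntegral.integral_nonneg hb.le fun _ _ => norm_nonneg _) fun n => by
        rw [intervalIntegral.integral_congr_Ioo_of_le hb.le fun y hy =>
          congrArg norm (hcongr n hy)]
        simp only [norm_mul (x ^ n), norm_pow, intervalIntegral.integral_const_mul]
        gcongr
        exact integral_norm_firstOrderCell_mul_exp_le hσ hb hq hκ n)
  refine ⟨hsum.1, hsum.2.congr_fun fun n => ?_⟩
  rw [intervalIntegral.integral_congr_Ioo_of_le hb.le (hcongr n),
    intervalIntegral.integral_const_mul, potentialLaplace]

lemma integral_firstOrder_mul_exp (hσ : |σ| ≤ 1) (hb : 0 < b)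
    (hq : IntervalIntegrable q volume 0 b) (hκ : 0 < κ.re) :
    ∫ α in Ioi (0 : ℝ), (firstOrder σ b q α : ℂ) * Complex.exp (-2 * α * κ) =
      (potentialLaplace b q κ + σ ^ 2 * Complex.exp (-2 * κ * b) *
        potentialLaplace b (fun y => q (b - y)) κ) /
          (1 - σ * Complex.exp (-2 * κ * b)) ^ 2 := by
  have hx := norm_mul_exp_neg_lt_one hσ hb hκ
  set P := potentialLaplace b q κ
  set R := potentialLaplace b (fun y => q (b - y)) κ
  have hseries := ((hasSum_succ_mul_geometric hx).mul_right P).add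
    ((hasSum_coe_mul_geometric_of_norm_lt_one hx).mul_right (σ * R))
  refine ((hasSum_integral_firstOrder_mul_exp hσ hb hq hκ).2.unique
    (hseries.congr_fun fun n => ?_)).trans (by ring)
  rw [potentialLaplace_firstOrderCell hq]
  ring

lemma freeWeyl_sq (σ b : ℝ) (κ : ℂ) (t : ℝ) :
    freeWeyl σ b κ t ^ 2 = (Complex.exp (-2 * t * κ) + σ ^ 2 * Complex.exp (-2 * κ * b) *
      Complex.exp (-2 * (b - t : ℝ) * κ) - 2 * σ * Complex.exp (-2 * κ * b)) /
        (1 - σ * Complex.exp (-2 * κ * b)) ^ 2 := by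
  have hdirect : Complex.exp (-2 * t * κ) = Complex.exp (-κ * t) ^ 2 := by
    rw [← Complex.exp_nat_mul]; congr 1; push_cast; ring
  have hreflected : Complex.exp (-2 * κ * b) * Complex.exp (-2 * (b - t : ℝ) * κ) =
      Complex.exp (-κ * (2 * b - t)) ^ 2 := by
    rw [← Complex.exp_nat_mul, ← Complex.exp_add]; congr 1; push_cast; ring
  have hcross : Complex.exp (-2 * κ * b) =
      Complex.exp (-κ * t) * Complex.exp (-κ * (2 * b - t)) := by
    rw [← Complex.exp_add]; congr 1; ring
  rw [freeWeyl, div_pow, hdirect]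
  congr 1
  linear_combination -(σ : ℂ) ^ 2 * hreflected + 2 * σ * hcross

lemma integral_freeWeyl_sq_mul (hq : IntervalIntegrable q volume 0 b) :
    ∫ t in (0 : ℝ)..b, freeWeyl σ b κ t ^ 2 * q t =
      (potentialLaplace b q κ + σ ^ 2 * Complex.exp (-2 * κ * b) *
        potentialLaplace b (fun y => q (b - y)) κ -
        2 * σ * Complex.exp (-2 * κ * b) * (∫ y in (0 : ℝ)..b, q y : ℝ)) /
          (1 - σ * Complex.exp (-2 * κ * b)) ^ 2 := by
  set x := Complex.exp (-2 * κ * b)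
  have hreflect : potentialLaplace b (fun y => q (b - y)) κ =
      ∫ t in (0 : ℝ)..b, q t * Complex.exp (-2 * (b - t : ℝ) * κ) := by
    simpa [potentialLaplace] using intervalIntegral.integral_comp_sub_left
      (fun t : ℝ => (q t : ℂ) * Complex.exp (-2 * (b - t : ℝ) * κ)) (a := 0) (b := b) b
  have hqC := intervalIntegrable_ofReal hq
  have hdirect := intervalIntegrable_mul_exp hq κ
  have hreflected : IntervalIntegrable
      (fun t => (q t : ℂ) * Complex.exp (-2 * (b - t : ℝ) * κ)) volume 0 b :=
    hqC.mul_continuousOn (by fun_prop)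
  rw [hreflect, potentialLaplace, ← intervalIntegral.integral_ofReal,
    ← intervalIntegral.integral_const_mul, ← intervalIntegral.integral_const_mul,
    ← intervalIntegral.integral_add hdirect (hreflected.const_mul _),
    ← intervalIntegral.integral_sub (hdirect.add (hreflected.const_mul _)) (hqC.const_mul _),
    ← intervalIntegral.integral_div]
  congr 1 with t
  rw [freeWeyl_sq]
  ring

lemma exp_neg_mul_succ (κ : ℂ) (b : ℝ) (j : ℕ) :
    Complex.exp (-2 * κ * b * (j + 1)) = Complex.exp (-2 * κ * b) ^ (j + 1) := by
  rw [← Complex.exp_nat_mul]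
  push_cast
  ring_nf

lemma hasSum_coeffA (hσ : |σ| ≤ 1) (hb : 0 < b) (hκ : 0 < κ.re) :
    HasSum (fun j : ℕ => ((2 * σ ^ (j + 1) : ℝ) : ℂ) * κ * Complex.exp (-2 * κ * b * (j + 1)))
      (2 * κ * (σ * Complex.exp (-2 * κ * b)) / (1 - σ * Complex.exp (-2 * κ * b))) := by
  rw [div_eq_mul_inv]
  refine ((hasSum_geometric_of_norm_lt_one (norm_mul_exp_neg_lt_one hσ hb hκ)).mul_left
    (2 * κ * (σ * Complex.exp (-2 * κ * b)))).congr_fun fun j => ?_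
  push_cast [exp_neg_mul_succ]
  ring

lemma hasSum_coeffB (hσ : |σ| ≤ 1) (hb : 0 < b) (hκ : 0 < κ.re) (I : ℝ) :
    HasSum (fun j : ℕ => ((-2 * σ ^ (j + 1) * (j + 1 : ℕ) * I : ℝ) : ℂ) *
      Complex.exp (-2 * κ * b * (j + 1)))
      (-2 * I * (σ * Complex.exp (-2 * κ * b)) / (1 - σ * Complex.exp (-2 * κ * b)) ^ 2) := by
  rw [div_eq_mul_one_div]
  refine ((hasSum_succ_mul_geometric (norm_mul_exp_neg_lt_one hσ hb hκ)).mul_left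
    (-2 * I * (σ * Complex.exp (-2 * κ * b)))).congr_fun fun j => ?_
  push_cast [exp_neg_mul_succ]
  ring

end FirstOrder

/-! ### The amplitude of the `m`-function -/

/-- The amplitude `A` of the expansion of the `m`-function; the doubled argument turns the Laplace
kernel `e^{-κt}` of the Born series into `e^{-2ακ}`. -/
noncomputable def amplitude (σ b : ℝ) (q : ℝ → ℝ) (ν : Measure ℝ) (s : ℝ → ℝ) (α : ℝ) : ℝ :=
  firstOrder σ b q α + 2 * bornRemainder σ b ν s (2 * α)

/-- The constant in the bounds for `∫₀ᵃ |A|`, where `M` is the total variation of the potential. -/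
noncomputable def amplitudeConst (b M : ℝ) : ℝ := 6 * M * (b⁻¹ ^ 2 + 1)

section AmplitudeExpansion

variable {σ b r : ℝ} {κ : ℂ} {q s : ℝ → ℝ} {ν : Measure ℝ}

lemma EncodesBoundary.mul_freeWeyl_sq {h : OnePoint ℝ} (hh : EncodesBoundary h σ r) :
    r * freeWeyl σ b κ b ^ 2 = -4 * r * (σ * Complex.exp (-2 * κ * b)) /
      (1 - σ * Complex.exp (-2 * κ * b)) ^ 2 := by
  rcases hh with ⟨-, rfl, rfl⟩ | ⟨-, rfl⟩
  · simp
  · rw [freeWeyl_sq, show -2 * (b : ℂ) * κ = -2 * κ * b by ring]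
    simp only [sub_self, Complex.ofReal_neg, Complex.ofReal_one, Complex.ofReal_zero, mul_zero,
      zero_mul, Complex.exp_zero]
    ring

lemma freeWeylDeriv_zero (hσ : |σ| ≤ 1) (hb : 0 < b) (hκ : 0 < κ.re) :
    freeWeylDeriv σ b κ 0 = -κ - 2 * κ * (σ * Complex.exp (-2 * κ * b)) /
      (1 - σ * Complex.exp (-2 * κ * b)) := by
  have hreflected : Complex.exp (-κ * (2 * b - (0 : ℝ))) = Complex.exp (-2 * κ * b) := by
    congr 1; push_cast; ring
  rw [freeWeylDeriv, hreflected, eq_sub_iff_add_eq, ← add_div,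
    div_eq_iff (one_sub_mul_exp_ne_zero hσ hb hκ), Complex.ofReal_zero, mul_zero, Complex.exp_zero]
  ring

variable [IsFiniteMeasure ν]

lemma integral_bornRemainder_mul_exp (hσ : |σ| ≤ 1) (hb : 0 < b) (hs : Measurable s)
    (hs1 : ∀ y, |s y| ≤ 1) (hκ : bornRate σ ν < κ.re) :
    IntegrableOn (fun α : ℝ => ((2 * bornRemainder σ b ν s (2 * α) : ℝ) : ℂ) *
      Complex.exp (-2 * α * κ)) (Ioi 0) ∧
    ∫ α in Ioi (0 : ℝ), ((2 * bornRemainder σ b ν s (2 * α) : ℝ) : ℂ) *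
      Complex.exp (-2 * α * κ) = laplace κ (bornRemainder σ b ν s) := by
  obtain ⟨β, hβ, hβκ⟩ := exists_between hκ
  obtain ⟨B, hR⟩ := exists_expBounded_bornRemainder hσ hb hs1 hβ
  set g : ℝ → ℂ := fun t => (bornRemainder σ b ν s t : ℂ) * Complex.exp (-κ * t) with hg
  have hint : Integrable g := hR.integrable (measurable_bornRemainder hσ hb hs hs1) hβκ
  have hscale (α : ℝ) : ((2 * bornRemainder σ b ν s (2 * α) : ℝ) : ℂ) *
      Complex.exp (-2 * α * κ) = 2 * g (2 * α) := by
    rw [hg, show -2 * (α : ℂ) * κ = -κ * (2 * α : ℝ) by push_cast; ring]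
    push_cast
    ring
  simp only [hscale]
  refine ⟨((hint.comp_mul_left' two_ne_zero).const_mul 2).integrableOn, ?_⟩
  rw [integral_const_mul, integral_comp_mul_left_Ioi g 0 two_pos, mul_zero,
    setIntegral_eq_integral_of_forall_compl_eq_zero, Complex.real_smul, laplace]
  · push_cast
    ring
  · intro t ht
    simp [hg, bornRemainder_of_nonpos (not_lt.1 ht)]

lemma hasMExpansion_amplitude {h : OnePoint ℝ} (hh : EncodesBoundary h σ r)
    (hν : RepresentsPotential b q r ν s) (hb : 0 < b) (hq : IntegrableOn q (Ioo 0 b))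
    (hκ : greenBound σ * (potentialNorm b q + |r|) < κ.re) :
    HasMExpansion b q h (fun j => 2 * σ ^ j)
      (fun j => -2 * σ ^ j * j * (2 * r + ∫ x in (0 : ℝ)..b, q x))
      (amplitude σ b q ν s) κ := by
  have hσ := hh.abs_le_one
  rw [← hν.measureReal_univ] at hκ
  have hκ0 : 0 < κ.re := (bornRate_nonneg hσ).trans_lt hκ
  have hqi : IntervalIntegrable q volume 0 b :=
    (intervalIntegrable_iff_integrableOn_Ioo_of_le hb.le).2 hq
  have hA := hasSum_coeffA hσ hb hκ0
  have hB := hasSum_coeffB hσ hb hκ0 (2 * r + ∫ x in (0 : ℝ)..b, q x)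
  have hfirst := (hasSum_integral_firstOrder_mul_exp hσ hb hqi hκ0).1
  obtain ⟨hborn, hborn_eq⟩ :=
    integral_bornRemainder_mul_exp hσ hb hν.measurable hν.abs_le_one hκ
  have hsplit : (fun α : ℝ => (amplitude σ b q ν s α : ℂ) * Complex.exp (-2 * α * κ)) =
      fun α : ℝ => (firstOrder σ b q α : ℂ) * Complex.exp (-2 * α * κ) +
        ((2 * bornRemainder σ b ν s (2 * α) : ℝ) : ℂ) * Complex.exp (-2 * α * κ) := by
    ext α
    rw [amplitude, Complex.ofReal_add, add_mul]
  refine ⟨hA.summable, hB.summable, by rw [hsplit]; exact hfirst.add hborn, ?_⟩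
  convert hasWeylMValue_of_representsPotential hh hν hb hq hκ using 1
  rw [hA.tsum_eq, hB.tsum_eq, hsplit, integral_add hfirst hborn, hborn_eq,
    integral_firstOrder_mul_exp hσ hb hqi hκ0, integral_freeWeyl_sq_mul hqi, hh.mul_freeWeyl_sq,
    freeWeylDeriv_zero hσ hb hκ0]
  push_cast
  ring

end AmplitudeExpansion

section AmplitudeBounds

variable {σ b r α a : ℝ} {q s : ℝ → ℝ} {ν : Measure ℝ} [IsFiniteMeasure ν]

lemma abs_amplitude_sub_firstOrder_le (hν : RepresentsPotential b q r ν s)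
    (hσ : |σ| ≤ 1) (hb : 0 < b) (hα : 0 ≤ α) :
    |amplitude σ b q ν s α - firstOrder σ b q α| ≤
      greenBound σ * ((2 * α + b) * (2 * α + 2 * b) / b ^ 2) *
        (potentialNorm b q + |r|) ^ 2 *
        Real.exp (2 * greenBound σ * (potentialNorm b q + |r|) * α) := by
  rw [amplitude, add_sub_cancel_left, abs_mul, abs_two]
  refine (mul_le_mul_of_nonneg_left (abs_bornRemainder_le hσ hb hν.abs_le_one
    (mul_nonneg zero_le_two hα)) zero_le_two).trans_eq ?_
  rw [bornRate, hν.measureReal_univ, mul_left_comm _ 2, ← mul_assoc 2, ← mul_assoc 2]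
  field_simp

lemma abs_amplitude_sub_firstOrderDirichlet_le (hν : RepresentsPotential b q 0 ν s) (hb : 0 < b)
    (hα : 0 ≤ α) :
    |amplitude 1 b q ν s α - firstOrderDirichlet b q α| ≤
      (2 * α + b) * (2 * α + 2 * b) / (2 * b ^ 2) * potentialNorm b q ^ 2 *
        Real.exp (α * potentialNorm b q) := by
  rw [← firstOrder_one]
  refine (abs_amplitude_sub_firstOrder_le hν abs_one.le hb hα).trans_eq ?_
  rw [greenBound_one, abs_zero]
  ring_nf

lemma abs_amplitude_sub_firstOrderNeumann_le (hν : RepresentsPotential b q 0 ν s) (hb : 0 < b)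
    (hα : 0 ≤ α) :
    |amplitude (-1) b q ν s α - firstOrderNeumann b q α| ≤
      (2 * α + b) * (2 * α + 2 * b) / b ^ 2 * potentialNorm b q ^ 2 *
        Real.exp (2 * α * potentialNorm b q) := by
  rw [← firstOrder_neg_one]
  refine (abs_amplitude_sub_firstOrder_le hν (by simp) hb hα).trans_eq ?_
  rw [greenBound_neg_one, abs_zero]
  ring_nf

lemma abs_amplitude_sub_le_of_lt (hν : RepresentsPotential b q r ν s)
    (hb : 0 < b) (hα : 0 < α) (hαb : α < b) :
    |amplitude σ b q ν s α - q α| ≤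
      potentialNorm b q ^ 2 * Real.exp (α * potentialNorm b q) := by
  rw [amplitude, firstOrder_of_lt hb hα hαb, add_sub_cancel_left, abs_mul, abs_two]
  refine (mul_le_mul_of_nonneg_left (abs_bornRemainder_le_of_lt hν.abs_le_one (by linarith))
    zero_le_two).trans_eq ?_
  rw [hν.measureReal_Iio]
  ring_nf

lemma abs_amplitude_sub_firstOrder_le_of_mem (hν : RepresentsPotential b q r ν s)
    (hσ : |σ| ≤ 1) (hb : 0 < b) (hα : α ∈ Icc 0 a) :
    |amplitude σ b q ν s α - firstOrder σ b q α| ≤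
      2 * (a / b + 1) ^ 2 * (potentialNorm b q + |r|) *
        (2 * greenBound σ * (potentialNorm b q + |r|) *
          Real.exp (2 * greenBound σ * (potentialNorm b q + |r|) * α)) := by
  have hquadratic : (2 * α + b) * (2 * α + 2 * b) / b ^ 2 ≤ 4 * (a / b + 1) ^ 2 := by
    rw [show 4 * (a / b + 1) ^ 2 = (2 * a + 2 * b) * (2 * a + 2 * b) / b ^ 2 by field_simp; ring]
    obtain ⟨hα0, hαa⟩ := hα
    gcongr ?_ * ?_ / _ <;> linarith
  have hgreen := greenBound_nonneg hσ
  calc |amplitude σ b q ν s α - firstOrder σ b q α|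
      ≤ greenBound σ * ((2 * α + b) * (2 * α + 2 * b) / b ^ 2) * (potentialNorm b q + |r|) ^ 2 *
          Real.exp (2 * greenBound σ * (potentialNorm b q + |r|) * α) :=
        abs_amplitude_sub_firstOrder_le hν hσ hb hα.1
    _ ≤ greenBound σ * (4 * (a / b + 1) ^ 2) * (potentialNorm b q + |r|) ^ 2 *
          Real.exp (2 * greenBound σ * (potentialNorm b q + |r|) * α) := by gcongr
    _ = _ := by ring

lemma integral_mul_exp_le (c a : ℝ) :
    ∫ α in (0 : ℝ)..a, c * Real.exp (c * α) ≤ Real.exp (c * a) := by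
  rw [intervalIntegral.integral_eq_sub_of_hasDerivAt (f := fun α => Real.exp (c * α))
    (fun x _ => by simpa [mul_comm] using ((hasDerivAt_id x).const_mul c).exp)
    ((by fun_prop : Continuous fun α => c * Real.exp (c * α)).intervalIntegrable 0 a)]
  simp

lemma intervalIntegrable_amplitude_sub_firstOrder (hν : RepresentsPotential b q r ν s)
    (hσ : |σ| ≤ 1) (hb : 0 < b) (ha : 0 < a) :
    IntervalIntegrable (fun α => amplitude σ b q ν s α - firstOrder σ b q α) volume 0 a := by
  have hmeas : Measurable fun α => amplitude σ b q ν s α - firstOrder σ b q α := by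
    simp only [amplitude, add_sub_cancel_left]
    exact ((measurable_bornRemainder hσ hb hν.measurable hν.abs_le_one).comp
      (measurable_const_mul 2)).const_mul 2
  refine (Continuous.intervalIntegrable (by fun_prop) 0 a).mono_fun' hmeas.aestronglyMeasurable
    ((ae_restrict_mem measurableSet_uIoc).mono fun α hα =>
      abs_amplitude_sub_firstOrder_le_of_mem (a := a) hν hσ hb (Ioc_subset_Icc_self ?_))
  rwa [uIoc_of_le ha.le] at hα

lemma integral_abs_amplitude_sub_firstOrder_le (hν : RepresentsPotential b q r ν s)
    (hσ : |σ| ≤ 1) (hb : 0 < b) (ha : 0 < a) :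
    ∫ α in (0 : ℝ)..a, |amplitude σ b q ν s α - firstOrder σ b q α| ≤
      2 * (a / b + 1) ^ 2 * (potentialNorm b q + |r|) *
        Real.exp (2 * greenBound σ * (potentialNorm b q + |r|) * a) := by
  have hnorm := potentialNorm_nonneg hb q
  refine (intervalIntegral.integral_mono_on ha.le
    (intervalIntegrable_amplitude_sub_firstOrder hν hσ hb ha).abs
    (Continuous.intervalIntegrable (by fun_prop) 0 a)
    fun α hα => abs_amplitude_sub_firstOrder_le_of_mem hν hσ hb hα).trans ?_
  rw [intervalIntegral.integral_const_mul]
  gcongr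
  exact integral_mul_exp_le _ _

lemma intervalIntegrable_amplitude (hν : RepresentsPotential b q r ν s) (hσ : |σ| ≤ 1)
    (hb : 0 < b) (hq : IntegrableOn q (Ioo 0 b)) (ha : 0 < a) :
    IntervalIntegrable (amplitude σ b q ν s) volume 0 a := by
  simpa using (intervalIntegrable_amplitude_sub_firstOrder hν hσ hb ha).add
    (intervalIntegrable_firstOrder (σ := σ) hb
      ((intervalIntegrable_iff_integrableOn_Ioo_of_le hb.le).2 hq) ha)

lemma integrableOn_amplitude (hν : RepresentsPotential b q r ν s) (hσ : |σ| ≤ 1)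
    (hb : 0 < b) (hq : IntegrableOn q (Ioo 0 b)) (ha : 0 < a) :
    IntegrableOn (amplitude σ b q ν s) (Ioo 0 a) :=
  (intervalIntegrable_iff_integrableOn_Ioo_of_le ha.le).1
    (intervalIntegrable_amplitude hν hσ hb hq ha)

lemma div_add_one_sq_le (a b : ℝ) : (a / b + 1) ^ 2 ≤ 2 * (b⁻¹ ^ 2 + 1) * (1 + a ^ 2) := by
  rw [div_eq_mul_inv]
  nlinarith [sq_nonneg (a * b⁻¹ - 1), sq_nonneg a, sq_nonneg b⁻¹]

lemma integral_abs_amplitude_le (hν : RepresentsPotential b q r ν s) (hσ : |σ| ≤ 1)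
    (hb : 0 < b) (hq : IntegrableOn q (Ioo 0 b)) (ha : 0 < a) :
    ∫ α in (0 : ℝ)..a, |amplitude σ b q ν s α| ≤
      amplitudeConst b (potentialNorm b q + |r|) * (1 + a ^ 2) *
        Real.exp (2 * greenBound σ * (potentialNorm b q + |r|) * a) := by
  have hqi : IntervalIntegrable q volume 0 b :=
    (intervalIntegrable_iff_integrableOn_Ioo_of_le hb.le).2 hq
  have hfirst := (intervalIntegrable_firstOrder (σ := σ) hb hqi ha).abs
  have hremainder := (intervalIntegrable_amplitude_sub_firstOrder hν hσ hb ha).abs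
  have hgreen := greenBound_nonneg hσ
  have hnorm := potentialNorm_nonneg hb q
  set M := potentialNorm b q + |r|
  have hnormM : potentialNorm b q ≤ M := le_add_of_nonneg_right (abs_nonneg r)
  have hM0 : 0 ≤ M := hnorm.trans hnormM
  set e := Real.exp (2 * greenBound σ * M * a)
  have he : 1 ≤ e := Real.one_le_exp (by positivity)
  calc ∫ α in (0 : ℝ)..a, |amplitude σ b q ν s α|
      ≤ ∫ α in (0 : ℝ)..a,
          (|amplitude σ b q ν s α - firstOrder σ b q α| + |firstOrder σ b q α|) :=
        intervalIntegral.integral_mono_on ha.le (intervalIntegrable_amplitude hν hσ hb hq ha).abs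
          (hremainder.add hfirst) fun α _ => by
            simpa using abs_add_le (amplitude σ b q ν s α - firstOrder σ b q α)
              (firstOrder σ b q α)
    _ ≤ 2 * (a / b + 1) ^ 2 * M * e + (a / b + 1) ^ 2 * potentialNorm b q := by
        rw [intervalIntegral.integral_add hremainder hfirst]
        exact add_le_add (integral_abs_amplitude_sub_firstOrder_le hν hσ hb ha)
          (integral_abs_firstOrder_le hσ hb hqi ha)
    _ ≤ 2 * (a / b + 1) ^ 2 * M * e + (a / b + 1) ^ 2 * (M * e) := by
        gcongr
        exact hnormM.trans (le_mul_of_one_le_right hM0 he)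
    _ = (a / b + 1) ^ 2 * (3 * M * e) := by ring
    _ ≤ 2 * (b⁻¹ ^ 2 + 1) * (1 + a ^ 2) * (3 * M * e) := by
        gcongr
        exact div_add_one_sq_le a b
    _ = _ := by rw [amplitudeConst]; ring

lemma integral_abs_amplitude_dirichlet_le (hν : RepresentsPotential b q 0 ν s) (hb : 0 < b)
    (hq : IntegrableOn q (Ioo 0 b)) (ha : 0 < a) :
    ∫ α in (0 : ℝ)..a, |amplitude 1 b q ν s α| ≤
      amplitudeConst b (potentialNorm b q) * (1 + a ^ 2) * Real.exp (a * potentialNorm b q) := by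
  refine (integral_abs_amplitude_le hν abs_one.le hb hq ha).trans_eq ?_
  rw [greenBound_one, abs_zero]
  ring_nf

lemma integral_abs_amplitude_neumann_le (hν : RepresentsPotential b q 0 ν s) (hb : 0 < b)
    (hq : IntegrableOn q (Ioo 0 b)) (ha : 0 < a) :
    ∫ α in (0 : ℝ)..a, |amplitude (-1) b q ν s α| ≤
      amplitudeConst b (potentialNorm b q) * (1 + a ^ 2) *
        Real.exp (2 * a * potentialNorm b q) := by
  refine (integral_abs_amplitude_le hν (by simp) hb hq ha).trans_eq ?_
  rw [greenBound_neg_one, abs_zero]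
  ring_nf

lemma amplitudeConst_nonneg (b : ℝ) {M : ℝ} (hM : 0 ≤ M) : 0 ≤ amplitudeConst b M := by
  unfold amplitudeConst; positivity

lemma integral_abs_amplitude_le_exp (hν : RepresentsPotential b q r ν s)
    (hσ : |σ| ≤ 1) (hb : 0 < b) (hq : IntegrableOn q (Ioo 0 b)) (ha : 0 < a) :
    ∫ α in (0 : ℝ)..a, |amplitude σ b q ν s α| ≤
      amplitudeConst b (potentialNorm b q + |r|) *
        Real.exp (2 * a * (potentialNorm b q + |r| + b⁻¹ + 1)) := by
  have hnorm := potentialNorm_nonneg hb q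
  have hconst := amplitudeConst_nonneg b (add_nonneg hnorm (abs_nonneg r))
  have hquadratic : 1 + a ^ 2 ≤ Real.exp (2 * a) := by
    nlinarith [Real.quadratic_le_exp_of_nonneg (x := 2 * a) (by positivity)]
  calc ∫ α in (0 : ℝ)..a, |amplitude σ b q ν s α|
      ≤ amplitudeConst b (potentialNorm b q + |r|) * (1 + a ^ 2) *
        Real.exp (2 * greenBound σ * (potentialNorm b q + |r|) * a) :=
        integral_abs_amplitude_le hν hσ hb hq ha
    _ ≤ amplitudeConst b (potentialNorm b q + |r|) * Real.exp (2 * a) *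
        Real.exp (2 * 1 * (potentialNorm b q + |r|) * a) := by
        gcongr
        exact greenBound_le_one hσ
    _ = amplitudeConst b (potentialNorm b q + |r|) *
        Real.exp (2 * a * (potentialNorm b q + |r| + 1)) := by
        rw [mul_assoc, ← Real.exp_add]
        ring_nf
    _ ≤ _ := by
        have := inv_pos.2 hb
        gcongr _ * Real.exp (_ * ?_)
        linarith

end AmplitudeBounds

section BoundaryCases

variable {b σ r : ℝ} {q s : ℝ → ℝ} {ν : Measure ℝ} {h : OnePoint ℝ}

lemma exists_encodesBoundary (h : OnePoint ℝ) : ∃ σ r, EncodesBoundary h σ r := by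
  induction h using OnePoint.rec with
  | infty => exact ⟨1, 0, Or.inl ⟨rfl, rfl, rfl⟩⟩
  | coe r => exact ⟨-1, r, Or.inr ⟨rfl, rfl⟩⟩

lemma EncodesBoundary.eq_of_infty (hh : EncodesBoundary ∞ σ r) : σ = 1 ∧ r = 0 :=
  hh.elim And.right fun hr => absurd hr.1 (OnePoint.infty_ne_coe r)

lemma EncodesBoundary.eq_of_coe {r' : ℝ} (hh : EncodesBoundary (r' : OnePoint ℝ) σ r) :
    σ = -1 ∧ r = r' :=
  hh.elim (fun hr => absurd hr.1 (OnePoint.coe_ne_infty r')) fun hr =>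
    ⟨hr.2, (OnePoint.coe_injective hr.1).symm⟩

variable [IsFiniteMeasure ν]

lemma hasMExpansion_amplitude_of_lt (hh : EncodesBoundary h σ r)
    (hν : RepresentsPotential b q r ν s) (hb : 0 < b) (hq : IntegrableOn q (Ioo 0 b)) {κ : ℂ}
    (hκ : 2 * (potentialNorm b q + |r| + b⁻¹ + 1) / 2 < κ.re) :
    HasMExpansion b q h (fun j => 2 * σ ^ j)
      (fun j => -2 * σ ^ j * j * (2 * r + ∫ x in (0 : ℝ)..b, q x)) (amplitude σ b q ν s) κ := by
  have hrate : greenBound σ * (potentialNorm b q + |r|) ≤ potentialNorm b q + |r| :=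
    mul_le_of_le_one_left (add_nonneg (potentialNorm_nonneg hb q) (abs_nonneg r))
      (greenBound_le_one hh.abs_le_one)
  exact hasMExpansion_amplitude hh hν hb hq (by linarith [inv_pos.2 hb])

lemma abs_two_mul_pow_le (hσ : |σ| ≤ 1) (n : ℕ) : |2 * σ ^ n| ≤ 2 := by
  rw [abs_mul, abs_pow, abs_two]
  exact mul_le_of_le_one_right zero_le_two (pow_le_one₀ (abs_nonneg σ) hσ)

lemma exists_bound_mExpansion (hh : EncodesBoundary h σ r) (hν : RepresentsPotential b q r ν s)
    (hb : 0 < b) (hq : IntegrableOn q (Ioo 0 b)) :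
    ∃ C K₀ : ℝ, (∀ n : ℕ, 1 ≤ n → |2 * σ ^ n| ≤ C) ∧
      (∀ n : ℕ, 1 ≤ n → |-2 * σ ^ n * n * (2 * r + ∫ x in (0 : ℝ)..b, q x)| ≤ C * n) ∧
      (∀ a : ℝ, 0 < a →
        ∫ α in (0 : ℝ)..a, |amplitude σ b q ν s α| ≤ C * Real.exp (K₀ * a)) ∧
      ∀ κ : ℂ, K₀ / 2 < κ.re → HasMExpansion b q h (fun j => 2 * σ ^ j)
        (fun j => -2 * σ ^ j * j * (2 * r + ∫ x in (0 : ℝ)..b, q x))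
        (amplitude σ b q ν s) κ := by
  have hσ := hh.abs_le_one
  have hnorm := potentialNorm_nonneg hb q
  set I := 2 * r + ∫ x in (0 : ℝ)..b, q x
  set M := amplitudeConst b (potentialNorm b q + |r|)
  have hI : 0 ≤ |I| := abs_nonneg I
  have hM : 0 ≤ M := amplitudeConst_nonneg b (add_nonneg hnorm (abs_nonneg r))
  refine ⟨2 + 2 * |I| + M, 2 * (potentialNorm b q + |r| + b⁻¹ + 1), fun n _ => ?_, fun n _ => ?_,
    fun a ha => ?_, fun κ hκ => hasMExpansion_amplitude_of_lt hh hν hb hq hκ⟩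
  · linarith [abs_two_mul_pow_le hσ n]
  · calc |-2 * σ ^ n * n * I| = |2 * σ ^ n| * |I| * n := by
          rw [neg_mul, neg_mul, neg_mul, abs_neg, abs_mul, abs_mul, Nat.abs_cast, mul_right_comm]
      _ ≤ 2 * |I| * n := by gcongr; exact abs_two_mul_pow_le hσ n
      _ ≤ (2 + 2 * |I| + M) * n := by gcongr; linarith
  · calc ∫ α in (0 : ℝ)..a, |amplitude σ b q ν s α|
        ≤ M * Real.exp (2 * a * (potentialNorm b q + |r| + b⁻¹ + 1)) :=
          integral_abs_amplitude_le_exp hν hσ hb hq ha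
      _ ≤ (2 + 2 * |I| + M) * Real.exp (2 * (potentialNorm b q + |r| + b⁻¹ + 1) * a) := by
          rw [mul_right_comm 2 a]
          gcongr
          linarith

end BoundaryCases

theorem theorem1p6 :
    ∃ (D₁ : ℝ) (CD CN : ℝ → ℝ → ℝ) (D₂ : ℝ → ℝ → ℝ → ℝ), 0 < D₁ ∧
      ∀ (b : ℝ) (q : ℝ → ℝ) (h : OnePoint ℝ), 0 < b → IntegrableOn q (Ioo 0 b) →
        ∃ (cA cB : ℕ → ℝ) (A : ℝ → ℝ),
          (∀ a : ℝ, 0 < a → IntegrableOn A (Ioo 0 a)) ∧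
          -- the general statement
          (∃ C K₀ : ℝ,
            (∀ n : ℕ, 1 ≤ n → |cA n| ≤ C) ∧
            (∀ n : ℕ, 1 ≤ n → |cB n| ≤ C * n) ∧
            (∀ a : ℝ, 0 < a → ∫ α in (0 : ℝ)..a, |A α| ≤ C * Real.exp (K₀ * a)) ∧
            (∀ κ : ℂ, K₀ / 2 < κ.re → HasMExpansion b q h cA cB A κ)) ∧
          -- Dirichlet condition at `b`
          (h = ∞ →
            (∀ κ : ℂ, potentialNorm b q / 2 < κ.re → HasMExpansion b q h cA cB A κ) ∧
            (∀ j : ℕ, 1 ≤ j → cA j = 2) ∧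
            (∀ j : ℕ, 1 ≤ j → cB j = -2 * j * ∫ x in (0 : ℝ)..b, q x) ∧
            (∀ α : ℝ, 0 < α → |A α - firstOrderDirichlet b q α| ≤
              (2 * α + b) * (2 * α + 2 * b) / (2 * b ^ 2) * potentialNorm b q ^ 2 *
                Real.exp (α * potentialNorm b q)) ∧
            (∀ a : ℝ, 0 < a → ∫ α in (0 : ℝ)..a, |A α| ≤
              CD b (potentialNorm b q) * (1 + a ^ 2) * Real.exp (a * potentialNorm b q))) ∧
          -- Neumann condition at `b`
          (h = ((0 : ℝ) : OnePoint ℝ) →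
            (∀ κ : ℂ, potentialNorm b q < κ.re → HasMExpansion b q h cA cB A κ) ∧
            (∀ j : ℕ, 1 ≤ j → cA j = 2 * (-1) ^ j) ∧
            (∀ j : ℕ, 1 ≤ j → cB j = 2 * (-1) ^ (j + 1) * j * ∫ x in (0 : ℝ)..b, q x) ∧
            (∀ α : ℝ, 0 < α → |A α - firstOrderNeumann b q α| ≤
              (2 * α + b) * (2 * α + 2 * b) / b ^ 2 * potentialNorm b q ^ 2 *
                Real.exp (2 * α * potentialNorm b q)) ∧
            (∀ a : ℝ, 0 < a → ∫ α in (0 : ℝ)..a, |A α| ≤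
              CN b (potentialNorm b q) * (1 + a ^ 2) * Real.exp (2 * a * potentialNorm b q))) ∧
          -- general finite `h = r`
          (∀ r : ℝ, h = (r : OnePoint ℝ) →
            (∀ κ : ℂ, D₁ * (potentialNorm b q + |r| + b⁻¹ + 1) / 2 < κ.re →
              HasMExpansion b q h cA cB A κ) ∧
            (∀ j : ℕ, 1 ≤ j → cA j = 2 * (-1) ^ j) ∧
            (∀ j : ℕ, 1 ≤ j →
              cB j = 2 * (-1) ^ (j + 1) * j * (2 * r + ∫ x in (0 : ℝ)..b, q x)) ∧
            (∀ α : ℝ, 0 < α → α < b → |A α - q α| ≤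
              potentialNorm b q ^ 2 * Real.exp (α * potentialNorm b q)) ∧
            (∀ a : ℝ, 0 < a → ∫ α in (0 : ℝ)..a, |A α| ≤
              D₂ b (potentialNorm b q) r *
                Real.exp (D₁ * a * (potentialNorm b q + |r| + b⁻¹ + 1)))) := by
  refine ⟨2, amplitudeConst, amplitudeConst, fun b n r => amplitudeConst b (n + |r|), two_pos,
    fun b q h hb hq => ?_⟩
  obtain ⟨σ, r, hh⟩ := exists_encodesBoundary h
  obtain ⟨ν, s, _, hν⟩ := exists_representsPotential hb hq r
  refine ⟨fun j => 2 * σ ^ j, fun j => -2 * σ ^ j * j * (2 * r + ∫ x in (0 : ℝ)..b, q x),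
    amplitude σ b q ν s, fun a ha => integrableOn_amplitude hν hh.abs_le_one hb hq ha,
    exists_bound_mExpansion hh hν hb hq, ?_, ?_, ?_⟩
  · rintro rfl
    obtain ⟨rfl, rfl⟩ := hh.eq_of_infty
    exact ⟨fun κ hκ => hasMExpansion_amplitude hh hν hb hq
        (by rw [greenBound_one, abs_zero]; linarith), by simp, by simp,
      fun α hα => abs_amplitude_sub_firstOrderDirichlet_le hν hb hα.le,
      fun a ha => integral_abs_amplitude_dirichlet_le hν hb hq ha⟩
  · rintro rfl
    obtain ⟨rfl, rfl⟩ := hh.eq_of_coe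
    exact ⟨fun κ hκ => hasMExpansion_amplitude hh hν hb hq (by simpa [greenBound_neg_one] using hκ),
      fun j _ => rfl, fun j _ => by ring,
      fun α hα => abs_amplitude_sub_firstOrderNeumann_le hν hb hα.le,
      fun a ha => integral_abs_amplitude_neumann_le hν hb hq ha⟩
  · rintro r' rfl
    obtain ⟨rfl, rfl⟩ := hh.eq_of_coe
    exact ⟨fun κ hκ => hasMExpansion_amplitude_of_lt hh hν hb hq hκ, fun j _ => rfl,
      fun j _ => by ring, fun α hα hαb => abs_amplitude_sub_le_of_lt hν hb hα hαb,
      fun a ha => integral_abs_amplitude_le_exp hν hh.abs_le_one hb hq ha⟩
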